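/- Work on $\mathbb R^8$ with the Euclidean metric $\delta$. Let $\Phi$ be a constant Cayley form with metric $\delta$, i.e. a 4-form which in some orthonormal frame equals $$e^{0123}-e^{0145}+e^{0167}+e^{0246}+e^{0257}-e^{0347}+e^{0356}+e^{1247}-e^{1256}+e^{1346}+e^{1357}+e^{2345}-e^{2367}+e^{4567},$$ and let $\mathrm{Spin}(7)$ be its stabiliser. The operator $J_2(\beta)_{ab}=\tfrac12\Phi_{ab}{}^{pq}\beta_{pq}$ on 2-forms has eigenvalues $-3$ and $1$; let $\Lambda^2_7$ be the eigenspace for $-3$. A field $\psi=(h,\xi)$ consists of a symmetric tensor $h_{ab}$ (with trace $h$) and a 2-form $\xi\in\Lambda^2_7$. It describes the perturbation $\phi_{abcd}=-4\big(h_{[a}{}^p+\tfrac14\xi_{[a}{}^p\big)\Phi_{bcd]p}$ of $\Phi$. A *Lagrangian* is a constant-coefficient expression $A^{ab}(\psi,\partial_a\partial_b\psi)+B^{ab}(\partial_a\psi,\partial_b\psi)$, quadratic in $\psi$ with two derivatives, whose action $\int\mathcal L$ on smooth compactly supported fields is $\mathrm{Spin}(7)$-invariant. Two Lagrangians are identified,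 written $\simeq$, if they have the same action on all such fields, i.e. if they differ by a total derivative. A Lagrangian is *diffeomorphism invariant* if its action is unchanged under $\psi\mapsto\psi+\delta\psi$ whenever $\delta\phi=\mathcal L_v\Phi$ for a smooth compactly supported vector field $v$. Then the following hold. 1. Every such $v$ has exactly one field variation, namely $$\delta h_{ab}=\partial_{(a}v_{b)},\qquad \delta\xi_{ab}=\partial_{[a}v_{b]}-\tfrac12\Phi_{ab}{}^{pq}\partial_pv_q .$$ 2. Up to $\simeq$, the Lagrangians are exactly $$\tfrac\rho2(\partial_ah_{bc})^2+\tfrac\alpha2(\partial_ah)^2-\beta h\partial^a\partial^bh_{ab}-\gamma(\partial^ah_{ab})^2+\tfrac\lambda2(\partial_a\xi_{bc})^2-\mu\,\partial_bh^{ba}\partial^c\xi_{ca}\qquad(\ast)$$ with $\rho,\alpha,\beta,\gamma,\lambda,\mu\in\mathbb R$. The Lagrangian $(\ast)$ is diffeomorphism invariant if and only if $$\alpha=-\rho+\mu,\quad \beta=\rho-\mu,\quad \gamma=\rho-\tfrac\mu2,\quad \lambda=\tfrac\mu8,$$ and it is then equal to $\rho\mathcal L_{GR}+\mu\mathcal L'$,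 where $$\mathcal L_{GR}=\tfrac12(\partial_ah_{bc})^2-\tfrac12(\partial_ah)^2-h\partial^a\partial^bh_{ab}-(\partial^ah_{ab})^2,$$ $$\mathcal L'=\tfrac12(\partial_ah)^2+h\partial^a\partial^bh_{ab}+\tfrac12(\partial^ah_{ab})^2+\tfrac1{16}(\partial_c\xi_{ab})^2-\partial_bh^{ba}\partial^c\xi_{ca}.$$ 3. A Lagrangian $\mathcal L$ is diffeomorphism invariant if and only if $\mathcal L\simeq\rho\mathcal L_{GR}+\mu\mathcal L'$ for some $(\rho,\mu)\in\mathbb R^2$, and $(\rho,\mu)$ is then unique. 4. For $(\rho,\mu),(\rho',\mu')\neq(0,0)$, the actions of $\rho\mathcal L_{GR}+\mu\mathcal L'$ and $\rho'\mathcal L_{GR}+\mu'\mathcal L'$ are related by a rescaling $\psi\mapsto c\psi$, $c>0$, of the fields and an overall sign if and only if $\rho\mu'=\rho'\mu$. So up to rescaling there is a one-parameter family, parametrised by the ratio $\rho:\mu$. 5. If $\gamma\ne0$, then $(\ast)$ is $\simeq$ $$\tfrac\rho2(\partial_ah_{bc})^2+\Big(\tfrac\alpha2+\tfrac{\beta^2}{4\gamma}\Big)(\partial_ah)^2+\Big(\tfrac\lambda2+\tfrac{\mu^2}{32\gamma}\Big)(\partial_a\xi_{bc})^2-\gamma\Big(\partial^a\big(h_{ab}-\tfrac\beta{2\gamma}\delta_{ab}h+\tfrac\mu{2\gamma}\xi_{ab}\big)\Big)^2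 .$$ For the diffeomorphism-invariant Lagrangians with $\rho\neq0$ and $\gamma=\rho-\frac\mu2\ne0$, the gauge condition $\partial^a\big(h_{ab}-\frac\beta{2\gamma}\delta_{ab}h+\frac\mu{2\gamma}\xi_{ab}\big)=0$ can be imposed at the level of symbols: for every covector $p\ne0$ and every value $f$ of the fields there is exactly one gauge direction $\kappa$ at $p$ (a value of the variation in item 1 with $\partial_av_b$ replaced by $p_av_b$) such that $f+\kappa$ satisfies the condition with $\partial^a$ replaced by $p^a$. 6. The Euler-Lagrange equations of $\rho\mathcal L_{GR}+\mu\mathcal L'$ are elliptic modulo diffeomorphisms (for each covector $p\neq0$ the kernel of the principal symbol is exactly the space of gauge directions at $p$) if and only if $$\rho\ne0,\qquad \mu\ne0,\qquad 7\mu\ne6\rho .$$ In particular they are so for every generic member of the family. For $\mu=0$, $\rho\neq0$, where $\xi$ does not enter, the kernel of the symbol at $p\ne0$ consists of all $(h,\xi)$ such that $h_{ab}=p_{(a}v_{b)}$ for some $v$ (ellipticity modulo diffeomorphisms for $h$). -/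

import Mathlib

open scoped ContDiff

noncomputable section

namespace Cayley

/-- Flat eight-dimensional space with its Cartesian coordinates; indices are raised and lowered
with the Euclidean metric `δ`, so all indices are written downstairs. -/
abbrev E8 : Type := Fin 8 → ℝ

/-- Tensors with two indices. -/
abbrev T2 : Type := Fin 8 → Fin 8 → ℝ

/-- Tensors with four indices. -/
abbrev T4 : Type := Fin 8 → Fin 8 → Fin 8 → Fin 8 → ℝ

/-- The components of the 4-form `e^i ∧ e^j ∧ e^k ∧ e^l`. -/
def wedge (i j k l : Fin 8) (a b c d : Fin 8) : ℤ :=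
  Matrix.det (Matrix.of fun r s : Fin 4 => if ![i, j, k, l] r = ![a, b, c, d] s then (1 : ℤ) else 0)

/-- The standard Cayley form, with integer components. It is self-dual and its sign is the one for
which `β ↦ (1/2) Φ_{ab}^{pq} β_{pq}` has the eigenvalues `-3` (on `Λ²_7`) and `1` (on `Λ²_21`). -/
def cayleyZ (a b c d : Fin 8) : ℤ :=
  wedge 0 1 2 3 a b c d - wedge 0 1 4 5 a b c d + wedge 0 1 6 7 a b c d + wedge 0 2 4 6 a b c d
  + wedge 0 2 5 7 a b c d - wedge 0 3 4 7 a b c d + wedge 0 3 5 6 a b c d + wedge 1 2 4 7 a b c d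
  - wedge 1 2 5 6 a b c d + wedge 1 3 4 6 a b c d + wedge 1 3 5 7 a b c d + wedge 2 3 4 5 a b c d
  - wedge 2 3 6 7 a b c d + wedge 4 5 6 7 a b c d

/-- The standard Cayley form. -/
def cayley0 : T4 := fun a b c d => (cayleyZ a b c d : ℝ)

/-- The action of a matrix on tensors with four indices. -/
def act4 (g : Matrix (Fin 8) (Fin 8) ℝ) (Φ : T4) : T4 := fun a b c d =>
  ∑ i, ∑ j, ∑ k, ∑ l, g a i * g b j * g c k * g d l * Φ i j k l

/-- The action of a matrix on tensors with two indices. -/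
def act2 (g : Matrix (Fin 8) (Fin 8) ℝ) (t : T2) : T2 := fun a b =>
  ∑ i, ∑ j, g a i * g b j * t i j

/-- `Φ` is a (constant) Cayley form whose metric is `δ`: it has the standard components in some
orthonormal frame. -/
def IsCayleyForm (Φ : T4) : Prop :=
  ∃ g ∈ Matrix.orthogonalGroup (Fin 8) ℝ, Φ = act4 g cayley0

/-- `Spin(7)`, the stabiliser of `Φ`. -/
def spin7 (Φ : T4) : Set (Matrix (Fin 8) (Fin 8) ℝ) :=
  {g | g ∈ Matrix.orthogonalGroup (Fin 8) ℝ ∧ act4 g Φ = Φ}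

/-- The operator `J₂(β)_{ab} = (1/2) Φ_{ab}^{pq} β_{pq}`. -/
def J2 (Φ : T4) (β : T2) : T2 := fun a b => (1 / 2) * ∑ p, ∑ q, Φ a b p q * β p q

/-- The values of the fields: pairs `(h, ξ)` with `h` a symmetric tensor and `ξ ∈ Λ²_7`, the
eigenspace of `J₂` on 2-forms of eigenvalue `-3`. -/
def FieldSpace (Φ : T4) : Submodule ℝ (T2 × T2) where
  carrier := {f | (∀ a b, f.1 a b = f.1 b a) ∧ (∀ a b, f.2 a b = -f.2 b a) ∧
    ∀ a b, J2 Φ f.2 a b = -3 * f.2 a b}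
  add_mem' := by
    rintro f g ⟨h1, h2, h3⟩ ⟨k1, k2, k3⟩
    refine ⟨fun a b => ?_, fun a b => ?_, fun a b => ?_⟩
    · simp only [Prod.fst_add, Pi.add_apply]
      rw [h1 a b, k1 a b]
    · simp only [Prod.snd_add, Pi.add_apply]
      rw [h2 a b, k2 a b]; ring
    · have e : J2 Φ (f + g).2 a b = J2 Φ f.2 a b + J2 Φ g.2 a b := by
        simp only [J2, Prod.snd_add, Pi.add_apply, mul_add, Finset.sum_add_distrib]
      rw [e, h3, k3]
      simp only [Prod.snd_add, Pi.add_apply]; ring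
  zero_mem' := by
    refine ⟨fun a b => rfl, fun a b => ?_, fun a b => ?_⟩ <;> simp [J2]
  smul_mem' := by
    rintro c f ⟨h1, h2, h3⟩
    refine ⟨fun a b => ?_, fun a b => ?_, fun a b => ?_⟩
    · simp only [Prod.smul_fst, Pi.smul_apply]
      rw [h1 a b]
    · simp only [Prod.smul_snd, Pi.smul_apply, smul_eq_mul]
      rw [h2 a b]; ring
    · have e : J2 Φ (c • f).2 a b = c * J2 Φ f.2 a b := by
        simp only [J2, Prod.smul_snd, Pi.smul_apply, smul_eq_mul, Finset.mul_sum]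
        refine Finset.sum_congr rfl fun p _ => Finset.sum_congr rfl fun q _ => ?_
        ring
      rw [e, h3]
      simp only [Prod.smul_snd, Pi.smul_apply, smul_eq_mul]; ring

/-- Field configurations. -/
abbrev Field (Φ : T4) : Type := E8 → FieldSpace Φ

/-- Smooth and compactly supported. -/
def IsTest {F : Type*} [NormedAddCommGroup F] [NormedSpace ℝ F] (f : E8 → F) : Prop :=
  ContDiff ℝ ∞ f ∧ HasCompactSupport f

/-- The partial derivative `∂_a`. -/
def pd {F : Type*} [NormedAddCommGroup F] [NormedSpace ℝ F] (a : Fin 8) (f : E8 → F) : E8 → F :=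
  fun x => fderiv ℝ f x (Pi.single a 1)

/-- The infinitesimal action of `H ∈ Λ¹ ⊗ Λ¹` on `Φ`, that is
`4 H_{[a}^p Φ_{|p|bcd]} = -4 H_{[a}^p Φ_{bcd]p}`. -/
def infAct (Φ : T4) (H : T2) : T4 := fun a b c d =>
  ∑ p, (H a p * Φ p b c d + H b p * Φ a p c d + H c p * Φ a b p d + H d p * Φ a b c p)

/-- The perturbation `φ_{abcd} = -4 (h_{[a}^p + (1/4) ξ_{[a}^p) Φ_{bcd]p}` of the Cayley form. -/
def perturbation (Φ : T4) (f : FieldSpace Φ) : T4 :=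
  infAct Φ fun a b => f.1.1 a b + (1 / 4) * f.1.2 a b

/-- The Lie derivative of the constant 4-form `Φ` along the vector field `v`. -/
def lieDeriv (Φ : T4) (v : E8 → E8) (x : E8) : T4 :=
  infAct Φ fun a p => pd a (fun y => v y p) x

/-- `δ = (δh, δξ)` is the variation of the fields under the infinitesimal diffeomorphism `v`:
the perturbation of the Cayley form changes by the Lie derivative of `Φ`. -/
def IsDiffeoVariation (Φ : T4) (v : E8 → E8) (δ : Field Φ) : Prop :=
  ∀ x, perturbation Φ (δ x) = lieDeriv Φ v x

/-! ### Lagrangians -/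

/-- A translation-invariant Lagrangian that is quadratic in the fields and contains two
derivatives, `A^{ab}(ψ, ∂_a ∂_b ψ) + B^{ab}(∂_a ψ, ∂_b ψ)`, with arbitrary coefficients. -/
structure QuadLagrangian (Φ : T4) where
  A : Fin 8 → Fin 8 → LinearMap.BilinForm ℝ (FieldSpace Φ)
  B : Fin 8 → Fin 8 → LinearMap.BilinForm ℝ (FieldSpace Φ)

/-- The Lagrangian density. -/
def QuadLagrangian.density {Φ : T4} (L : QuadLagrangian Φ) (ψ : Field Φ) (x : E8) : ℝ :=
  ∑ a, ∑ b, (L.A a b (ψ x) (pd a (pd b ψ) x) + L.B a b (pd a ψ x) (pd b ψ x))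

/-- The action functional of a Lagrangian density. -/
def action {Φ : T4} (ℓ : Field Φ → E8 → ℝ) (ψ : Field Φ) : ℝ := ∫ x, ℓ ψ x

/-- Two densities have the same action (equivalently, for quadratic Lagrangians, they differ by a
total derivative). -/
def SameAction {Φ : T4} (ℓ ℓ' : Field Φ → E8 → ℝ) : Prop :=
  ∀ ψ : Field Φ, IsTest ψ → action ℓ ψ = action ℓ' ψ

/-- The action is invariant under rotations `(h, ξ)(x) ↦ (g h gᵀ, g ξ gᵀ)(g⁻¹ x)`, `g ∈ Spin(7)`. -/
def IsSpin7Invariant {Φ : T4} (ℓ : Field Φ → E8 → ℝ) : Prop :=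
  ∀ g ∈ spin7 Φ, ∀ ψ ψ' : Field Φ, IsTest ψ → IsTest ψ' →
    (∀ x, (ψ' (g.mulVec x)).1.1 = act2 g (ψ x).1.1 ∧ (ψ' (g.mulVec x)).1.2 = act2 g (ψ x).1.2) →
    action ℓ ψ' = action ℓ ψ

/-- The action is invariant under infinitesimal diffeomorphisms. -/
def IsDiffeoInvariant {Φ : T4} (ℓ : Field Φ → E8 → ℝ) : Prop :=
  ∀ ψ : Field Φ, IsTest ψ → ∀ v : E8 → E8, IsTest v → ∀ δ : Field Φ, IsDiffeoVariation Φ v δ →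
    action ℓ (ψ + δ) = action ℓ ψ

section densities

variable {Φ : T4}

/-- The component `h_{ab}` of a configuration. -/
def hc (ψ : Field Φ) (a b : Fin 8) : E8 → ℝ := fun x => (ψ x).1.1 a b

/-- The component `ξ_{ab}` of a configuration. -/
def xc (ψ : Field Φ) (a b : Fin 8) : E8 → ℝ := fun x => (ψ x).1.2 a b

/-- The trace `h = h^a_a`. -/
def trh (ψ : Field Φ) : E8 → ℝ := fun x => ∑ a, (ψ x).1.1 a a

/-- `(∂_a h_{bc})²` -/
def dhSq (ψ : Field Φ) (x : E8) : ℝ := ∑ a, ∑ b, ∑ c, (pd a (hc ψ b c) x) ^ 2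

/-- `(∂_a h)²` -/
def dtrSq (ψ : Field Φ) (x : E8) : ℝ := ∑ a, (pd a (trh ψ) x) ^ 2

/-- `h ∂^a ∂^b h_{ab}` -/
def hddh (ψ : Field Φ) (x : E8) : ℝ := trh ψ x * ∑ a, ∑ b, pd a (pd b (hc ψ a b)) x

/-- `(∂^a h_{ab})²` -/
def divhSq (ψ : Field Φ) (x : E8) : ℝ := ∑ b, (∑ a, pd a (hc ψ a b) x) ^ 2

/-- `(∂_a ξ_{bc})²` -/
def dxSq (ψ : Field Φ) (x : E8) : ℝ := ∑ a, ∑ b, ∑ c, (pd a (xc ψ b c) x) ^ 2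

/-- `∂_b h^{ba} ∂^c ξ_{ca}` -/
def divhdivx (ψ : Field Φ) (x : E8) : ℝ :=
  ∑ a, (∑ b, pd b (hc ψ b a) x) * (∑ c, pd c (xc ψ c a) x)

/-- The general linear combination of the six terms. -/
def lagXi (ρ α β γ lam μ : ℝ) (ψ : Field Φ) (x : E8) : ℝ :=
  ρ / 2 * dhSq ψ x + α / 2 * dtrSq ψ x - β * hddh ψ x - γ * divhSq ψ x
    + lam / 2 * dxSq ψ x - μ * divhdivx ψ x

/-- The linearised Einstein-Hilbert Lagrangian. -/
def lagGR (ψ : Field Φ) (x : E8) : ℝ :=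
  1 / 2 * dhSq ψ x - 1 / 2 * dtrSq ψ x - hddh ψ x - divhSq ψ x

/-- The second Lagrangian `L'`. -/
def lagPrime (ψ : Field Φ) (x : E8) : ℝ :=
  1 / 2 * dtrSq ψ x + hddh ψ x + 1 / 2 * divhSq ψ x + 1 / 16 * dxSq ψ x - divhdivx ψ x

/-- The family `ρ L_GR + μ L'`. -/
def lagDiff (ρ μ : ℝ) (ψ : Field Φ) (x : E8) : ℝ := ρ * lagGR ψ x + μ * lagPrime ψ x

/-- The gauge-fixing square `(∂^a (h_{ab} - s η_{ab} h + t ξ_{ab}))²`. -/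
def gaugeSq (s t : ℝ) (ψ : Field Φ) (x : E8) : ℝ :=
  ∑ b, (∑ a, pd a (fun y => hc ψ a b y - s * ((if a = b then 1 else 0) * trh ψ y)
    + t * xc ψ a b y) x) ^ 2

end densities

/-! ### Euler-Lagrange equations and ellipticity -/

/-- The Euler-Lagrange expression `∂L/∂ψ - ∂_a ∂L/∂ψ_a + ∂_a ∂_b ∂L/∂ψ_{ab}`, paired with `χ`, as a
function of the second derivatives `w a b = ∂_a ∂_b ψ`. -/
def QuadLagrangian.eulerLagrange {Φ : T4} (L : QuadLagrangian Φ)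
    (w : Fin 8 → Fin 8 → FieldSpace Φ) (χ : FieldSpace Φ) : ℝ :=
  ∑ a, ∑ b, (L.A a b χ (w a b) + L.A a b (w a b) χ - L.B a b χ (w a b) - L.B a b (w a b) χ)

/-- The kernel of the principal symbol at the covector `p` of the Euler-Lagrange operator, which is
obtained by replacing `∂_a ∂_b ψ` by `p_a p_b f`. -/
def QuadLagrangian.symbolKernel {Φ : T4} (L : QuadLagrangian Φ) (p : E8) : Set (FieldSpace Φ) :=
  {f | ∀ χ, L.eulerLagrange (fun a b => (p a * p b) • f) χ = 0}

/-- The image at the covector `p` of the principal symbol of the map from vector fields to field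
variations: `∂_a v_b` is replaced by `p_a v_b`. -/
def gaugeDirections (Φ : T4) (p : E8) : Set (FieldSpace Φ) :=
  {f | ∃ v : E8, perturbation Φ f = infAct Φ fun a b => p a * v b}

/-- The Euler-Lagrange equations are elliptic modulo diffeomorphisms: for every `p ≠ 0` the symbol
sequence (vector fields → fields → equations) is exact at the fields. -/
def QuadLagrangian.EllipticModuloGauge {Φ : T4} (L : QuadLagrangian Φ) : Prop :=
  ∀ p : E8, p ≠ 0 → L.symbolKernel p = gaugeDirections Φ p

/-- The principal symbol of the gauge condition `∂^a (h_{ab} - s η_{ab} h + t ξ_{ab})`. -/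
def gaugeCondSymbol {Φ : T4} (s t : ℝ) (p : E8) (f : FieldSpace Φ) : E8 := fun b =>
  ∑ a, p a * (f.1.1 a b - s * ((if a = b then 1 else 0) * ∑ c, f.1.1 c c) + t * f.1.2 a b)

end Cayley

end

noncomputable section
namespace Cayley

/-! ### Algebraic identities of the standard Cayley form -/

/-! Everything is reduced to the quadratic symbol of a Lagrangian, a function of a covector p and a
field value f, and then to the geometry of Λ²_7.

Algebra. The only facts used about the standard Cayley form are finite integer identities:
antisymmetry, the contraction Φ_{abpq}Φ_{cdpq}, and the Clifford relation ξ_{ac}ξ_{bc} = (1/8)|ξ|²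
δ_{ab} on Λ²_7. They are decided by evaluation and carried to any Φ by the orthogonal frame. The
contraction gives J₂² + 2J₂ - 3 = 0 on 2-forms. It also shows that the infinitesimal action of H on
Φ kills the eigenvalue-1 forms and is injective on symmetric tensors plus Λ²_7
(`IsCayleyForm.infAct_eq`, `IsCayleyForm.perturbation_eq_zero`). Hence every vector field has
exactly one field variation, given by `gaugeMap` applied to ∂v.

Analysis. Integration by parts turns the action into a pairing of ψ with its Euler-Lagrange
expression. Testing on cut-off polynomials (p·x)ⁿ/n! shows that equality of actions is equality of
quadratic symbols, that diffeomorphism invariance says the symbol annihilates the values of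
`gaugeMap` on p ⊗ v, and that Spin(7)-invariance of the action is Spin(7)-invariance of the symbol
(`QuadLagrangian.sameAction_iff`, `QuadLagrangian.isDiffeoInvariant_iff`,
`QuadLagrangian.isSpin7Invariant_iff`).

Classification. A differentiable Spin(7)-invariant function of three vectors is invariant under all
rotations (`IsSpinInvariant₃.fderiv_rotation`). Given ξ in Λ²_7, choose v ≠ 0 orthogonal to the
three vectors and to their images under ξ, which is six conditions in dimension eight. Then v ∧ ξv
annihilates the three vectors, while its Λ²_7 part is a nonzero multiple of ξ; so ξ acts as an
element of spin(7) does, and the derivative along it vanishes. Symmetric tensors are sums of squares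
u ⊗ u, and elements of Λ²_7 are projections of forms v ∧ ξv, so the blocks of the symbol become
functions of three vectors. Rotating these into a normal form leaves exactly the six terms.

The rest is linear algebra of the explicit symbol `sixTerms_symbol`. On gauge directions it is a
combination of four independent expressions, whose coefficients are the four relations for α, β, γ,
λ. The alternative form with the gauge-fixing square is a completed square, with the Clifford
relation supplying the ξ² term. For ellipticity, a gauge transformation achieves p^a h_{ab} = 0;
pairing with δ, with h and with ξ then gives the factors 7μ - 6ρ, ρ and μ, and each vanishing factor
produces a kernel element that is not a gauge direction. -/

/-- The components of the standard Cayley form. They vanish unless the last index is the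
bitwise sum of the other three; the signs are stored in base four. -/
def cayleyTable (a b c d : Fin 8) : ℤ :=
  bif (Nat.xor (Nat.xor a b) c).beq d then
    -- The base-four digit at position 64a + 8b + c is the sign increased by one, so that it is a
    -- natural number.
    Int.subNatNat ((Nat.shiftRight 59923134754752963312211741781481959310168169941083462742261545118215248410187373768097944291078577180213893741868806881439893806132941457553071853450596108222931567195249761248855071211058970477070740509231629215544302199361412202354606545598521685660974897673902639562178740392729947577650305797523117528405
      (2 * (64 * a + 8 * b + c))) % 4) 1
  else 0

/-- `x` if `i = a`, and `0` otherwise, in a form that the kernel evaluates quickly. -/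
def selectEq (i a : Fin 8) (x : ℤ) : ℤ := bif Nat.beq i a then x else 0

/-- The Kronecker symbol. -/
def kron (i a : Fin 8) : ℤ := if i = a then 1 else 0

/-- The `2 × 2` minor of the matrix `δ`. -/
def minor₂ (k l c d : Fin 8) : ℤ := selectEq k c (selectEq l d 1) - selectEq k d (selectEq l c 1)

/-- The `3 × 3` minor of the matrix `δ`. -/
def minor₃ (j k l b c d : Fin 8) : ℤ :=
  selectEq j b (minor₂ k l c d) - selectEq j c (minor₂ k l b d) + selectEq j d (minor₂ k l b c)

theorem selectEq_eq (i a : Fin 8) (x : ℤ) : selectEq i a x = kron i a * x := by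
  by_cases h : i = a
  · simp [selectEq, kron, h]
  · have : Nat.beq i a = false := by
      rw [← Bool.not_eq_true, Nat.beq_eq]; exact fun e => h (Fin.ext e)
    simp [selectEq, kron, h, this]

theorem det_fin_four (M : Matrix (Fin 4) (Fin 4) ℤ) : M.det =
    M 0 0 * (M 1 1 * (M 2 2 * M 3 3 - M 2 3 * M 3 2) - M 1 2 * (M 2 1 * M 3 3 - M 2 3 * M 3 1)
      + M 1 3 * (M 2 1 * M 3 2 - M 2 2 * M 3 1))
    - M 0 1 * (M 1 0 * (M 2 2 * M 3 3 - M 2 3 * M 3 2) - M 1 2 * (M 2 0 * M 3 3 - M 2 3 * M 3 0)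
      + M 1 3 * (M 2 0 * M 3 2 - M 2 2 * M 3 0))
    + M 0 2 * (M 1 0 * (M 2 1 * M 3 3 - M 2 3 * M 3 1) - M 1 1 * (M 2 0 * M 3 3 - M 2 3 * M 3 0)
      + M 1 3 * (M 2 0 * M 3 1 - M 2 1 * M 3 0))
    - M 0 3 * (M 1 0 * (M 2 1 * M 3 2 - M 2 2 * M 3 1) - M 1 1 * (M 2 0 * M 3 2 - M 2 2 * M 3 0)
      + M 1 2 * (M 2 0 * M 3 1 - M 2 1 * M 3 0)) := by
  rw [Matrix.det_succ_row_zero]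
  simp [Fin.sum_univ_succ, Matrix.det_fin_three, Fin.succAbove]
  ring!

/-- Laplace expansion into nested `selectEq` branches short-circuits as soon as two indices differ,
which makes evaluation of all components feasible where the determinant over permutations is not. -/
theorem wedge_eq_minors (i j k l a b c d : Fin 8) : wedge i j k l a b c d =
    selectEq i a (minor₃ j k l b c d) - selectEq i b (minor₃ j k l a c d) +
    selectEq i c (minor₃ j k l a b d) - selectEq i d (minor₃ j k l a b c) := by
  change Matrix.det (Matrix.of fun r s : Fin 4 => kron (![i, j, k, l] r) (![a, b, c, d] s)) = _
  simp only [selectEq_eq, minor₃, minor₂, det_fin_four, Matrix.of_apply, Matrix.cons_val]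
  ring

theorem cayleyZ_eq_table : ∀ a b c d : Fin 8, cayleyZ a b c d = cayleyTable a b c d := by
  simp only [cayleyZ, wedge_eq_minors]
  decide +kernel

theorem cayleyZ_swap₁₂ (a b c d : Fin 8) : cayleyZ b a c d = -cayleyZ a b c d := by
  simp only [cayleyZ_eq_table]
  revert a b c d
  decide +kernel

theorem cayleyZ_swap₂₃ (a b c d : Fin 8) : cayleyZ a c b d = -cayleyZ a b c d := by
  simp only [cayleyZ_eq_table]
  revert a b c d
  decide +kernel

theorem cayleyZ_swap₃₄ (a b c d : Fin 8) : cayleyZ a b d c = -cayleyZ a b c d := by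
  simp only [cayleyZ_eq_table]
  revert a b c d
  decide +kernel

/-- The quadratic identity behind the spectrum of J₂: as an operator identity on 2-forms it reads
J₂² = 3 - 2J₂. -/
theorem cayleyZ_contract (a b c d : Fin 8) : ∑ p, ∑ q, cayleyZ a b p q * cayleyZ c d p q =
    6 * ((if a = c then 1 else 0) * (if b = d then 1 else 0)
      - (if a = d then 1 else 0) * (if b = c then 1 else 0)) - 4 * cayleyZ a b c d := by
  have h : ∀ a b c d : Fin 8, ∑ p, ∑ q, cayleyTable a b p q * cayleyTable c d p q =
      6 * (selectEq a c (selectEq b d 1) - selectEq a d (selectEq b c 1))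
        - 4 * cayleyTable a b c d := by
    simp only [Fin.sum_univ_eight]
    decide +kernel
  simpa only [selectEq_eq, kron, mul_one, cayleyZ_eq_table] using h a b c d

end Cayley
end

/-! ### The standard Λ²_7 in components -/

noncomputable section
namespace Cayley

/-- The components of the isomorphism `ℝ⁷ → Λ²_7` whose inverse is `ξ ↦ ξ_{0k}`. -/
def asdFrame (k c d : Fin 8) : ℤ :=
  selectEq 0 c (selectEq k d 1) - selectEq 0 d (selectEq k c 1) - cayleyTable 0 k c d

/-- Let D(ξ) = ξ_{cd} - Σ_k `asdFrame k c d` ξ_{0k}. This is the identity D ∘ J₂ = D on 2-forms in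
components; on the eigenspace for -3 it forces -3D = D, so D vanishes there. -/
theorem asdFrame_cayley (c d p q : Fin 8) :
    cayleyTable c d p q - ∑ k, asdFrame k c d * cayleyTable 0 k p q =
      selectEq c p (selectEq d q 1) - selectEq c q (selectEq d p 1)
        - (selectEq 0 p (asdFrame q c d) - selectEq 0 q (asdFrame p c d)) := by
  simp only [Fin.sum_univ_eight]
  revert c d p q
  decide +kernel

/-- The seven frame forms satisfy the Clifford relations. The frame form with k = 0 is zero, whence
the factor 1 - δ_{0k}. -/
theorem asdFrame_clifford (a b k l : Fin 8) :
    ∑ c, (asdFrame k a c * asdFrame l b c + asdFrame l a c * asdFrame k b c) =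
      2 * (selectEq a b (selectEq k l (1 - selectEq 0 k 1))) := by
  simp only [Fin.sum_univ_eight]
  revert a b k l
  decide +kernel

/-- The component form of `J₂ ξ = -3 ξ`: the standard `Λ²_7` is the graph of `asdFrame`. -/
theorem eq_sum_asdFrame {ξ : T2} (hξ : ∀ a b, ξ a b = -ξ b a)
    (h : ∀ a b, J2 cayley0 ξ a b = -3 * ξ a b) (c d : Fin 8) :
    ξ c d = ∑ k, asdFrame k c d * ξ 0 k := by
  have hd : ∀ (a b : Fin 8) (x : ℤ), ((selectEq a b x : ℤ) : ℝ) = if a = b then (x : ℝ) else 0 := by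
    intro a b x
    rw [selectEq_eq, kron]; split_ifs <;> simp
  have h1 : J2 cayley0 ξ c d - ∑ k, (asdFrame k c d : ℝ) * J2 cayley0 ξ 0 k =
      (1 / 2) * ∑ p, ∑ q, ((cayleyTable c d p q - ∑ k, asdFrame k c d * cayleyTable 0 k p q : ℤ) : ℝ)
        * ξ p q := by
    simp only [J2, cayley0, cayleyZ_eq_table]
    push_cast
    simp only [sub_mul, Finset.sum_sub_distrib, mul_sub, Finset.mul_sum, Finset.sum_mul]
    congr 1
    rw [Finset.sum_comm]
    refine Finset.sum_congr rfl fun p _ => ?_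
    rw [Finset.sum_comm]
    refine Finset.sum_congr rfl fun q _ => Finset.sum_congr rfl fun k _ => ?_
    ring
  have h2 : ∑ p, ∑ q, ((cayleyTable c d p q - ∑ k, asdFrame k c d * cayleyTable 0 k p q : ℤ) : ℝ)
        * ξ p q = 2 * (ξ c d - ∑ k, asdFrame k c d * ξ 0 k) := by
    simp only [asdFrame_cayley]
    push_cast [hd]
    simp only [sub_mul, Finset.sum_sub_distrib, ite_mul, zero_mul, Finset.sum_ite_eq,
      Finset.mem_univ, if_true, one_mul]
    simp only [Finset.sum_ite_irrel, Finset.sum_const_zero, Finset.sum_ite_eq, Finset.mem_univ,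
      if_true]
    rw [hξ d c]
    have : ∀ x, (asdFrame x c d : ℝ) * ξ x 0 = -(asdFrame x c d * ξ 0 x) := by
      intro x; rw [hξ x 0]; ring
    simp only [this, Finset.sum_neg_distrib]
    ring
  -- The left side of `h1` becomes -3D and the right side D, where D is the difference of the two
  -- sides of the goal.
  rw [h2, h] at h1
  simp only [h] at h1
  have h3 : ∑ k, (asdFrame k c d : ℝ) * (-3 * ξ 0 k) = -3 * ∑ k, asdFrame k c d * ξ 0 k := by
    rw [Finset.mul_sum]; refine Finset.sum_congr rfl fun k _ => ?_; ring
  rw [h3] at h1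
  linarith

theorem cayley0_clifford {ξ : T2} (hξ : ∀ a b, ξ a b = -ξ b a)
    (h : ∀ a b, J2 cayley0 ξ a b = -3 * ξ a b) (a b : Fin 8) :
    ∑ c, ξ a c * ξ b c = if a = b then ∑ k, ξ 0 k ^ 2 else 0 := by
  have hd : ∀ (a b : Fin 8) (x : ℤ), ((selectEq a b x : ℤ) : ℝ) = if a = b then (x : ℝ) else 0 := by
    intro a b x
    rw [selectEq_eq, kron]; split_ifs <;> simp
  have h0 : ξ 0 0 = 0 := by have := hξ 0 0; linarith
  have e1 : ∑ c, ξ a c * ξ b c =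
      ∑ k, ∑ l, (∑ c, (asdFrame k a c : ℝ) * asdFrame l b c) * (ξ 0 k * ξ 0 l) := by
    calc ∑ c, ξ a c * ξ b c
        = ∑ c, ∑ k, ∑ l, (asdFrame k a c : ℝ) * asdFrame l b c * (ξ 0 k * ξ 0 l) := by
          refine Finset.sum_congr rfl fun c _ => ?_
          rw [eq_sum_asdFrame hξ h a c, eq_sum_asdFrame hξ h b c, Finset.sum_mul_sum]
          refine Finset.sum_congr rfl fun k _ => Finset.sum_congr rfl fun l _ => ?_
          ring
      _ = _ := by
          rw [Finset.sum_comm]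
          refine Finset.sum_congr rfl fun k _ => ?_
          rw [Finset.sum_comm]
          refine Finset.sum_congr rfl fun l _ => ?_
          rw [Finset.sum_mul]
  -- The factor ξ_{0k}ξ_{0l} is symmetric, so averaging with the sum in which k and l are exchanged
  -- brings in the anticommutator of frame forms.
  have e2 : ∑ c, ξ a c * ξ b c =
      ∑ k, ∑ l, (∑ c, (asdFrame l a c : ℝ) * asdFrame k b c) * (ξ 0 k * ξ 0 l) := by
    rw [e1, Finset.sum_comm]
    refine Finset.sum_congr rfl fun k _ => Finset.sum_congr rfl fun l _ => ?_
    ring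
  have e3 : ∀ k l, (∑ c, (asdFrame k a c : ℝ) * asdFrame l b c)
      + (∑ c, (asdFrame l a c : ℝ) * asdFrame k b c) =
      2 * (if a = b then if k = l then 1 - (if 0 = k then 1 else 0) else 0 else 0) := by
    intro k l
    have := congrArg (Int.cast : ℤ → ℝ) (asdFrame_clifford a b k l)
    push_cast [hd] at this
    rw [← Finset.sum_add_distrib]
    exact this
  have e4 : 2 * ∑ c, ξ a c * ξ b c = ∑ k, ∑ l,
      2 * (if a = b then if k = l then 1 - (if 0 = k then 1 else 0) else 0 else 0) * (ξ 0 k * ξ 0 l) := by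
    rw [two_mul]
    nth_rewrite 1 [e1]
    rw [e2, ← Finset.sum_add_distrib]
    refine Finset.sum_congr rfl fun k _ => ?_
    rw [← Finset.sum_add_distrib]
    refine Finset.sum_congr rfl fun l _ => ?_
    rw [← add_mul, e3]
  have e5 : ∑ k, ∑ l,
      2 * (if a = b then if k = l then 1 - (if (0 : Fin 8) = k then (1 : ℝ) else 0) else 0 else 0)
        * (ξ 0 k * ξ 0 l) = 2 * (if a = b then ∑ k, ξ 0 k ^ 2 else 0) := by
    by_cases hab : a = b
    · simp only [hab, if_true, Finset.mul_sum]
      refine Finset.sum_congr rfl fun k _ => ?_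
      rw [Finset.sum_eq_single k]
      · by_cases hk : 0 = k
        · subst hk; simp [h0]
        · simp [hk]; ring
      · intro l _ hl; simp [hl.symm]
      · simp
    · simp [hab]
  linarith [e4.trans e5]

end Cayley
end

noncomputable section
namespace Cayley

/-! ### Identities of a general Cayley form -/

/-- The inner product of tensors with two indices. -/
def frob (s t : T2) : ℝ := ∑ a, ∑ b, s a b * t a b

theorem of_act2 (g : Matrix (Fin 8) (Fin 8) ℝ) (t : T2) :
    Matrix.of (act2 g t) = g * Matrix.of t * g.transpose := by
  ext a b
  simp only [act2, Matrix.mul_apply, Matrix.of_apply, Matrix.transpose_apply, Finset.sum_mul]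
  rw [Finset.sum_comm]
  refine Finset.sum_congr rfl fun i _ => Finset.sum_congr rfl fun j _ => ?_
  ring

theorem sum_orthogonal_row {g : Matrix (Fin 8) (Fin 8) ℝ} (hg : g ∈ Matrix.orthogonalGroup (Fin 8) ℝ)
    (i j : Fin 8) : ∑ a, g i a * g j a = if i = j then 1 else 0 := by
  have := congrFun (congrFun ((Matrix.mem_orthogonalGroup_iff (Fin 8) ℝ).1 hg) i) j
  simpa [Matrix.mul_apply, Matrix.one_apply] using this

theorem act2_act2 (g k : Matrix (Fin 8) (Fin 8) ℝ) (t : T2) : act2 g (act2 k t) = act2 (g * k) t := by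
  apply Matrix.of.injective
  simp only [of_act2, Matrix.transpose_mul, Matrix.mul_assoc]

theorem act2_one (t : T2) : act2 1 t = t := by
  apply Matrix.of.injective
  simp [of_act2]

theorem frob_eq_trace (s t : T2) :
    frob s t = (Matrix.of s * (Matrix.of t).transpose : Matrix (Fin 8) (Fin 8) ℝ).trace := by
  simp [frob, Matrix.trace, Matrix.mul_apply]

theorem frob_act2 {g : Matrix (Fin 8) (Fin 8) ℝ} (hg : g ∈ Matrix.orthogonalGroup (Fin 8) ℝ)
    (s t : T2) : frob (act2 g s) (act2 g t) = frob s t := by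
  have h := (Matrix.mem_orthogonalGroup_iff' (Fin 8) ℝ).1 hg
  change g.transpose * g = 1 at h
  rw [frob_eq_trace, frob_eq_trace, of_act2, of_act2]
  rw [Matrix.transpose_mul, Matrix.transpose_mul, Matrix.transpose_transpose]
  calc _ = (g * (Matrix.of s * (g.transpose * g) * (Matrix.of t).transpose * g.transpose)).trace := by
        simp only [Matrix.mul_assoc]
    _ = _ := by
        rw [h, Matrix.trace_mul_comm, Matrix.mul_one, Matrix.mul_assoc, h, Matrix.mul_one]

theorem sum_comm_pairs (f : Fin 8 → Fin 8 → Fin 8 → Fin 8 → ℝ) :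
    ∑ i, ∑ j, ∑ k, ∑ l, f i j k l = ∑ k, ∑ l, ∑ i, ∑ j, f i j k l := by
  rw [Finset.sum_comm_cycle]
  exact Finset.sum_congr rfl fun k _ => Finset.sum_comm_cycle

theorem act4_eq_act2_right (g : Matrix (Fin 8) (Fin 8) ℝ) (Φ : T4) (a b : Fin 8) :
    act4 g Φ a b = act2 g fun k l => act2 g (fun i j => Φ i j k l) a b := by
  funext c d
  simp only [act4, act2, Finset.mul_sum]
  rw [sum_comm_pairs]
  refine Finset.sum_congr rfl fun k _ => Finset.sum_congr rfl fun l _ =>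
    Finset.sum_congr rfl fun i _ => Finset.sum_congr rfl fun j _ => ?_
  ring

theorem frob_comm (s t : T2) : frob s t = frob t s := by simp only [frob, mul_comm]

theorem act4_swap₁₂ (g : Matrix (Fin 8) (Fin 8) ℝ) {Φ : T4}
    (h : ∀ a b c d, Φ b a c d = -Φ a b c d) (a b c d : Fin 8) :
    act4 g Φ b a c d = -act4 g Φ a b c d := by
  simp only [act4]
  rw [Finset.sum_comm]
  simp only [← Finset.sum_neg_distrib]
  refine Finset.sum_congr rfl fun i _ => Finset.sum_congr rfl fun j _ =>
    Finset.sum_congr rfl fun k _ => Finset.sum_congr rfl fun l _ => ?_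
  rw [h]; ring

theorem act4_swap₂₃ (g : Matrix (Fin 8) (Fin 8) ℝ) {Φ : T4}
    (h : ∀ a b c d, Φ a c b d = -Φ a b c d) (a b c d : Fin 8) :
    act4 g Φ a c b d = -act4 g Φ a b c d := by
  simp only [act4, ← Finset.sum_neg_distrib]
  refine Finset.sum_congr rfl fun i _ => ?_
  rw [Finset.sum_comm]
  refine Finset.sum_congr rfl fun j _ =>
    Finset.sum_congr rfl fun k _ => Finset.sum_congr rfl fun l _ => ?_
  rw [h]; ring

theorem act4_swap₃₄ (g : Matrix (Fin 8) (Fin 8) ℝ) {Φ : T4}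
    (h : ∀ a b c d, Φ a b d c = -Φ a b c d) (a b c d : Fin 8) :
    act4 g Φ a b d c = -act4 g Φ a b c d := by
  simp only [act4, ← Finset.sum_neg_distrib]
  refine Finset.sum_congr rfl fun i _ => Finset.sum_congr rfl fun j _ => ?_
  rw [Finset.sum_comm]
  refine Finset.sum_congr rfl fun k _ => Finset.sum_congr rfl fun l _ => ?_
  rw [h]; ring

theorem J2_eq_frob (Φ : T4) (β : T2) (a b : Fin 8) : J2 Φ β a b = 1 / 2 * frob (Φ a b) β := rfl

theorem frob_act2_slices {g : Matrix (Fin 8) (Fin 8) ℝ} (Φ : T4) (β : T2) (a b : Fin 8) :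
    frob (fun k l => act2 g (fun i j => Φ i j k l) a b) β =
      act2 g (fun i j => frob (Φ i j) β) a b := by
  simp only [frob, act2, Finset.mul_sum, Finset.sum_mul]
  rw [sum_comm_pairs]
  refine Finset.sum_congr rfl fun k _ => Finset.sum_congr rfl fun l _ =>
    Finset.sum_congr rfl fun i _ => Finset.sum_congr rfl fun j _ => ?_
  ring

theorem J2_act {g : Matrix (Fin 8) (Fin 8) ℝ} (hg : g ∈ Matrix.orthogonalGroup (Fin 8) ℝ)
    (Φ : T4) (β : T2) : J2 (act4 g Φ) (act2 g β) = act2 g (J2 Φ β) := by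
  funext a b
  rw [J2_eq_frob, act4_eq_act2_right, frob_act2 hg, frob_act2_slices]
  simp only [act2, J2_eq_frob, Finset.mul_sum]
  refine Finset.sum_congr rfl fun i _ => Finset.sum_congr rfl fun j _ => ?_
  ring

theorem act2_delta {g : Matrix (Fin 8) (Fin 8) ℝ} (hg : g ∈ Matrix.orthogonalGroup (Fin 8) ℝ)
    (x : ℝ) (a b : Fin 8) : act2 g (fun i j => if i = j then x else 0) a b = if a = b then x else 0 := by
  have := sum_orthogonal_row hg a b
  simp only [act2, mul_ite, mul_zero, Finset.sum_ite_eq, Finset.mem_univ, if_true]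
  rw [← Finset.sum_mul, this]
  split_ifs <;> simp

theorem act2_smul (g : Matrix (Fin 8) (Fin 8) ℝ) (c : ℝ) (t : T2) : act2 g (c • t) = c • act2 g t := by
  funext a b
  simp only [act2, Pi.smul_apply, smul_eq_mul, Finset.mul_sum]
  refine Finset.sum_congr rfl fun i _ => Finset.sum_congr rfl fun j _ => ?_
  ring

theorem act2_add (g : Matrix (Fin 8) (Fin 8) ℝ) (s t : T2) : act2 g (s + t) = act2 g s + act2 g t := by
  funext a b
  simp only [act2, Pi.add_apply, mul_add, Finset.sum_add_distrib]

theorem act2_transpose_swap (g : Matrix (Fin 8) (Fin 8) ℝ) (t : T2) (a b : Fin 8) :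
    act2 g t b a = act2 g (fun i j => t j i) a b := by
  simp only [act2]
  rw [Finset.sum_comm]
  refine Finset.sum_congr rfl fun i _ => Finset.sum_congr rfl fun j _ => ?_
  ring

section
variable {Φ : T4}

theorem IsCayleyForm.swap₁₂ (hΦ : IsCayleyForm Φ) (a b c d : Fin 8) : Φ b a c d = -Φ a b c d := by
  obtain ⟨g, -, rfl⟩ := hΦ
  refine act4_swap₁₂ g (fun a b c d => ?_) a b c d
  simp only [cayley0, cayleyZ_swap₁₂ a b c d, Int.cast_neg]

theorem IsCayleyForm.swap₂₃ (hΦ : IsCayleyForm Φ) (a b c d : Fin 8) : Φ a c b d = -Φ a b c d := by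
  obtain ⟨g, -, rfl⟩ := hΦ
  refine act4_swap₂₃ g (fun a b c d => ?_) a b c d
  simp only [cayley0, cayleyZ_swap₂₃ a b c d, Int.cast_neg]

theorem IsCayleyForm.swap₃₄ (hΦ : IsCayleyForm Φ) (a b c d : Fin 8) : Φ a b d c = -Φ a b c d := by
  obtain ⟨g, -, rfl⟩ := hΦ
  refine act4_swap₃₄ g (fun a b c d => ?_) a b c d
  simp only [cayley0, cayleyZ_swap₃₄ a b c d, Int.cast_neg]

theorem IsCayleyForm.swap_pairs (hΦ : IsCayleyForm Φ) (a b c d : Fin 8) : Φ c d a b = Φ a b c d := by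
  rw [hΦ.swap₂₃, hΦ.swap₁₂, hΦ.swap₃₄, hΦ.swap₂₃]; ring

theorem IsCayleyForm.contract (hΦ : IsCayleyForm Φ) (a b c d : Fin 8) :
    frob (Φ a b) (Φ c d) = 6 * ((if a = c then 1 else 0) * (if b = d then 1 else 0)
      - (if a = d then 1 else 0) * (if b = c then 1 else 0)) - 4 * Φ a b c d := by
  obtain ⟨g, hg, rfl⟩ := hΦ
  have h0 : ∀ i j k l, frob (cayley0 i j) (cayley0 k l) =
      6 * ((if i = k then 1 else 0) * (if j = l then 1 else 0)
      - (if i = l then 1 else 0) * (if j = k then 1 else 0)) - 4 * cayley0 i j k l := by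
    intro i j k l
    have := congrArg (Int.cast : ℤ → ℝ) (cayleyZ_contract i j k l)
    push_cast at this
    exact this
  -- Orthogonality removes g from the contracted pair of indices, so only the two free pairs remain
  -- rotated.
  have h1 : frob (act4 g cayley0 a b) (act4 g cayley0 c d) =
      act2 g (fun i j => act2 g (fun k l => frob (cayley0 i j) (cayley0 k l)) c d) a b := by
    rw [act4_eq_act2_right, act4_eq_act2_right, frob_act2 hg, frob_act2_slices]
    refine congrFun (congrFun (congrArg (act2 g) (funext fun i => funext fun j => ?_)) a) b
    rw [frob_comm, frob_act2_slices]
    exact congrFun (congrFun (congrArg (act2 g) (funext fun k => funext fun l => frob_comm _ _)) c) d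
  have e := sum_orthogonal_row hg
  have h2 : ∀ a b c d, act4 g cayley0 a b c d =
      act2 g (fun i j => act2 g (fun k l => cayley0 i j k l) c d) a b := by
    intro a b c d
    simp only [act4, act2, Finset.mul_sum]
    refine Finset.sum_congr rfl fun i _ => Finset.sum_congr rfl fun j _ =>
      Finset.sum_congr rfl fun k _ => Finset.sum_congr rfl fun l _ => ?_
    ring
  have h3 : ∀ i j, act2 g (fun k l => 6 * ((if i = k then (1 : ℝ) else 0) * (if j = l then 1 else 0)
      - (if i = l then 1 else 0) * (if j = k then 1 else 0)) - 4 * cayley0 i j k l) c d =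
      6 * (g c i * g d j - g d i * g c j) - 4 * act2 g (cayley0 i j) c d := by
    intro i j
    simp only [act2, mul_sub, Finset.sum_sub_distrib, Finset.mul_sum]
    have hk : ∀ i j, ∑ k, ∑ l, g c k * g d l * (6 * ((if i = k then 1 else 0)
        * (if j = l then 1 else 0))) = 6 * (g c i * g d j) := by
      intro i j
      calc _ = ∑ k, ∑ l, 6 * ((g c k * (if i = k then 1 else 0)) * (g d l * (if j = l then 1 else 0))) := by
            refine Finset.sum_congr rfl fun k _ => Finset.sum_congr rfl fun l _ => ?_
            ring
        _ = _ := by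
            simp only [← Finset.mul_sum, ← Finset.sum_mul]
            simp
    have hk' : ∀ i j, ∑ k, ∑ l, g c k * g d l * (6 * ((if i = l then 1 else 0)
        * (if j = k then 1 else 0))) = 6 * (g d i * g c j) := by
      intro i j
      rw [mul_comm (g d i), ← hk]
      refine Finset.sum_congr rfl fun k _ => Finset.sum_congr rfl fun l _ => ?_
      ring
    rw [hk, hk']
    congr 1
    refine Finset.sum_congr rfl fun k _ => Finset.sum_congr rfl fun l _ => ?_
    ring
  rw [h1, h2]
  simp only [h0, h3]
  simp only [act2, mul_sub, Finset.sum_sub_distrib, Finset.mul_sum]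
  congr 1
  · rw [← e a c, ← e b d, ← e a d, ← e b c]
    rw [Finset.sum_mul_sum, Finset.sum_mul_sum]
    simp only [Finset.mul_sum]
    congr 1
    all_goals
      refine Finset.sum_congr rfl fun i _ => Finset.sum_congr rfl fun j _ => ?_
      ring
  · refine Finset.sum_congr rfl fun i _ => Finset.sum_congr rfl fun j _ =>
      Finset.sum_congr rfl fun k _ => Finset.sum_congr rfl fun l _ => ?_
    ring

/-- Elements of `Λ²_7` anticommute like the generators of a Clifford algebra. -/
theorem IsCayleyForm.clifford (hΦ : IsCayleyForm Φ) {ξ : T2} (hξ : ∀ a b, ξ a b = -ξ b a)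
    (h : ∀ a b, J2 Φ ξ a b = -3 * ξ a b) (a b : Fin 8) :
    ∑ c, ξ a c * ξ b c = if a = b then 1 / 8 * frob ξ ξ else 0 := by
  obtain ⟨g, hg, rfl⟩ := hΦ
  have h1 := (Matrix.mem_orthogonalGroup_iff (Fin 8) ℝ).1 hg
  have h2 := (Matrix.mem_orthogonalGroup_iff' (Fin 8) ℝ).1 hg
  change g * g.transpose = 1 at h1
  change g.transpose * g = 1 at h2
  -- Move ξ back to the standard frame, where the Clifford relation is known; the scalar is
  -- identified at the end by a trace.
  set β : T2 := act2 g.transpose ξ with hβ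
  have e1 : act2 g β = ξ := by rw [hβ, act2_act2, h1, act2_one]
  have hβa : ∀ a b, β a b = -β b a := by
    intro a b
    rw [hβ, act2_transpose_swap _ _ b a]
    have : (fun i j => ξ j i) = (-1 : ℝ) • ξ := by
      funext i j; rw [hξ j i]; simp
    rw [this, act2_smul]; simp
  have hβJ : J2 cayley0 β = (-3 : ℝ) • β := by
    have e2 : act2 g (J2 cayley0 β) = act2 g ((-3 : ℝ) • β) := by
      rw [← J2_act hg, e1, act2_smul, e1]
      funext a b; exact h a b
    have := congrArg (act2 g.transpose) e2
    rwa [act2_act2, act2_act2, h2, act2_one, act2_one] at this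
  have hc := cayley0_clifford hβa (fun a b => by rw [hβJ]; rfl)
  set x := ∑ k, β 0 k ^ 2
  have hx : ∀ a b, ∑ c, ξ a c * ξ b c = if a = b then x else 0 := by
    intro a b
    rw [← act2_delta hg x a b, ← e1]
    have : (fun i j => if i = j then x else 0) = fun i j => ∑ c, β i c * β j c := by
      funext i j; rw [hc]
    rw [this]
    have m1 : Matrix.of (fun i j => ∑ c, β i c * β j c) = Matrix.of β * (Matrix.of β).transpose := by
      ext i j; simp [Matrix.mul_apply]
    have m2 : ∑ c, act2 g β a c * act2 g β b c =
        (Matrix.of (act2 g β) * (Matrix.of (act2 g β)).transpose) a b := by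
      simp [Matrix.mul_apply]
    have m3 : Matrix.of (act2 g β) * (Matrix.of (act2 g β)).transpose =
        Matrix.of (act2 g fun i j => ∑ c, β i c * β j c) := by
      rw [of_act2 g β, of_act2 g (fun i j => ∑ c, β i c * β j c), m1, Matrix.transpose_mul, Matrix.transpose_mul,
        Matrix.transpose_transpose]
      calc _ = g * Matrix.of β * (g.transpose * g) * (Matrix.of β).transpose * g.transpose := by
            simp only [Matrix.mul_assoc]
        _ = _ := by rw [h2, Matrix.mul_one]; simp only [Matrix.mul_assoc]
    rw [m2, m3, Matrix.of_apply]
  rw [hx]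
  have : frob ξ ξ = 8 * x := by
    simp only [frob, hx, if_true]; simp
  rw [this]; congr 1; ring

end

end Cayley
end

noncomputable section
namespace Cayley

/-! ### The decomposition of `Λ¹ ⊗ Λ¹` and the infinitesimal action -/

/-- The symmetric part of a tensor. -/
def symPart (H : T2) : T2 := fun a b => 1 / 2 * (H a b + H b a)

/-- Four times the projection of a tensor to `Λ²_7`. -/
def asdPart (Φ : T4) (H : T2) : T2 := fun a b => 1 / 2 * (H a b - H b a) - J2 Φ H a b

theorem frob_add_left (s t u : T2) : frob (s + t) u = frob s u + frob t u := by
  simp only [frob, Pi.add_apply, add_mul, Finset.sum_add_distrib]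

theorem frob_smul_left (c : ℝ) (s u : T2) : frob (c • s) u = c * frob s u := by
  simp only [frob, Pi.smul_apply, smul_eq_mul, Finset.mul_sum, mul_assoc]

theorem frob_add_right (s t u : T2) : frob u (s + t) = frob u s + frob u t := by
  simp only [frob_comm u, frob_add_left]

theorem frob_smul_right (c : ℝ) (s u : T2) : frob u (c • s) = c * frob u s := by
  simp only [frob_comm u, frob_smul_left]

theorem frob_swap (s t : T2) : frob s (fun a b => t b a) = frob (fun a b => s b a) t := by
  simp only [frob]; rw [Finset.sum_comm]

theorem frob_sum_right {ι : Type*} (u : Finset ι) (s : T2) (x : ι → ℝ) (t : ι → T2) :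
    frob s (fun a b => ∑ p ∈ u, x p * t p a b) = ∑ p ∈ u, x p * frob s (t p) := by
  simp only [frob, Finset.mul_sum]
  rw [Finset.sum_comm_cycle]
  refine Finset.sum_congr rfl fun p _ => Finset.sum_congr rfl fun a _ =>
    Finset.sum_congr rfl fun b _ => ?_
  ring

theorem frob_self_nonneg (s : T2) : 0 ≤ frob s s :=
  Finset.sum_nonneg fun _ _ => Finset.sum_nonneg fun _ _ => mul_self_nonneg _

theorem frob_self_eq_zero {s : T2} (h : frob s s = 0) : s = 0 := by
  rw [frob, Finset.sum_eq_zero_iff_of_nonneg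
    (fun a _ => Finset.sum_nonneg fun b _ => mul_self_nonneg _)] at h
  funext a b
  have := h a (Finset.mem_univ a)
  rw [Finset.sum_eq_zero_iff_of_nonneg (fun b _ => mul_self_nonneg _)] at this
  exact mul_self_eq_zero.1 (this b (Finset.mem_univ b))

theorem J2_add (Φ : T4) (s t : T2) : J2 Φ (s + t) = J2 Φ s + J2 Φ t := by
  funext a b; simp only [J2_eq_frob, frob_add_right, Pi.add_apply, mul_add]

theorem J2_smul (Φ : T4) (c : ℝ) (s : T2) : J2 Φ (c • s) = c • J2 Φ s := by
  funext a b
  simp only [J2_eq_frob, frob_smul_right, Pi.smul_apply, smul_eq_mul]; ring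

theorem symPart_add (s t : T2) : symPart (s + t) = symPart s + symPart t := by
  funext a b; simp only [symPart, Pi.add_apply]; ring

theorem symPart_smul (c : ℝ) (s : T2) : symPart (c • s) = c • symPart s := by
  funext a b; simp only [symPart, Pi.smul_apply, smul_eq_mul]; ring

theorem asdPart_add (Φ : T4) (s t : T2) : asdPart Φ (s + t) = asdPart Φ s + asdPart Φ t := by
  funext a b; simp only [asdPart, J2_add, Pi.add_apply]; ring

theorem asdPart_smul (Φ : T4) (c : ℝ) (s : T2) : asdPart Φ (c • s) = c • asdPart Φ s := by
  funext a b; simp only [asdPart, J2_smul, Pi.smul_apply, smul_eq_mul]; ring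

theorem infAct_add (Φ : T4) (s t : T2) : infAct Φ (s + t) = infAct Φ s + infAct Φ t := by
  funext a b c d
  simp only [infAct, Pi.add_apply, ← Finset.sum_add_distrib]
  refine Finset.sum_congr rfl fun p _ => ?_
  ring

section
variable {Φ : T4}

theorem IsCayleyForm.J2_antisymm (hΦ : IsCayleyForm Φ) (H : T2) (a b : Fin 8) :
    J2 Φ H b a = -J2 Φ H a b := by
  simp only [J2]
  rw [← mul_neg, ← Finset.sum_neg_distrib]
  refine congrArg _ (Finset.sum_congr rfl fun p _ => ?_)
  rw [← Finset.sum_neg_distrib]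
  refine Finset.sum_congr rfl fun q _ => ?_
  rw [hΦ.swap₁₂ a b, neg_mul]

theorem IsCayleyForm.J2_swap (hΦ : IsCayleyForm Φ) (H : T2) :
    J2 Φ (fun a b => H b a) = -J2 Φ H := by
  funext a b
  rw [Pi.neg_apply, Pi.neg_apply, J2_eq_frob, J2_eq_frob, frob_swap, ← mul_neg]
  simp only [frob, ← Finset.sum_neg_distrib]
  refine congrArg _ (Finset.sum_congr rfl fun p _ => Finset.sum_congr rfl fun q _ => ?_)
  rw [hΦ.swap₃₄ a b p q, neg_mul]

/-- The contraction identity in operator form. It factors as (J₂ + 3)(J₂ - 1) = 0 on 2-forms, so (1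
- J₂)/4 and (3 + J₂)/4 are the projections to the eigenspaces for -3 and 1. -/
theorem IsCayleyForm.J2_J2 (hΦ : IsCayleyForm Φ) (H : T2) (a b : Fin 8) :
    J2 Φ (J2 Φ H) a b = 3 / 2 * (H a b - H b a) - 2 * J2 Φ H a b := by
  have e : J2 Φ (J2 Φ H) a b = 1 / 4 * ∑ r, ∑ s, frob (Φ a b) (Φ r s) * H r s := by
    simp only [J2, frob, Finset.mul_sum, Finset.sum_mul]
    rw [sum_comm_pairs]
    refine Finset.sum_congr rfl fun r _ => Finset.sum_congr rfl fun s _ =>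
      Finset.sum_congr rfl fun p _ => Finset.sum_congr rfl fun q _ => ?_
    rw [hΦ.swap_pairs r s p q]; ring
  rw [e]
  simp only [hΦ.contract, sub_mul, mul_sub, Finset.sum_sub_distrib]
  have e1 : ∑ r, ∑ s, 6 * ((if a = r then 1 else 0) * (if b = s then 1 else 0)) * H r s
      = 6 * H a b := by
    simp [mul_ite, ite_mul]
  have e2 : ∑ r, ∑ s, 6 * ((if a = s then 1 else 0) * (if b = r then 1 else 0)) * H r s
      = 6 * H b a := by
    simp [mul_ite, ite_mul, Finset.sum_ite_irrel]
  have e3 : ∑ r, ∑ s, 4 * Φ a b r s * H r s = 8 * J2 Φ H a b := by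
    simp only [J2, Finset.mul_sum]
    refine Finset.sum_congr rfl fun r _ => Finset.sum_congr rfl fun s _ => ?_
    ring
  rw [e1, e2, e3]; ring

theorem IsCayleyForm.J2_asdPart (hΦ : IsCayleyForm Φ) (H : T2) (a b : Fin 8) :
    J2 Φ (asdPart Φ H) a b = -3 * asdPart Φ H a b := by
  have : asdPart Φ H = (1 / 2 : ℝ) • (H + (-1 : ℝ) • (fun a b => H b a)) + (-1 : ℝ) • J2 Φ H := by
    funext a b
    simp only [asdPart, Pi.add_apply, Pi.smul_apply, smul_eq_mul]; ring
  rw [this, J2_add, J2_smul, J2_smul, J2_add, J2_smul, hΦ.J2_swap H]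
  simp only [Pi.add_apply, Pi.smul_apply, smul_eq_mul, Pi.neg_apply, hΦ.J2_J2]
  ring

theorem IsCayleyForm.asdPart_antisymm (hΦ : IsCayleyForm Φ) (H : T2) (a b : Fin 8) :
    asdPart Φ H a b = -asdPart Φ H b a := by
  simp only [asdPart, hΦ.J2_antisymm H a b]; ring

theorem IsCayleyForm.frob_J2 (hΦ : IsCayleyForm Φ) (s t : T2) :
    frob (J2 Φ s) t = frob s (J2 Φ t) := by
  simp only [J2, frob, Finset.mul_sum, Finset.sum_mul]
  rw [sum_comm_pairs]
  refine Finset.sum_congr rfl fun r _ => Finset.sum_congr rfl fun s _ =>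
    Finset.sum_congr rfl fun p _ => Finset.sum_congr rfl fun q _ => ?_
  rw [hΦ.swap_pairs r s p q]; ring

/-- The pairing of an element of `Λ²_7` with a tensor only sees the `Λ²_7` part. -/
theorem IsCayleyForm.frob_asdPart (hΦ : IsCayleyForm Φ) (H : T2) {η : T2}
    (hη : ∀ a b, η a b = -η b a) (h : ∀ a b, J2 Φ η a b = -3 * η a b) :
    frob (asdPart Φ H) η = 4 * frob H η := by
  have e : asdPart Φ H = (1 / 2 : ℝ) • (H + (-1 : ℝ) • (fun a b => H b a)) + (-1 : ℝ) • J2 Φ H := by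
    funext a b
    simp only [asdPart, Pi.add_apply, Pi.smul_apply, smul_eq_mul]; ring
  have e1 : frob (fun a b => H b a) η = - frob H η := by
    rw [← frob_swap]
    have : (fun a b => η b a) = (-1 : ℝ) • η := by funext a b; rw [hη b a]; simp
    rw [this, frob_smul_right]; ring
  have e2 : J2 Φ η = (-3 : ℝ) • η := by funext a b; exact h a b
  rw [e, frob_add_left, frob_smul_left, frob_add_left, frob_smul_left, frob_smul_left, e1,
    hΦ.frob_J2, e2, frob_smul_right]
  ring

theorem IsCayleyForm.asdPart_of_mem {η : T2}
    (hη : ∀ a b, η a b = -η b a) (h : ∀ a b, J2 Φ η a b = -3 * η a b) :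
    asdPart Φ η = (4 : ℝ) • η := by
  funext a b
  simp only [asdPart, h, Pi.smul_apply, smul_eq_mul, hη b a]; ring

/-- The field variation with symbol `H`, that is `(H_{(ab)}, H_{[ab]} - (1/2) Φ_{ab}^{pq} H_{pq})`. -/
def gaugeMap (hΦ : IsCayleyForm Φ) : T2 →ₗ[ℝ] FieldSpace Φ where
  toFun H := ⟨(symPart H, asdPart Φ H), fun a b => by simp only [symPart]; ring,
    hΦ.asdPart_antisymm H, hΦ.J2_asdPart H⟩
  map_add' s t := Subtype.ext (Prod.ext (symPart_add s t) (asdPart_add Φ s t))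
  map_smul' c s := Subtype.ext (Prod.ext (symPart_smul c s) (asdPart_smul Φ c s))

theorem IsCayleyForm.infAct_swap₁₂ (hΦ : IsCayleyForm Φ) (H : T2) (a b c d : Fin 8) :
    infAct Φ H b a c d = -infAct Φ H a b c d := by
  simp only [infAct, ← Finset.sum_neg_distrib]
  refine Finset.sum_congr rfl fun p _ => ?_
  rw [hΦ.swap₁₂ a p, hΦ.swap₁₂ p b, hΦ.swap₁₂ a b p d, hΦ.swap₁₂ a b c p]; ring

theorem IsCayleyForm.infAct_swap₂₃ (hΦ : IsCayleyForm Φ) (H : T2) (a b c d : Fin 8) :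
    infAct Φ H a c b d = -infAct Φ H a b c d := by
  simp only [infAct, ← Finset.sum_neg_distrib]
  refine Finset.sum_congr rfl fun p _ => ?_
  rw [hΦ.swap₂₃ p b c, hΦ.swap₂₃ a b p, hΦ.swap₂₃ a p c, hΦ.swap₂₃ a b c p]; ring

theorem IsCayleyForm.infAct_swap₃₄ (hΦ : IsCayleyForm Φ) (H : T2) (a b c d : Fin 8) :
    infAct Φ H a b d c = -infAct Φ H a b c d := by
  simp only [infAct, ← Finset.sum_neg_distrib]
  refine Finset.sum_congr rfl fun p _ => ?_
  rw [hΦ.swap₃₄ p b c d, hΦ.swap₃₄ a p c d, hΦ.swap₃₄ a b c p, hΦ.swap₃₄ a b p d]; ring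

/-- Contracting back with Φ recovers H up to what acts trivially: a symmetric H gives 24H + 18 tr(H)
δ, an element of Λ²_7 is multiplied by 96, and a form with J₂H = H is sent to zero. Both the kernel
and the injectivity of the infinitesimal action are read off from this. -/
theorem IsCayleyForm.infAct_contract (hΦ : IsCayleyForm Φ) (H : T2) (a e : Fin 8) :
    ∑ b, ∑ c, ∑ d, Φ e b c d * infAct Φ H a b c d =
      24 * H a e + (if a = e then 18 * ∑ p, H p p else 0) - 24 * J2 Φ H a e := by
  have t1 : ∑ b, ∑ c, ∑ d, Φ e b c d * ∑ p, H a p * Φ p b c d = 42 * H a e := by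
    calc _ = ∑ b, ∑ p, H a p * frob (Φ e b) (Φ p b) :=
          Finset.sum_congr rfl fun b _ => frob_sum_right _ (Φ e b) (H a) fun p => Φ p b
      _ = ∑ p, ∑ b, H a p * (6 * ((if e = p then 1 else 0)
            - (if e = b then 1 else 0) * (if b = p then 1 else 0))) := by
          rw [Finset.sum_comm]
          refine Finset.sum_congr rfl fun p _ => Finset.sum_congr rfl fun b _ => ?_
          have h0 : Φ e b p b = 0 := by
            have h1 := hΦ.swap₂₃ e b p b
            have h2 := hΦ.swap₃₄ e p b b
            linarith
          rw [hΦ.contract, h0]; simp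
      _ = _ := by
          simp only [mul_sub, Finset.sum_sub_distrib]
          simp [mul_ite]
          ring
  have t2 : ∑ b, ∑ c, ∑ d, Φ e b c d * ∑ p, H b p * Φ a p c d =
      6 * (if a = e then ∑ p, H p p else 0) - 6 * H a e - 8 * J2 Φ H a e := by
    calc _ = ∑ b, ∑ p, H b p * frob (Φ e b) (Φ a p) :=
          Finset.sum_congr rfl fun b _ => frob_sum_right _ (Φ e b) (H b) fun p => Φ a p
      _ = ∑ b, ∑ p, (H b p * (6 * ((if a = e then 1 else 0) * (if b = p then 1 else 0)))
            - H b p * (6 * ((if e = p then 1 else 0) * (if b = a then 1 else 0)))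
            - 4 * (Φ a e b p * H b p)) := by
          refine Finset.sum_congr rfl fun b _ => Finset.sum_congr rfl fun p _ => ?_
          rw [hΦ.contract, hΦ.swap₂₃ e a b p, hΦ.swap₁₂ a e]
          simp only [eq_comm (a := e) (b := a)]
          ring
      _ = _ := by
          simp only [Finset.sum_sub_distrib]
          congr 1
          · congr 1
            · by_cases h : a = e
              · simp [h, Finset.mul_sum, mul_comm]
              · simp [h]
            · simp [mul_comm]
          · simp only [J2, Finset.mul_sum]
            refine Finset.sum_congr rfl fun b _ => Finset.sum_congr rfl fun p _ => ?_
            ring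
  -- By antisymmetry of both copies of Φ, the three slots contracted with Φ contribute equally.
  have t3 : ∑ b, ∑ c, ∑ d, Φ e b c d * ∑ p, H c p * Φ a b p d =
      ∑ b, ∑ c, ∑ d, Φ e b c d * ∑ p, H b p * Φ a p c d := by
    rw [Finset.sum_comm]
    refine Finset.sum_congr rfl fun b _ => Finset.sum_congr rfl fun c _ =>
      Finset.sum_congr rfl fun d _ => ?_
    rw [hΦ.swap₂₃ e b c d, neg_mul, ← mul_neg, ← Finset.sum_neg_distrib]
    refine congrArg _ (Finset.sum_congr rfl fun p _ => ?_)
    rw [hΦ.swap₂₃ a p c d]; ring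
  have t4 : ∑ b, ∑ c, ∑ d, Φ e b c d * ∑ p, H d p * Φ a b c p =
      ∑ b, ∑ c, ∑ d, Φ e b c d * ∑ p, H c p * Φ a b p d := by
    refine Finset.sum_congr rfl fun b _ => ?_
    rw [Finset.sum_comm]
    refine Finset.sum_congr rfl fun c _ => Finset.sum_congr rfl fun d _ => ?_
    rw [hΦ.swap₃₄ e b c d, neg_mul, ← mul_neg, ← Finset.sum_neg_distrib]
    refine congrArg _ (Finset.sum_congr rfl fun p _ => ?_)
    rw [hΦ.swap₃₄ a b p d]; ring
  calc _ = ∑ b, ∑ c, ∑ d, Φ e b c d * (∑ p, H a p * Φ p b c d)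
        + ∑ b, ∑ c, ∑ d, Φ e b c d * (∑ p, H b p * Φ a p c d)
        + ∑ b, ∑ c, ∑ d, Φ e b c d * (∑ p, H c p * Φ a b p d)
        + ∑ b, ∑ c, ∑ d, Φ e b c d * (∑ p, H d p * Φ a b c p) := by
        simp only [infAct, Finset.sum_add_distrib, mul_add]
    _ = _ := by
        rw [t4, t3, t1, t2]
        split_ifs <;> ring

/-- A norm argument. Write I for the action of β on Φ. Expanding one factor of |I|² gives four
terms, each a contraction of β with the tensor Φ_{pbcd} I_{abcd}. By `infAct_contract` that tensor
is 24(β - J₂β) = 0, so |I|² = 0. -/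
theorem IsCayleyForm.infAct_eq_zero (hΦ : IsCayleyForm Φ) {β : T2} (hβ : ∀ a b, β a b = -β b a)
    (h : J2 Φ β = β) : infAct Φ β = 0 := by
  set I := infAct Φ β
  have hI₁₂ : ∀ a b c d, I b a c d = -I a b c d := hΦ.infAct_swap₁₂ β
  have hI₂₃ : ∀ a b c d, I a c b d = -I a b c d := hΦ.infAct_swap₂₃ β
  have hI₃₄ : ∀ a b c d, I a b d c = -I a b c d := hΦ.infAct_swap₃₄ β
  have hc : ∀ a p, ∑ b, ∑ c, ∑ d, Φ p b c d * I a b c d = 0 := by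
    intro a p
    have tr : ∑ p, β p p = 0 := Finset.sum_eq_zero fun q _ => by have := hβ q q; linarith
    rw [hΦ.infAct_contract, h, tr]; simp
  have t1 : ∑ a, ∑ b, ∑ c, ∑ d, I a b c d * ∑ p, β a p * Φ p b c d = 0 := by
    refine Finset.sum_eq_zero fun a _ => ?_
    calc _ = ∑ b, ∑ p, β a p * frob (I a b) (Φ p b) :=
          Finset.sum_congr rfl fun b _ => frob_sum_right _ (I a b) (β a) fun p => Φ p b
      _ = ∑ p, β a p * ∑ b, ∑ c, ∑ d, Φ p b c d * I a b c d := by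
          rw [Finset.sum_comm]
          simp only [frob, Finset.mul_sum, mul_comm]
      _ = 0 := by simp [hc]
  have t2 : ∑ a, ∑ b, ∑ c, ∑ d, I a b c d * ∑ p, β b p * Φ a p c d = 0 := by
    rw [← t1, Finset.sum_comm]
    refine Finset.sum_congr rfl fun a _ => Finset.sum_congr rfl fun b _ =>
      Finset.sum_congr rfl fun c _ => Finset.sum_congr rfl fun d _ => ?_
    rw [hI₁₂ a b, neg_mul, ← mul_neg, ← Finset.sum_neg_distrib]
    refine congrArg _ (Finset.sum_congr rfl fun p _ => ?_)
    rw [hΦ.swap₁₂ p b]; ring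
  have t3 : ∑ a, ∑ b, ∑ c, ∑ d, I a b c d * ∑ p, β c p * Φ a b p d = 0 := by
    rw [← t2]
    refine Finset.sum_congr rfl fun a _ => ?_
    rw [Finset.sum_comm]
    refine Finset.sum_congr rfl fun b _ =>
      Finset.sum_congr rfl fun c _ => Finset.sum_congr rfl fun d _ => ?_
    rw [hI₂₃ a b, neg_mul, ← mul_neg, ← Finset.sum_neg_distrib]
    refine congrArg _ (Finset.sum_congr rfl fun p _ => ?_)
    rw [hΦ.swap₂₃ a p c]; ring
  have t4 : ∑ a, ∑ b, ∑ c, ∑ d, I a b c d * ∑ p, β d p * Φ a b c p = 0 := by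
    rw [← t3]
    refine Finset.sum_congr rfl fun a _ => Finset.sum_congr rfl fun b _ => ?_
    rw [Finset.sum_comm]
    refine Finset.sum_congr rfl fun c _ => Finset.sum_congr rfl fun d _ => ?_
    rw [hI₃₄ a b, neg_mul, ← mul_neg, ← Finset.sum_neg_distrib]
    refine congrArg _ (Finset.sum_congr rfl fun p _ => ?_)
    rw [hΦ.swap₃₄ a b p d]; ring
  have hS : ∑ a, ∑ b, frob (I a b) (I a b) = 0 := by
    calc _ = ∑ a, ∑ b, ∑ c, ∑ d, I a b c d * (∑ p, β a p * Φ p b c d)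
          + ∑ a, ∑ b, ∑ c, ∑ d, I a b c d * (∑ p, β b p * Φ a p c d)
          + ∑ a, ∑ b, ∑ c, ∑ d, I a b c d * (∑ p, β c p * Φ a b p d)
          + ∑ a, ∑ b, ∑ c, ∑ d, I a b c d * (∑ p, β d p * Φ a b c p) := by
          simp only [← Finset.sum_add_distrib, ← mul_add]
          rfl
      _ = 0 := by rw [t1, t2, t3, t4]; simp
  funext a b
  rw [Finset.sum_eq_zero_iff_of_nonneg
    (fun a _ => Finset.sum_nonneg fun b _ => frob_self_nonneg _)] at hS
  have h1 := hS a (Finset.mem_univ a)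
  rw [Finset.sum_eq_zero_iff_of_nonneg (fun b _ => frob_self_nonneg _)] at h1
  exact frob_self_eq_zero (h1 b (Finset.mem_univ b))

theorem perturbation_eq (f : FieldSpace Φ) :
    perturbation Φ f = infAct Φ (f.1.1 + (1 / 4 : ℝ) • f.1.2) := rfl

/-- Only the symmetric and Λ²_7 parts of H move Φ. The factor 1/4 in the perturbation cancels the
factor four by which `asdPart` exceeds the projection. -/
theorem IsCayleyForm.infAct_eq (hΦ : IsCayleyForm Φ) (H : T2) :
    infAct Φ H = perturbation Φ (gaugeMap hΦ H) := by
  -- The remainder is (3 + J₂)/4 applied to the antisymmetric part of H, its component in the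
  -- eigenspace of eigenvalue 1.
  have e : H = (symPart H + (1 / 4 : ℝ) • asdPart Φ H) + fun a b =>
      1 / 4 * (3 / 2 * (H a b - H b a) + J2 Φ H a b) := by
    funext a b
    simp only [symPart, asdPart, Pi.add_apply, Pi.smul_apply, smul_eq_mul]; ring
  have e1 : infAct Φ (fun a b => 1 / 4 * (3 / 2 * (H a b - H b a) + J2 Φ H a b)) = 0 := by
    apply hΦ.infAct_eq_zero
    · intro a b; rw [hΦ.J2_antisymm H b a]; ring
    · have : (fun a b => 1 / 4 * (3 / 2 * (H a b - H b a) + J2 Φ H a b)) =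
          (1 / 4 : ℝ) • ((3 / 2 : ℝ) • (H + (-1 : ℝ) • (fun a b => H b a)) + J2 Φ H) := by
        funext a b
        simp only [Pi.add_apply, Pi.smul_apply, smul_eq_mul]; ring
      rw [this, J2_smul, J2_add, J2_smul, J2_add, J2_smul, hΦ.J2_swap H]
      funext a b
      simp only [Pi.add_apply, Pi.smul_apply, smul_eq_mul, Pi.neg_apply, hΦ.J2_J2]
      ring
  conv_lhs => rw [e]
  rw [infAct_add, e1, add_zero]
  rfl

/-- Contraction with Φ yields 24h + 24ξ + 18 tr(h) δ = 0. Its trace is 168 tr(h) = 0, after which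
the symmetric and antisymmetric parts vanish separately. -/
theorem IsCayleyForm.perturbation_eq_zero (hΦ : IsCayleyForm Φ) {f : FieldSpace Φ}
    (h : perturbation Φ f = 0) : f = 0 := by
  obtain ⟨⟨s, ξ⟩, hs, hx, hJ⟩ := f
  rw [perturbation_eq] at h
  have hc : ∀ a e, 24 * s a e + 24 * ξ a e + (if a = e then 18 * ∑ p, s p p else 0) = 0 := by
    intro a e
    have h1 := hΦ.infAct_contract (s + (1 / 4 : ℝ) • ξ) a e
    have h2 : ∑ p, ξ p p = 0 := Finset.sum_eq_zero fun q _ => by have := hx q q; linarith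
    have h3 : J2 Φ s a e = 0 := by
      have := congrFun (congrFun (hΦ.J2_swap s) a) e
      have e1 : (fun a b => s b a) = s := by funext a b; exact hs b a
      rw [e1, Pi.neg_apply, Pi.neg_apply] at this
      linarith
    have h4 := hJ a e
    dsimp only at h4
    rw [h, J2_add, J2_smul] at h1
    simp only [Pi.add_apply, Pi.smul_apply, smul_eq_mul, Finset.sum_add_distrib, ← Finset.mul_sum,
      h2, h3, h4, Pi.zero_apply, mul_zero, Finset.sum_const_zero, add_zero] at h1
    linarith
  have htr : ∑ p, s p p = 0 := by
    have h1 : ∑ a, (24 * s a a + 24 * ξ a a + (if a = a then 18 * ∑ p, s p p else 0)) = 0 :=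
      Finset.sum_eq_zero fun a _ => hc a a
    have h2 : ∑ p, ξ p p = 0 := Finset.sum_eq_zero fun q _ => by have := hx q q; linarith
    simp only [if_true, Finset.sum_add_distrib, ← Finset.mul_sum, h2, Finset.sum_const,
      Finset.card_univ, Fintype.card_fin, nsmul_eq_mul] at h1
    push_cast at h1
    linarith
  simp only [htr, mul_zero, ite_self, add_zero] at hc
  refine Subtype.ext (Prod.ext ?_ ?_)
  · funext a b
    have h1 := hc a b
    have h2 := hc b a
    have h3 := hs a b
    have h4 := hx a b
    dsimp only at *
    simp only [ZeroMemClass.coe_zero, Prod.fst_zero, Pi.zero_apply]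
    linarith
  · funext a b
    have h1 := hc a b
    have h2 := hc b a
    have h3 := hs a b
    have h4 := hx a b
    dsimp only at *
    simp only [ZeroMemClass.coe_zero, Prod.snd_zero, Pi.zero_apply]
    linarith

theorem perturbation_sub (f g : FieldSpace Φ) :
    perturbation Φ (f - g) = perturbation Φ f - perturbation Φ g := by
  have : f.1.1 + (1 / 4 : ℝ) • f.1.2 =
      ((f - g).1.1 + (1 / 4 : ℝ) • (f - g).1.2) + (g.1.1 + (1 / 4 : ℝ) • g.1.2) := by
    funext a b
    simp only [Pi.add_apply, Pi.smul_apply, smul_eq_mul, AddSubgroupClass.coe_sub, Prod.fst_sub,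
      Prod.snd_sub, Pi.sub_apply]
    ring
  simp only [perturbation_eq, this, infAct_add, add_sub_cancel_right]

theorem IsCayleyForm.perturbation_injective (hΦ : IsCayleyForm Φ) {f g : FieldSpace Φ}
    (h : perturbation Φ f = perturbation Φ g) : f = g :=
  sub_eq_zero.1 (hΦ.perturbation_eq_zero (by rw [perturbation_sub, h, sub_self]))

theorem IsCayleyForm.perturbation_eq_iff (hΦ : IsCayleyForm Φ) {f : FieldSpace Φ} {H : T2} :
    perturbation Φ f = infAct Φ H ↔ f = gaugeMap hΦ H := by
  rw [hΦ.infAct_eq H]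
  exact ⟨hΦ.perturbation_injective, fun h => by rw [h]⟩

end
end Cayley
end

noncomputable section
namespace Cayley
open MeasureTheory

/-! ### Partial derivatives and integration by parts -/

section calculus
variable {F G : Type*} [NormedAddCommGroup F] [NormedSpace ℝ F] [NormedAddCommGroup G]
  [NormedSpace ℝ G]

theorem contDiff_pd {f : E8 → F} (hf : ContDiff ℝ ∞ f) (a : Fin 8) : ContDiff ℝ ∞ (pd a f) := by
  have h : ContDiff ℝ ∞ (fderiv ℝ f) := hf.fderiv_right (by simp)
  exact h.clm_apply contDiff_const

theorem IsTest.pd {f : E8 → F} (hf : IsTest f) (a : Fin 8) : IsTest (pd a f) :=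
  ⟨contDiff_pd hf.1 a, hf.2.fderiv_apply (𝕜 := ℝ) (Pi.single a 1)⟩

theorem IsTest.add {f g : E8 → F} (hf : IsTest f) (hg : IsTest g) : IsTest (f + g) :=
  ⟨hf.1.add hg.1, hf.2.add hg.2⟩

theorem IsTest.const_smul {f : E8 → F} (hf : IsTest f) (c : ℝ) : IsTest (c • f) :=
  ⟨contDiff_const.smul hf.1, hf.2.smul_left (f := fun _ => c)⟩

theorem IsTest.zero : IsTest (0 : E8 → F) := ⟨contDiff_const, HasCompactSupport.zero⟩

theorem IsTest.clm {f : E8 → F} (hf : IsTest f) (T : F →L[ℝ] G) : IsTest (fun x => T (f x)) :=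
  ⟨T.contDiff.comp hf.1, hf.2.comp_left (g := T) (map_zero T)⟩

theorem pd_clm {f : E8 → F} (hf : ContDiff ℝ ∞ f) (T : F →L[ℝ] G) (a : Fin 8) :
    pd a (fun x => T (f x)) = fun x => T (pd a f x) := by
  funext x
  have h1 : HasFDerivAt f (fderiv ℝ f x) x := (hf.differentiable (by simp) x).hasFDerivAt
  have h := (T.hasFDerivAt.comp x h1).fderiv
  exact congrArg (fun L : E8 →L[ℝ] G => L (Pi.single a 1)) h

theorem pd_add {f g : E8 → F} (hf : ContDiff ℝ ∞ f) (hg : ContDiff ℝ ∞ g) (a : Fin 8) :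
    pd a (f + g) = pd a f + pd a g := by
  funext x
  have := fderiv_add (hf.differentiable (by simp) x) (hg.differentiable (by simp) x)
  exact congrArg (fun L : E8 →L[ℝ] F => L (Pi.single a 1)) this

theorem pd_comm {f : E8 → F} (hf : ContDiff ℝ ∞ f) (a b : Fin 8) :
    pd a (pd b f) = pd b (pd a f) := by
  funext x
  have hs : IsSymmSndFDerivAt ℝ f x := hf.contDiffAt.isSymmSndFDerivAt
    (by simpa using (WithTop.coe_le_coe.2 le_top : ((2 : ℕ∞) : WithTop ℕ∞) ≤ ∞))
  have hd : DifferentiableAt ℝ (fderiv ℝ f) x :=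
    (hf.fderiv_right (m := ∞) (by simp)).differentiable (by simp) x
  have e : ∀ a b, pd a (pd b f) x = fderiv ℝ (fderiv ℝ f) x (Pi.single a 1) (Pi.single b 1) := by
    intro a b
    have := (hd.hasFDerivAt.clm_apply (hasFDerivAt_const (Pi.single b (1 : ℝ) : E8) x)).fderiv
    change fderiv ℝ (fun y => fderiv ℝ f y (Pi.single b 1)) x (Pi.single a 1) = _
    rw [this]; simp
  rw [e, e]; exact hs _ _

variable [FiniteDimensional ℝ F]

theorem bilin_continuous (b : LinearMap.BilinForm ℝ F) {f g : E8 → F} (hf : Continuous f)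
    (hg : Continuous g) : Continuous fun x => b (f x) (g x) := by
  change Continuous fun x => b.toContinuousBilinearMap (f x) (g x)
  fun_prop

theorem bilin_integrable (b : LinearMap.BilinForm ℝ F) {f g : E8 → F} (hf : IsTest f)
    (hg : ContDiff ℝ ∞ g) : Integrable fun x => b (f x) (g x) := by
  refine (bilin_continuous b hf.1.continuous hg.continuous).integrable_of_hasCompactSupport ?_
  refine hf.2.mono fun x hx => ?_
  intro h0
  exact hx (by simp [h0])

theorem integral_bilin_pd (b : LinearMap.BilinForm ℝ F) {f g : E8 → F} (hf : IsTest f)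
    (hg : IsTest g) (a : Fin 8) : ∫ x, b (f x) (pd a g x) = -∫ x, b (pd a f x) (g x) :=
  integral_bilinear_fderiv_right_eq_neg_left_of_integrable (B := b.toContinuousBilinearMap)
    (bilin_integrable b (hf.pd a) hg.1) (bilin_integrable b hf (hg.pd a).1)
    (bilin_integrable b hf hg.1) (fun x _ => hf.1.differentiable (by simp) x)
    fun x _ => hg.1.differentiable (by simp) x

theorem integral_bilin_pd_pd (b : LinearMap.BilinForm ℝ F) {f g : E8 → F} (hf : IsTest f)
    (hg : IsTest g) (a c : Fin 8) :
    ∫ x, b (f x) (pd a (pd c g) x) = ∫ x, b (pd a (pd c f) x) (g x) := by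
  rw [integral_bilin_pd b hf (hg.pd c), integral_bilin_pd b (hf.pd a) hg, neg_neg,
    pd_comm hf.1]

end calculus

/-! ### Symbols -/

section symbols
variable {Φ : T4}

/-- The bilinear forms that enter the Euler-Lagrange expression. -/
def QuadLagrangian.coeff (L : QuadLagrangian Φ) (a b : Fin 8) :
    LinearMap.BilinForm ℝ (FieldSpace Φ) :=
  (L.A a b).flip + L.A a b - (L.B a b).flip - L.B a b

theorem QuadLagrangian.eulerLagrange_eq (L : QuadLagrangian Φ)
    (w : Fin 8 → Fin 8 → FieldSpace Φ) (χ : FieldSpace Φ) :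
    L.eulerLagrange w χ = ∑ a, ∑ b, L.coeff a b (w a b) χ := rfl

theorem QuadLagrangian.coeff_apply (L : QuadLagrangian Φ) (a b : Fin 8) (f χ : FieldSpace Φ) :
    L.coeff a b f χ = L.A a b χ f + L.A a b f χ - L.B a b χ f - L.B a b f χ := rfl

theorem QuadLagrangian.coeff_symm (L : QuadLagrangian Φ) (a b : Fin 8) (f χ : FieldSpace Φ) :
    L.coeff a b f χ = L.coeff a b χ f := by
  simp only [coeff_apply]; ring

/-- The principal symbol as a quadratic form: `∂_a ψ` is replaced by `p_a f`. -/
def QuadLagrangian.quadSymbol (L : QuadLagrangian Φ) (p : E8) (f : FieldSpace Φ) : ℝ :=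
  ∑ a, ∑ b, p a * p b * (L.B a b f f - L.A a b f f)

/-- The principal symbol of the Euler-Lagrange operator as a bilinear form. -/
def QuadLagrangian.symbol (L : QuadLagrangian Φ) (p : E8) : LinearMap.BilinForm ℝ (FieldSpace Φ) :=
  ∑ a, ∑ b, (p a * p b) • L.coeff a b

theorem QuadLagrangian.symbol_apply (L : QuadLagrangian Φ) (p : E8) (f χ : FieldSpace Φ) :
    L.symbol p f χ = ∑ a, ∑ b, p a * p b * L.coeff a b f χ := by
  simp [symbol, LinearMap.sum_apply]

theorem QuadLagrangian.symbol_symm (L : QuadLagrangian Φ) (p : E8) (f χ : FieldSpace Φ) :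
    L.symbol p f χ = L.symbol p χ f := by
  simp only [symbol_apply, fun a b => L.coeff_symm a b f χ]

theorem QuadLagrangian.symbol_self (L : QuadLagrangian Φ) (p : E8) (f : FieldSpace Φ) :
    L.symbol p f f = -2 * L.quadSymbol p f := by
  simp only [symbol_apply, quadSymbol, Finset.mul_sum, coeff_apply]
  refine Finset.sum_congr rfl fun a _ => Finset.sum_congr rfl fun b _ => ?_
  ring

/-- Polarisation: the bilinear symbol is determined by the quadratic one, so invariance and equality
need only be checked for `quadSymbol`. -/
theorem QuadLagrangian.symbol_eq_polar (L : QuadLagrangian Φ) (p : E8) (f χ : FieldSpace Φ) :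
    L.symbol p f χ = -(L.quadSymbol p (f + χ) - L.quadSymbol p f - L.quadSymbol p χ) := by
  have h1 := L.symbol_self p (f + χ)
  have h2 := L.symbol_self p f
  have h3 := L.symbol_self p χ
  have h4 := L.symbol_symm p f χ
  simp only [map_add, LinearMap.add_apply] at h1
  linarith

theorem QuadLagrangian.eulerLagrange_symbol (L : QuadLagrangian Φ) (p : E8) (f χ : FieldSpace Φ) :
    L.eulerLagrange (fun a b => (p a * p b) • f) χ = L.symbol p f χ := by
  rw [eulerLagrange_eq, symbol_apply]
  simp

theorem QuadLagrangian.mem_symbolKernel (L : QuadLagrangian Φ) (p : E8) (f : FieldSpace Φ) :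
    f ∈ L.symbolKernel p ↔ ∀ χ, L.symbol p f χ = 0 := by
  simp only [symbolKernel, Set.mem_ofPred_eq, eulerLagrange_symbol]

/-- The action as the pairing of the field with its Euler-Lagrange expression. -/
theorem QuadLagrangian.action_eq (L : QuadLagrangian Φ) {ψ : Field Φ} (hψ : IsTest ψ) :
    action L.density ψ = 1 / 2 * ∫ x, L.eulerLagrange (fun a b => pd a (pd b ψ) x) (ψ x) := by
  have hp : ∀ a b, IsTest (pd a (pd b ψ)) := fun a b => (hψ.pd b).pd a
  have i1 : ∀ a b, Integrable fun x => L.A a b (ψ x) (pd a (pd b ψ) x) := fun a b =>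
    bilin_integrable _ hψ (hp a b).1
  have i2 : ∀ a b, Integrable fun x => L.B a b (pd a ψ x) (pd b ψ x) := fun a b =>
    bilin_integrable _ (hψ.pd a) (hψ.pd b).1
  have i3 : ∀ a b, Integrable fun x => L.coeff a b (pd a (pd b ψ) x) (ψ x) := fun a b =>
    bilin_integrable _ (hp a b) hψ.1
  have e : ∀ a b, ∫ x, L.A a b (ψ x) (pd a (pd b ψ) x) + L.B a b (pd a ψ x) (pd b ψ x) =
      1 / 2 * ∫ x, L.coeff a b (pd a (pd b ψ) x) (ψ x) := by
    intro a b
    rw [integral_add (i1 a b) (i2 a b)]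
    have j1 := bilin_integrable (L.A a b) hψ (hp a b).1
    have j2 := bilin_integrable (L.A a b) (hp a b) hψ.1
    have j3 := bilin_integrable (L.B a b) hψ (hp a b).1
    have j4 := bilin_integrable (L.B a b) (hp a b) hψ.1
    have : ∫ x, L.coeff a b (pd a (pd b ψ) x) (ψ x) =
        (∫ x, L.A a b (ψ x) (pd a (pd b ψ) x)) + (∫ x, L.A a b (pd a (pd b ψ) x) (ψ x))
        - (∫ x, L.B a b (ψ x) (pd a (pd b ψ) x)) - ∫ x, L.B a b (pd a (pd b ψ) x) (ψ x) := by
      have j12 : Integrable fun x => L.A a b (ψ x) (pd a (pd b ψ) x) +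
        L.A a b (pd a (pd b ψ) x) (ψ x) := j1.add j2
      have j123 : Integrable fun x => L.A a b (ψ x) (pd a (pd b ψ) x) +
        L.A a b (pd a (pd b ψ) x) (ψ x) - L.B a b (ψ x) (pd a (pd b ψ) x) := j12.sub j3
      rw [← integral_add j1 j2, ← integral_sub j12 j3, ← integral_sub j123 j4]
      rfl
    rw [this, integral_bilin_pd_pd (L.A a b) hψ hψ, integral_bilin_pd_pd (L.B a b) hψ hψ]
    have k2 := integral_bilin_pd (L.B a b) (hψ.pd a) hψ b
    rw [k2, pd_comm hψ.1 b a]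
    ring
  have i12 : ∀ a b, Integrable fun x => L.A a b (ψ x) (pd a (pd b ψ) x) +
      L.B a b (pd a ψ x) (pd b ψ x) := fun a b => (i1 a b).add (i2 a b)
  simp only [action, density, eulerLagrange_eq]
  rw [integral_finsetSum _ fun a _ => integrable_finsetSum _ fun b _ => i12 a b,
    integral_finsetSum _ fun a _ => integrable_finsetSum _ fun b _ => i3 a b, Finset.mul_sum]
  refine Finset.sum_congr rfl fun a _ => ?_
  rw [integral_finsetSum _ fun b _ => i12 a b,
    integral_finsetSum _ fun b _ => i3 a b, Finset.mul_sum]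
  exact Finset.sum_congr rfl fun b _ => e a b

theorem QuadLagrangian.integrable_eulerLagrange (L : QuadLagrangian Φ) {ψ φ : Field Φ}
    (hψ : IsTest ψ) (hφ : ContDiff ℝ ∞ φ) :
    Integrable fun x => L.eulerLagrange (fun a b => pd a (pd b ψ) x) (φ x) :=
  integrable_finsetSum _ fun a _ => integrable_finsetSum _ fun b _ =>
    bilin_integrable (L.coeff a b) ((hψ.pd b).pd a) hφ

/-- Formal self-adjointness of the Euler-Lagrange operator: two integrations by parts together with
the symmetry of each `coeff a b`. -/
theorem QuadLagrangian.integral_eulerLagrange_symm (L : QuadLagrangian Φ) {ψ φ : Field Φ}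
    (hψ : IsTest ψ) (hφ : IsTest φ) :
    ∫ x, L.eulerLagrange (fun a b => pd a (pd b ψ) x) (φ x) =
      ∫ x, L.eulerLagrange (fun a b => pd a (pd b φ) x) (ψ x) := by
  have i : ∀ {ψ φ : Field Φ}, IsTest ψ → IsTest φ → ∀ a b,
      Integrable fun x => L.coeff a b (pd a (pd b ψ) x) (φ x) := fun hψ hφ a b =>
    bilin_integrable _ ((hψ.pd b).pd a) hφ.1
  simp only [eulerLagrange_eq]
  rw [integral_finsetSum _ fun a _ => integrable_finsetSum _ fun b _ => i hψ hφ a b,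
    integral_finsetSum _ fun a _ => integrable_finsetSum _ fun b _ => i hφ hψ a b]
  refine Finset.sum_congr rfl fun a _ => ?_
  rw [integral_finsetSum _ fun b _ => i hψ hφ a b, integral_finsetSum _ fun b _ => i hφ hψ a b]
  refine Finset.sum_congr rfl fun b _ => ?_
  rw [← integral_bilin_pd_pd _ hψ hφ]
  simp only [fun x => L.coeff_symm a b (ψ x)]

theorem QuadLagrangian.eulerLagrange_add_left (L : QuadLagrangian Φ)
    (w w' : Fin 8 → Fin 8 → FieldSpace Φ) (χ : FieldSpace Φ) :
    L.eulerLagrange (w + w') χ = L.eulerLagrange w χ + L.eulerLagrange w' χ := by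
  simp [eulerLagrange_eq, Finset.sum_add_distrib]

theorem QuadLagrangian.eulerLagrange_add_right (L : QuadLagrangian Φ)
    (w : Fin 8 → Fin 8 → FieldSpace Φ) (χ χ' : FieldSpace Φ) :
    L.eulerLagrange w (χ + χ') = L.eulerLagrange w χ + L.eulerLagrange w χ' := by
  simp [eulerLagrange_eq, Finset.sum_add_distrib]

theorem QuadLagrangian.eulerLagrange_smul_right (L : QuadLagrangian Φ)
    (w : Fin 8 → Fin 8 → FieldSpace Φ) (c : ℝ) (χ : FieldSpace Φ) :
    L.eulerLagrange w (c • χ) = c * L.eulerLagrange w χ := by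
  simp [eulerLagrange_eq, Finset.mul_sum]

/-- The two mixed terms agree by self-adjointness, so the factor 1/2 of `action_eq` disappears from
the cross term. -/
theorem QuadLagrangian.action_add (L : QuadLagrangian Φ) {ψ φ : Field Φ}
    (hψ : IsTest ψ) (hφ : IsTest φ) :
    action L.density (ψ + φ) = action L.density ψ + action L.density φ +
      ∫ x, L.eulerLagrange (fun a b => pd a (pd b φ) x) (ψ x) := by
  rw [L.action_eq hψ, L.action_eq hφ, L.action_eq (hψ.add hφ)]
  have e : ∀ x, L.eulerLagrange (fun a b => pd a (pd b (ψ + φ)) x) ((ψ + φ) x) =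
      (L.eulerLagrange (fun a b => pd a (pd b ψ) x) (ψ x) +
        L.eulerLagrange (fun a b => pd a (pd b φ) x) (φ x)) +
      (L.eulerLagrange (fun a b => pd a (pd b ψ) x) (φ x) +
        L.eulerLagrange (fun a b => pd a (pd b φ) x) (ψ x)) := by
    intro x
    have : (fun a b => pd a (pd b (ψ + φ)) x) =
        (fun a b => pd a (pd b ψ) x) + fun a b => pd a (pd b φ) x := by
      funext a b
      rw [pd_add hψ.1 hφ.1, pd_add (hψ.pd b).1 (hφ.pd b).1]; rfl
    rw [this, Pi.add_apply, L.eulerLagrange_add_left, L.eulerLagrange_add_right,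
      L.eulerLagrange_add_right]
    ring
  simp only [e]
  have i1 := L.integrable_eulerLagrange hψ hψ.1
  have i2 := L.integrable_eulerLagrange hφ hφ.1
  have i3 := L.integrable_eulerLagrange hψ hφ.1
  have i4 := L.integrable_eulerLagrange hφ hψ.1
  rw [integral_add (f := fun x => L.eulerLagrange (fun a b => pd a (pd b ψ) x) (ψ x) +
      L.eulerLagrange (fun a b => pd a (pd b φ) x) (φ x))
      (g := fun x => L.eulerLagrange (fun a b => pd a (pd b ψ) x) (φ x) +
      L.eulerLagrange (fun a b => pd a (pd b φ) x) (ψ x)) (i1.add i2) (i3.add i4),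
    integral_add i1 i2, integral_add i3 i4, L.integral_eulerLagrange_symm hψ hφ]
  ring

theorem eq_zero_of_integral_smul_eq_zero {e : E8 → ℝ} (he : Continuous e)
    (h : ∀ θ : E8 → ℝ, IsTest θ → ∫ x, θ x * e x = 0) : e = 0 := by
  have := ae_eq_zero_of_integral_contDiff_smul_eq_zero (μ := volume) he.locallyIntegrable
    fun g hg hc => h g ⟨hg, hc⟩
  exact Measure.eq_of_ae_eq this he continuous_const

/-- The fundamental lemma of the calculus of variations, applied to the test fields θχ with θ a
scalar test function and χ constant. -/
theorem QuadLagrangian.eulerLagrange_eq_zero_of_integral (L : QuadLagrangian Φ) {φ : Field Φ}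
    (hφ : IsTest φ)
    (h : ∀ ψ : Field Φ, IsTest ψ → ∫ x, L.eulerLagrange (fun a b => pd a (pd b φ) x) (ψ x) = 0)
    (x : E8) (χ : FieldSpace Φ) : L.eulerLagrange (fun a b => pd a (pd b φ) x) χ = 0 := by
  have hc : Continuous fun x => L.eulerLagrange (fun a b => pd a (pd b φ) x) χ := by
    refine continuous_finsetSum _ fun a _ => continuous_finsetSum _ fun b _ => ?_
    exact bilin_continuous (L.coeff a b) ((hφ.pd b).pd a).1.continuous
      (continuous_const (y := χ))
  refine congrFun (eq_zero_of_integral_smul_eq_zero hc fun θ hθ => ?_) x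
  have ht : IsTest fun x => θ x • χ :=
    ⟨hθ.1.smul contDiff_const, hθ.2.smul_right (f' := fun _ => χ)⟩
  simpa only [L.eulerLagrange_smul_right] using h _ ht

end symbols
end Cayley
end

noncomputable section
namespace Cayley
open MeasureTheory
open scoped Topology

/-! ### Polarisation and localised polynomials -/

theorem add_swap_eq_zero_of_quadratic {M : T2} (h : ∀ p : E8, ∑ a, ∑ b, p a * p b * M a b = 0)
    (a b : Fin 8) : M a b + M b a = 0 := by
  set m : E8 → E8 → ℝ := fun p q => ∑ a, ∑ b, p a * q b * M a b
  have hl : ∀ p p' q, m (p + p') q = m p q + m p' q := by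
    intro p p' q
    simp only [m, Pi.add_apply, add_mul, Finset.sum_add_distrib]
  have hr : ∀ p q q', m p (q + q') = m p q + m p q' := by
    intro p q q'
    simp only [m, Pi.add_apply, add_mul, mul_add, Finset.sum_add_distrib]
  have hs : ∀ a b, m (Pi.single a 1) (Pi.single b 1) = M a b := by
    intro a b
    simp [m, Pi.single_apply]
  have h0 : ∀ p, m p p = 0 := h
  have h1 := h0 (Pi.single a 1 + Pi.single b 1)
  simp only [hl, hr, h0] at h1
  rw [← hs a b, ← hs b a]
  linarith

/-- A vanishing cubic form has vanishing symmetrisation, and a symmetric weight sees nothing else.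
The weight will be the third derivatives of a vector field. -/
theorem sum_eq_zero_of_cubic {M w : Fin 8 → Fin 8 → Fin 8 → ℝ}
    (h : ∀ p : E8, ∑ a, ∑ b, ∑ c, p a * p b * p c * M a b c = 0)
    (hw₁ : ∀ a b c, w b a c = w a b c) (hw₂ : ∀ a b c, w a c b = w a b c) :
    ∑ a, ∑ b, ∑ c, w a b c * M a b c = 0 := by
  set m : E8 → E8 → E8 → ℝ := fun p q r => ∑ a, ∑ b, ∑ c, p a * q b * r c * M a b c
  have hl : ∀ p p' q r, m (p + p') q r = m p q r + m p' q r := by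
    intro p p' q r
    simp only [m, Pi.add_apply, add_mul, Finset.sum_add_distrib]
  have hm : ∀ p q q' r, m p (q + q') r = m p q r + m p q' r := by
    intro p q q' r
    simp only [m, Pi.add_apply, add_mul, mul_add, Finset.sum_add_distrib]
  have hr : ∀ p q r r', m p q (r + r') = m p q r + m p q r' := by
    intro p q r r'
    simp only [m, Pi.add_apply, add_mul, mul_add, Finset.sum_add_distrib]
  have hs : ∀ a b c, m (Pi.single a 1) (Pi.single b 1) (Pi.single c 1) = M a b c := by
    intro a b c
    simp [m, Pi.single_apply]
  have h0 : ∀ p, m p p p = 0 := h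
  have hsym : ∀ p q r, m p q r + m p r q + m q p r + m q r p + m r p q + m r q p = 0 := by
    intro p q r
    have h1 := h0 (p + q + r)
    have h2 := h0 (p + q)
    have h3 := h0 (p + r)
    have h4 := h0 (q + r)
    simp only [hl, hm, hr, h0] at h1 h2 h3 h4
    linarith
  set S := ∑ a, ∑ b, ∑ c, w a b c * M a b c
  have e1 : ∑ a, ∑ b, ∑ c, w a b c * M b a c = S := by
    rw [Finset.sum_comm]
    simp only [S, hw₁]
  have e2 : ∑ a, ∑ b, ∑ c, w a b c * M a c b = S := by
    refine Finset.sum_congr rfl fun a _ => ?_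
    rw [Finset.sum_comm]
    simp only [hw₂]
  have e3 : ∑ a, ∑ b, ∑ c, w a b c * M b c a = S := by
    rw [← e2, Finset.sum_comm]
    simp only [hw₁]
  have e4 : ∑ a, ∑ b, ∑ c, w a b c * M c a b = S := by
    rw [← e1]
    refine Finset.sum_congr rfl fun a _ => ?_
    rw [Finset.sum_comm]
    simp only [hw₂]
  have e5 : ∑ a, ∑ b, ∑ c, w a b c * M c b a = S := by
    rw [← e3]
    refine Finset.sum_congr rfl fun a _ => ?_
    rw [Finset.sum_comm]
    simp only [hw₂]
  have e6 : ∑ a, ∑ b, ∑ c, w a b c *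
      (M a b c + M a c b + M b a c + M b c a + M c a b + M c b a) = 6 * S := by
    simp only [mul_add, Finset.sum_add_distrib, e1, e2, e3, e4, e5]
    ring
  have e7 : ∀ a b c, M a b c + M a c b + M b a c + M b c a + M c a b + M c b a = 0 := by
    intro a b c
    have := hsym (Pi.single a 1) (Pi.single b 1) (Pi.single c 1)
    simpa only [hs] using this
  simp only [e7, mul_zero, Finset.sum_const_zero] at e6
  linarith

section monomials
variable {F : Type*} [NormedAddCommGroup F] [NormedSpace ℝ F]

/-- The polynomial `(p·x)ⁿ/n! c`. -/
def monomialField (p : E8) (n : ℕ) (c : F) : E8 → F := fun x => ((p ⬝ᵥ x) ^ n / n.factorial) • c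

theorem contDiff_dotProduct (p : E8) : ContDiff ℝ ∞ fun x : E8 => p ⬝ᵥ x := by
  simp only [dotProduct]; fun_prop

theorem contDiff_monomialField (p : E8) (n : ℕ) (c : F) : ContDiff ℝ ∞ (monomialField p n c) :=
  (((contDiff_dotProduct p).pow n).div_const _).smul contDiff_const

theorem pd_monomialField (p : E8) (n : ℕ) (c : F) (a : Fin 8) :
    pd a (monomialField p (n + 1) c) = monomialField p n (p a • c) := by
  funext x
  have h1 : HasFDerivAt (fun x : E8 => p ⬝ᵥ x)
      (LinearMap.toContinuousLinearMap (dotProductBilin ℝ ℝ p : E8 →ₗ[ℝ] ℝ)) x :=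
    (LinearMap.toContinuousLinearMap (dotProductBilin ℝ ℝ p : E8 →ₗ[ℝ] ℝ)).hasFDerivAt
  have h2 := ((h1.pow (n + 1)).mul_const ((n + 1).factorial : ℝ)⁻¹).smul_const c
  have h3 : (fun x : E8 => ((p ⬝ᵥ x) ^ (n + 1) * ((n + 1).factorial : ℝ)⁻¹) • c) =
      monomialField p (n + 1) c := by
    funext y; simp only [monomialField, div_eq_mul_inv]
  rw [← h3, pd, h2.fderiv]
  simp only [monomialField, Nat.factorial_succ, smul_smul]
  simp [dotProductBilin]
  congr 1
  field_simp

theorem pd_congr {f g : E8 → F} {x : E8} (h : f =ᶠ[𝓝 x] g) (a : Fin 8) : pd a f =ᶠ[𝓝 x] pd a g :=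
  (h.fderiv (𝕜 := ℝ)).mono fun y hy => by simp only [pd, hy]

/-- Multiplying by a bump function equal to one near the origin prescribes derivatives at 0 of a
test field. This is how identities of integrals are converted into identities of symbols. -/
theorem exists_isTest_eventuallyEq {f : E8 → F} (hf : ContDiff ℝ ∞ f) :
    ∃ ψ : E8 → F, IsTest ψ ∧ ψ =ᶠ[𝓝 0] f := by
  let b : ContDiffBump (0 : E8) := ⟨1, 2, by norm_num, by norm_num⟩
  refine ⟨fun x => b x • f x, ⟨b.contDiff.smul hf, b.hasCompactSupport.smul_right⟩, ?_⟩
  filter_upwards [b.eventuallyEq_one] with x hx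
  simp only [hx, Pi.one_apply, one_smul]

end monomials

section
variable {Φ : T4}

theorem monomialField_zero (p : E8) (c : FieldSpace Φ) (x : E8) : monomialField p 0 c x = c := by
  simp [monomialField]

theorem pd_pd_of_eventuallyEq_monomial {φ : Field Φ} {p : E8} {f : FieldSpace Φ}
    (h : φ =ᶠ[𝓝 0] monomialField p 2 f) (a b : Fin 8) : pd a (pd b φ) 0 = (p a * p b) • f := by
  have := (pd_congr (pd_congr h b) a).self_of_nhds
  rw [this, pd_monomialField, pd_monomialField, monomialField_zero, smul_smul]

/-! ### Equality of actions -/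

/-- The difference of two Lagrangians. -/
def QuadLagrangian.sub (L L' : QuadLagrangian Φ) : QuadLagrangian Φ :=
  ⟨fun a b => L.A a b - L'.A a b, fun a b => L.B a b - L'.B a b⟩

theorem QuadLagrangian.eulerLagrange_sub (L L' : QuadLagrangian Φ)
    (w : Fin 8 → Fin 8 → FieldSpace Φ) (χ : FieldSpace Φ) :
    (L.sub L').eulerLagrange w χ = L.eulerLagrange w χ - L'.eulerLagrange w χ := by
  simp only [eulerLagrange, sub, LinearMap.sub_apply, ← Finset.sum_sub_distrib]
  refine Finset.sum_congr rfl fun a _ => Finset.sum_congr rfl fun b _ => ?_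
  ring

theorem QuadLagrangian.symbol_sub (L L' : QuadLagrangian Φ) (p : E8) (f χ : FieldSpace Φ) :
    (L.sub L').symbol p f χ = L.symbol p f χ - L'.symbol p f χ := by
  simp only [← eulerLagrange_symbol, eulerLagrange_sub]

/-- The symbol determines the coefficients only up to their antisymmetric part in the two derivative
indices, and that part drops out because second derivatives commute. -/
theorem QuadLagrangian.eulerLagrange_eq_zero (L : QuadLagrangian Φ) {χ : FieldSpace Φ}
    (h : ∀ p f, L.symbol p f χ = 0) {w : Fin 8 → Fin 8 → FieldSpace Φ}
    (hw : ∀ a b, w a b = w b a) : L.eulerLagrange w χ = 0 := by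
  rw [eulerLagrange_eq]
  have h1 : ∀ f a b, L.coeff a b f χ + L.coeff b a f χ = 0 := fun f a b =>
    add_swap_eq_zero_of_quadratic (M := fun a b => L.coeff a b f χ)
      (fun p => by rw [← symbol_apply]; exact h p f) a b
  have h2 : ∑ a, ∑ b, L.coeff a b (w a b) χ = ∑ a, ∑ b, L.coeff b a (w a b) χ := by
    rw [Finset.sum_comm]
    exact Finset.sum_congr rfl fun a _ => Finset.sum_congr rfl fun b _ => by rw [hw]
  have h3 : ∑ a, ∑ b, L.coeff a b (w a b) χ + ∑ a, ∑ b, L.coeff b a (w a b) χ = 0 := by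
    simp only [← Finset.sum_add_distrib, h1, Finset.sum_const_zero]
  linarith

/-- Equal actions have equal cross terms, hence equal Euler-Lagrange expressions; on a field that is
(p·x)²/2 f near the origin these are the symbols at p. Conversely, equal symbols give equal
Euler-Lagrange expressions, which determine the actions. -/
theorem QuadLagrangian.sameAction_iff (L L' : QuadLagrangian Φ) :
    SameAction L.density L'.density ↔ ∀ p f, L.quadSymbol p f = L'.quadSymbol p f := by
  constructor
  · intro h p f
    obtain ⟨φ, hφ, hφ0⟩ := exists_isTest_eventuallyEq (contDiff_monomialField p 2 f)
    have key : ∀ ψ : Field Φ, IsTest ψ →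
        ∫ x, (L.sub L').eulerLagrange (fun a b => pd a (pd b φ) x) (ψ x) = 0 := by
      intro ψ hψ
      have h1 := L.action_add hψ hφ
      have h2 := L'.action_add hψ hφ
      have h3 := h ψ hψ
      have h4 := h φ hφ
      have h5 := h _ (hψ.add hφ)
      simp only [eulerLagrange_sub]
      rw [integral_sub (L.integrable_eulerLagrange hφ hψ.1) (L'.integrable_eulerLagrange hφ hψ.1)]
      linarith
    have h1 := (L.sub L').eulerLagrange_eq_zero_of_integral hφ key 0 f
    simp only [pd_pd_of_eventuallyEq_monomial hφ0] at h1
    rw [eulerLagrange_symbol, symbol_sub, symbol_self, symbol_self] at h1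
    linarith
  · intro h ψ hψ
    rw [L.action_eq hψ, L'.action_eq hψ]
    congr 1
    refine integral_congr_ae (Filter.Eventually.of_forall fun x => ?_)
    have := (L.sub L').eulerLagrange_eq_zero (χ := ψ x)
      (fun p f => by rw [symbol_sub, symbol_eq_polar, symbol_eq_polar]; simp only [h]; ring)
      (w := fun a b => pd a (pd b ψ) x) (fun a b => by rw [pd_comm hψ.1])
    rw [eulerLagrange_sub] at this
    simpa [sub_eq_zero] using this

/-! ### Diffeomorphism invariance -/

/-- The tensor `p ⊗ v`. -/
def tensor (p v : E8) : T2 := fun a b => p a * v b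

/-- The field variation under the diffeomorphism with vector field `v`. -/
def gaugeVariation (hΦ : IsCayleyForm Φ) (v : E8 → E8) : Field Φ :=
  fun x => gaugeMap hΦ fun a b => pd a (fun y => v y b) x

theorem IsCayleyForm.isDiffeoVariation_iff (hΦ : IsCayleyForm Φ) (v : E8 → E8) (δ : Field Φ) :
    IsDiffeoVariation Φ v δ ↔ δ = gaugeVariation hΦ v := by
  rw [funext_iff]
  exact forall_congr' fun x => hΦ.perturbation_eq_iff

/-- The map from the derivative of a vector field to the field variation. -/
def gaugeCLM (hΦ : IsCayleyForm Φ) : T2 →L[ℝ] FieldSpace Φ :=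
  LinearMap.toContinuousLinearMap (gaugeMap hΦ)

theorem pd_apply {v : E8 → E8} (hv : ContDiff ℝ ∞ v) (a b : Fin 8) :
    pd a (fun y => v y b) = fun x => pd a v x b :=
  pd_clm hv (ContinuousLinearMap.proj (R := ℝ) (φ := fun _ : Fin 8 => ℝ) b) a

/-- The components of the derivative of a vector field. -/
def jacobianCLM : (E8 →L[ℝ] E8) →L[ℝ] T2 :=
  LinearMap.toContinuousLinearMap
    { toFun := fun L a b => L (Pi.single a 1) b
      map_add' := fun _ _ => rfl
      map_smul' := fun _ _ => rfl }

theorem gaugeVariation_eq (hΦ : IsCayleyForm Φ) {v : E8 → E8} (hv : ContDiff ℝ ∞ v) :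
    gaugeVariation hΦ v = fun x => gaugeCLM hΦ (jacobianCLM (fderiv ℝ v x)) := by
  funext x
  simp only [gaugeVariation, pd_apply hv]
  rfl

theorem isTest_jacobian {v : E8 → E8} (hv : IsTest v) :
    IsTest fun x => jacobianCLM (fderiv ℝ v x) :=
  IsTest.clm ⟨hv.1.fderiv_right (by simp), hv.2.fderiv (𝕜 := ℝ)⟩ jacobianCLM

theorem isTest_gaugeVariation (hΦ : IsCayleyForm Φ) {v : E8 → E8} (hv : IsTest v) :
    IsTest (gaugeVariation hΦ v) := by
  rw [gaugeVariation_eq hΦ hv.1]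
  exact (isTest_jacobian hv).clm _

theorem T2.eq_sum (H : T2) :
    H = ∑ c, ∑ d, H c d • tensor (Pi.single c 1) (Pi.single d 1) := by
  funext a b
  simp [tensor, Finset.sum_apply, Pi.single_apply]

theorem pd_pd_gaugeVariation (hΦ : IsCayleyForm Φ) {v : E8 → E8} (hv : IsTest v) (a b : Fin 8)
    (x : E8) : pd a (pd b (gaugeVariation hΦ v)) x =
      gaugeMap hΦ fun c d => pd a (pd b (pd c v)) x d := by
  have h := isTest_jacobian hv
  rw [gaugeVariation_eq hΦ hv.1, pd_clm h.1, pd_clm (h.pd b).1]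
  change gaugeMap hΦ _ = _
  congr 1
  funext c d
  let T : T2 →L[ℝ] ℝ := (ContinuousLinearMap.proj (R := ℝ) (φ := fun _ : Fin 8 => ℝ) d).comp
    (ContinuousLinearMap.proj (R := ℝ) (φ := fun _ : Fin 8 => Fin 8 → ℝ) c)
  have e1 : (fun x => T (jacobianCLM (fderiv ℝ v x))) = fun x => pd c v x d := rfl
  have e2 := congrArg (pd a) (pd_clm h.1 T b)
  rw [pd_clm (h.pd b).1 T a, e1, pd_apply (hv.pd c).1, pd_apply ((hv.pd c).pd b).1] at e2
  exact (congrFun e2 x).symm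

/-- Invariance says that the Euler-Lagrange expression of every variation vanishes. This is linear
in the third derivatives of v, which are symmetric, so it suffices to know it for third derivatives
of the form p_a p_b p_c v_d. -/
theorem QuadLagrangian.isDiffeoInvariant_iff (hΦ : IsCayleyForm Φ) (L : QuadLagrangian Φ) :
    IsDiffeoInvariant L.density ↔ ∀ p v χ, L.symbol p (gaugeMap hΦ (tensor p v)) χ = 0 := by
  constructor
  · intro h p v χ
    obtain ⟨u, hu, hu0⟩ := exists_isTest_eventuallyEq (contDiff_monomialField p 3 v)
    set δ := gaugeVariation hΦ u with hδ
    have tδ : IsTest δ := isTest_gaugeVariation hΦ hu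
    have vδ : IsDiffeoVariation Φ u δ := (hΦ.isDiffeoVariation_iff u δ).2 rfl
    -- Invariance at the zero field removes the part quadratic in δ and leaves only the cross term
    -- with ψ.
    have e0 : action L.density δ = 0 := by
      have := h 0 IsTest.zero u hu δ vδ
      rw [zero_add] at this
      rw [this, L.action_eq IsTest.zero]
      have : ∀ x, L.eulerLagrange (fun a b => pd a (pd b (0 : Field Φ)) x) ((0 : Field Φ) x) = 0 := by
        intro x; simp [eulerLagrange_eq]
      simp only [this, integral_zero, mul_zero]
    have key : ∀ ψ : Field Φ, IsTest ψ →
        ∫ x, L.eulerLagrange (fun a b => pd a (pd b δ) x) (ψ x) = 0 := by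
      intro ψ hψ
      have h1 := L.action_add hψ tδ
      have h2 := h ψ hψ u hu δ vδ
      linarith
    have h1 := L.eulerLagrange_eq_zero_of_integral tδ key 0 χ
    -- Near 0 the vector field is (p·x)³/6 v, whose derivative is (p·x)²/2 p ⊗ v.
    have hloc : δ =ᶠ[𝓝 0] monomialField p 2 (gaugeMap hΦ (tensor p v)) := by
      have hall : ∀ a, pd a u =ᶠ[𝓝 0] monomialField p 2 (p a • v) := fun a => by
        rw [← pd_monomialField]; exact pd_congr hu0 a
      filter_upwards [Filter.eventually_all.2 hall] with x hx
      simp only [hδ, gaugeVariation, pd_apply hu.1, hx, monomialField, ← map_smul]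
      congr 1
    simp only [pd_pd_of_eventuallyEq_monomial hloc] at h1
    rwa [eulerLagrange_symbol] at h1
  · intro h ψ hψ v hv δ hδ
    rw [(hΦ.isDiffeoVariation_iff v δ).1 hδ]
    have tδ := isTest_gaugeVariation hΦ hv
    have hz : ∀ x χ, L.eulerLagrange
        (fun a b => pd a (pd b (gaugeVariation hΦ v)) x) χ = 0 := by
      intro x χ
      -- For each direction e_d the hypothesis is the vanishing of a cubic form in p, to be paired
      -- with the symmetric third derivatives.
      have hM : ∀ d, ∑ a, ∑ b, ∑ c, pd a (pd b (pd c v)) x d *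
          L.coeff a b (gaugeMap hΦ (tensor (Pi.single c 1) (Pi.single d 1))) χ = 0 := by
        intro d
        refine sum_eq_zero_of_cubic (w := fun a b c => pd a (pd b (pd c v)) x d)
          (fun p => ?_) (fun a b c => ?_) (fun a b c => ?_)
        · rw [← h p (Pi.single d 1) χ, symbol_apply]
          refine Finset.sum_congr rfl fun a _ => Finset.sum_congr rfl fun b _ => ?_
          have : tensor p (Pi.single d 1) =
              ∑ c, p c • tensor (Pi.single c 1) (Pi.single d 1) := by
            funext i j
            simp [tensor, Finset.sum_apply, Pi.single_apply]
          rw [this]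
          simp only [map_sum, map_smul, LinearMap.sum_apply, LinearMap.smul_apply, smul_eq_mul,
            Finset.mul_sum, mul_assoc]
        · rw [pd_comm (hv.pd c).1]
        · rw [pd_comm hv.1]
      rw [eulerLagrange_eq]
      simp only [pd_pd_gaugeVariation hΦ hv]
      calc _ = ∑ a, ∑ b, ∑ c, ∑ d, pd a (pd b (pd c v)) x d *
            L.coeff a b (gaugeMap hΦ (tensor (Pi.single c 1) (Pi.single d 1))) χ := by
            refine Finset.sum_congr rfl fun a _ => Finset.sum_congr rfl fun b _ => ?_
            rw [T2.eq_sum fun c d => pd a (pd b (pd c v)) x d]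
            simp only [map_sum, map_smul, LinearMap.sum_apply, LinearMap.smul_apply, smul_eq_mul]
        _ = ∑ d, ∑ a, ∑ b, ∑ c, pd a (pd b (pd c v)) x d *
            L.coeff a b (gaugeMap hΦ (tensor (Pi.single c 1) (Pi.single d 1))) χ := by
            exact (Finset.sum_congr rfl fun a _ => Finset.sum_comm_cycle).trans Finset.sum_comm
        _ = 0 := by simp only [hM, Finset.sum_const_zero]
    have h1 := L.action_add hψ tδ
    rw [L.action_eq tδ] at h1
    simp only [hz] at h1
    simpa using h1

end
end Cayley
end

noncomputable section
namespace Cayley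
open MeasureTheory

/-! ### Rotations of the fields -/

section
variable {Φ : T4} {g : Matrix (Fin 8) (Fin 8) ℝ}

theorem J2_act_of_mem_spin7 (hg : g ∈ spin7 Φ) (β : T2) : J2 Φ (act2 g β) = act2 g (J2 Φ β) := by
  have := J2_act hg.1 Φ β
  rwa [hg.2] at this

/-- The action of `Spin(7)` on the values of the fields. -/
def spinAct (hg : g ∈ spin7 Φ) : FieldSpace Φ →ₗ[ℝ] FieldSpace Φ where
  toFun f := ⟨(act2 g f.1.1, act2 g f.1.2), by
    refine ⟨fun a b => ?_, fun a b => ?_, fun a b => ?_⟩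
    · change act2 g f.1.1 a b = act2 g f.1.1 b a
      rw [act2_transpose_swap _ _ a b]
      congr 2
      funext i j; exact f.2.1 i j
    · change act2 g f.1.2 a b = -act2 g f.1.2 b a
      rw [act2_transpose_swap _ _ a b]
      have : (fun i j => f.1.2 j i) = (-1 : ℝ) • f.1.2 := by
        funext i j
        rw [f.2.2.1 j i]; simp
      rw [this, act2_smul]; simp
    · change J2 Φ (act2 g f.1.2) a b = -3 * act2 g f.1.2 a b
      rw [J2_act_of_mem_spin7 hg]
      have : J2 Φ f.1.2 = (-3 : ℝ) • f.1.2 := by funext i j; exact f.2.2.2 i j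
      rw [this, act2_smul]; rfl⟩
  map_add' s t := Subtype.ext (Prod.ext (act2_add _ _ _) (act2_add _ _ _))
  map_smul' c s := Subtype.ext (Prod.ext (act2_smul _ _ _) (act2_smul _ _ _))

/-- The action of `Spin(7)` on Lagrangians. -/
def QuadLagrangian.pull (L : QuadLagrangian Φ) (hg : g ∈ spin7 Φ) : QuadLagrangian Φ where
  A i j := ∑ a, ∑ b, (g a i * g b j) • (L.A a b).compl₁₂ (spinAct hg) (spinAct hg)
  B i j := ∑ a, ∑ b, (g a i * g b j) • (L.B a b).compl₁₂ (spinAct hg) (spinAct hg)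

theorem QuadLagrangian.pull_A (L : QuadLagrangian Φ) (hg : g ∈ spin7 Φ) (i j : Fin 8)
    (f k : FieldSpace Φ) : (L.pull hg).A i j f k =
      ∑ a, ∑ b, g a i * g b j * L.A a b (spinAct hg f) (spinAct hg k) := by
  simp [pull, LinearMap.sum_apply]

theorem QuadLagrangian.pull_B (L : QuadLagrangian Φ) (hg : g ∈ spin7 Φ) (i j : Fin 8)
    (f k : FieldSpace Φ) : (L.pull hg).B i j f k =
      ∑ a, ∑ b, g a i * g b j * L.B a b (spinAct hg f) (spinAct hg k) := by
  simp [pull, LinearMap.sum_apply]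

theorem QuadLagrangian.quadSymbol_pull (L : QuadLagrangian Φ) (hg : g ∈ spin7 Φ) (p : E8)
    (f : FieldSpace Φ) : (L.pull hg).quadSymbol p f =
      L.quadSymbol (g.mulVec p) (spinAct hg f) := by
  simp only [quadSymbol, pull_A, pull_B, ← Finset.sum_sub_distrib, Finset.mul_sum]
  rw [sum_comm_pairs]
  refine Finset.sum_congr rfl fun a _ => Finset.sum_congr rfl fun b _ => ?_
  simp only [Matrix.mulVec, dotProduct]
  rw [Finset.sum_mul_sum]
  simp only [Finset.sum_mul]
  refine Finset.sum_congr rfl fun i _ => Finset.sum_congr rfl fun j _ => ?_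
  ring

theorem pd_comp_mulVec {F : Type*} [NormedAddCommGroup F] [NormedSpace ℝ F] {f : E8 → F}
    (hf : ContDiff ℝ ∞ f) (M : Matrix (Fin 8) (Fin 8) ℝ) (a : Fin 8) :
    pd a (fun y => f (M.mulVec y)) = fun y => ∑ i, M i a • pd i f (M.mulVec y) := by
  funext y
  let T : E8 →L[ℝ] E8 := LinearMap.toContinuousLinearMap M.mulVecLin
  have h1 : HasFDerivAt f (fderiv ℝ f (T y)) (T y) :=
    (hf.differentiable (by simp) (T y)).hasFDerivAt
  have h := (h1.comp y T.hasFDerivAt).fderiv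
  have e : T (Pi.single a 1) = ∑ i, M i a • Pi.single i (1 : ℝ) := by
    funext i
    simp [T, Finset.sum_apply, Pi.single_apply]
  change fderiv ℝ (f ∘ T) y (Pi.single a 1) = _
  rw [h, ContinuousLinearMap.comp_apply, e, map_sum]
  simp only [map_smul]
  rfl

theorem contDiff_mulVec (M : Matrix (Fin 8) (Fin 8) ℝ) : ContDiff ℝ ∞ fun y : E8 => M.mulVec y :=
  (LinearMap.toContinuousLinearMap M.mulVecLin).contDiff

theorem pd_finset_sum {ι F : Type*} [NormedAddCommGroup F] [NormedSpace ℝ F] (s : Finset ι)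
    {f : ι → E8 → F} (hf : ∀ i, ContDiff ℝ ∞ (f i)) (a : Fin 8) :
    pd a (fun x => ∑ i ∈ s, f i x) = fun x => ∑ i ∈ s, pd a (f i) x := by
  funext x
  have := fderiv_fun_sum (𝕜 := ℝ) (u := s) (x := x) fun i _ => (hf i).differentiable (by simp) x
  simp only [pd, this, sum_apply]

theorem pd_const_smul {F : Type*} [NormedAddCommGroup F] [NormedSpace ℝ F] {f : E8 → F}
    (hf : ContDiff ℝ ∞ f) (c : ℝ) (a : Fin 8) : pd a (fun x => c • f x) = fun x => c • pd a f x :=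
  pd_clm hf (c • ContinuousLinearMap.id ℝ F) a

/-- The rotation of a field configuration. -/
def rotField (hg : g ∈ spin7 Φ) (ψ : Field Φ) : Field Φ :=
  fun y => spinAct hg (ψ (g.transpose.mulVec y))

theorem transpose_mulVec_mulVec (hg : g ∈ spin7 Φ) (x : E8) :
    g.transpose.mulVec (g.mulVec x) = x := by
  have : g.transpose * g = 1 := (Matrix.mem_orthogonalGroup_iff' (Fin 8) ℝ).1 hg.1
  rw [Matrix.mulVec_mulVec, this, Matrix.one_mulVec]

theorem mulVec_transpose_mulVec (hg : g ∈ spin7 Φ) (x : E8) :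
    g.mulVec (g.transpose.mulVec x) = x := by
  have : g * g.transpose = 1 := (Matrix.mem_orthogonalGroup_iff (Fin 8) ℝ).1 hg.1
  rw [Matrix.mulVec_mulVec, this, Matrix.one_mulVec]

theorem pd_rotField (hg : g ∈ spin7 Φ) {ψ : Field Φ} (hψ : ContDiff ℝ ∞ ψ) (a : Fin 8) :
    pd a (rotField hg ψ) = fun y => ∑ i, g a i • rotField hg (pd i ψ) y := by
  let T : FieldSpace Φ →L[ℝ] FieldSpace Φ := LinearMap.toContinuousLinearMap (spinAct hg)
  have h1 : rotField hg ψ = fun y => T (ψ (g.transpose.mulVec y)) := rfl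
  rw [h1, pd_clm (f := fun y => ψ (g.transpose.mulVec y)) (hψ.comp (contDiff_mulVec _)) T,
    pd_comp_mulVec hψ]
  funext y
  simp only [map_sum, map_smul]
  rfl

theorem contDiff_rotField (hg : g ∈ spin7 Φ) {ψ : Field Φ} (hψ : ContDiff ℝ ∞ ψ) :
    ContDiff ℝ ∞ (rotField hg ψ) :=
  (LinearMap.toContinuousLinearMap (spinAct hg)).contDiff.comp (hψ.comp (contDiff_mulVec _))

theorem pd_pd_rotField (hg : g ∈ spin7 Φ) {ψ : Field Φ} (hψ : ContDiff ℝ ∞ ψ) (a b : Fin 8) :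
    pd a (pd b (rotField hg ψ)) =
      fun y => ∑ i, ∑ j, (g a i * g b j) • rotField hg (pd i (pd j ψ)) y := by
  have h1 : ∀ i, ContDiff ℝ ∞ (rotField hg (pd i ψ)) := fun i =>
    contDiff_rotField hg (contDiff_pd hψ i)
  rw [pd_rotField hg hψ, pd_finset_sum (f := fun i y => g b i • rotField hg (pd i ψ) y) _
    fun i => (contDiff_const (c := g b i)).smul (h1 i)]
  funext y
  rw [Finset.sum_comm]
  refine Finset.sum_congr rfl fun j _ => ?_
  rw [pd_const_smul (h1 j), pd_rotField hg (contDiff_pd hψ j)]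
  dsimp only
  rw [Finset.smul_sum]
  refine Finset.sum_congr rfl fun i _ => ?_
  rw [smul_smul, mul_comm]

theorem isTest_rotField (hg : g ∈ spin7 Φ) {ψ : Field Φ} (hψ : IsTest ψ) :
    IsTest (rotField hg ψ) := by
  refine ⟨contDiff_rotField hg hψ.1, ?_⟩
  have hemb : Topology.IsClosedEmbedding fun y : E8 => g.transpose.mulVec y :=
    (Homeomorph.mk ⟨fun y : E8 => g.transpose.mulVec y, fun x => g.mulVec x,
      mulVec_transpose_mulVec hg, transpose_mulVec_mulVec hg⟩
      (contDiff_mulVec _).continuous (contDiff_mulVec _).continuous).isClosedEmbedding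
  exact (hψ.2.comp_isClosedEmbedding hemb).comp_left (g := spinAct hg) (map_zero _)

theorem rotField_mulVec (hg : g ∈ spin7 Φ) (ψ : Field Φ) (x : E8) :
    rotField hg ψ (g.mulVec x) = spinAct hg (ψ x) := by
  rw [rotField, transpose_mulVec_mulVec hg]

theorem QuadLagrangian.density_rotField (L : QuadLagrangian Φ) (hg : g ∈ spin7 Φ) {ψ : Field Φ}
    (hψ : ContDiff ℝ ∞ ψ) (x : E8) :
    L.density (rotField hg ψ) (g.mulVec x) = (L.pull hg).density ψ x := by
  simp only [density, pd_pd_rotField hg hψ]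
  simp only [pull_A, pull_B, pd_rotField hg hψ, rotField_mulVec,
    map_sum, map_smul, LinearMap.sum_apply, LinearMap.smul_apply, smul_eq_mul]
  simp only [Finset.sum_add_distrib]
  congr 1
  · rw [sum_comm_pairs]
  · simp only [Finset.mul_sum]
    rw [sum_comm_pairs, Finset.sum_comm]
    refine Finset.sum_congr rfl fun i _ => Finset.sum_congr rfl fun j _ =>
      Finset.sum_congr rfl fun a _ => ?_
    refine Finset.sum_congr rfl fun b _ => ?_
    ring

theorem QuadLagrangian.continuous_density (L : QuadLagrangian Φ) {ψ : Field Φ}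
    (hψ : ContDiff ℝ ∞ ψ) : Continuous (L.density ψ) := by
  refine continuous_finsetSum _ fun a _ => continuous_finsetSum _ fun b _ => ?_
  have h := fun a => contDiff_pd hψ a
  exact (bilin_continuous (L.A a b) hψ.continuous (contDiff_pd (h b) a).continuous).add
    (bilin_continuous (L.B a b) (h a).continuous (h b).continuous)

theorem integral_comp_mulVec (hg : g ∈ spin7 Φ) {f : E8 → ℝ} (hf : Continuous f) :
    ∫ x, f (g.mulVec x) = ∫ x, f x := by
  have h1 : g * g.transpose = 1 := (Matrix.mem_orthogonalGroup_iff (Fin 8) ℝ).1 hg.1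
  have hd : g.det * g.det = 1 := by
    have := congrArg Matrix.det h1
    rwa [Matrix.det_mul, Matrix.det_transpose, Matrix.det_one] at this
  have habs : |g.det⁻¹| = 1 := by
    rw [abs_inv, inv_eq_one]
    have : |g.det| * |g.det| = 1 := by rw [← abs_mul, hd, abs_one]
    nlinarith [abs_nonneg g.det]
  have hne : g.det ≠ 0 := fun h => by simp [h] at hd
  have hm := Real.map_matrix_volume_pi_eq_smul_volume_pi hne
  rw [habs, ENNReal.ofReal_one, one_smul] at hm
  conv_rhs => rw [← hm]
  rw [integral_map (by
    exact (contDiff_mulVec g).continuous.measurable.aemeasurable) hf.aestronglyMeasurable]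
  rfl

theorem QuadLagrangian.action_rotField (L : QuadLagrangian Φ) (hg : g ∈ spin7 Φ) {ψ : Field Φ}
    (hψ : ContDiff ℝ ∞ ψ) :
    action L.density (rotField hg ψ) = action (L.pull hg).density ψ := by
  simp only [action, ← L.density_rotField hg hψ]
  exact (integral_comp_mulVec hg (L.continuous_density (contDiff_rotField hg hψ))).symm

/-- Rotating the field amounts to pulling back the coefficients, after a volume-preserving change of
variables. Invariance is therefore equality of the actions of L and of its pullback, to which
`sameAction_iff` applies. -/
theorem QuadLagrangian.isSpin7Invariant_iff (L : QuadLagrangian Φ) :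
    IsSpin7Invariant L.density ↔ ∀ g, ∀ hg : g ∈ spin7 Φ, ∀ p f,
      L.quadSymbol (g.mulVec p) (spinAct hg f) = L.quadSymbol p f := by
  simp only [← quadSymbol_pull]
  constructor
  · intro h g hg
    rw [← sameAction_iff]
    intro ψ hψ
    rw [← L.action_rotField hg hψ.1]
    refine h g hg ψ _ hψ (isTest_rotField hg hψ) fun x => ?_
    rw [rotField_mulVec hg]
    exact ⟨rfl, rfl⟩
  · intro h g hg ψ ψ' hψ hψ' hr
    have e : ψ' = rotField hg ψ := by
      funext y
      have h1 := hr (g.transpose.mulVec y)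
      rw [mulVec_transpose_mulVec hg] at h1
      exact Subtype.ext (Prod.ext h1.1 h1.2)
    rw [e, L.action_rotField hg hψ.1]
    exact (sameAction_iff _ _).2 (h g hg) ψ hψ

end
end Cayley
end

noncomputable section
namespace Cayley

/-! ### One-parameter subgroups of `Spin(7)` -/

section exponential

attribute [local instance] Matrix.linftyOpNormedRing Matrix.linftyOpNormedAlgebra

theorem hasDerivAt_exp_entry (X : Matrix (Fin 8) (Fin 8) ℝ) (a i : Fin 8) (t : ℝ) :
    HasDerivAt (fun t : ℝ => NormedSpace.exp (t • X) a i)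
      (∑ m, NormedSpace.exp (t • X) a m * X m i) t := by
  have h := hasDerivAt_exp_smul_const (𝕂 := ℝ) X t
  let T : Matrix (Fin 8) (Fin 8) ℝ →L[ℝ] ℝ :=
    LinearMap.toContinuousLinearMap (Matrix.entryLinearMap ℝ ℝ a i)
  exact T.hasFDerivAt.comp_hasDerivAt t h

theorem exp_mem_orthogonalGroup {X : Matrix (Fin 8) (Fin 8) ℝ} (hX : X.transpose = -X) (t : ℝ) :
    NormedSpace.exp (t • X) ∈ Matrix.orthogonalGroup (Fin 8) ℝ := by
  rw [Matrix.mem_orthogonalGroup_iff]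
  change _ * (NormedSpace.exp (t • X)).transpose = 1
  rw [← Matrix.exp_transpose, Matrix.transpose_smul, hX, smul_neg,
    ← Matrix.exp_add_of_commute _ _ ((Commute.refl (t • X)).neg_right), add_neg_cancel,
    NormedSpace.exp_zero]

end exponential

theorem sum_pull₁ (g X : Matrix (Fin 8) (Fin 8) ℝ) (Ψ : Fin 8 → ℝ) (a : Fin 8) :
    ∑ i, (∑ m, g a m * X m i) * Ψ i = ∑ i, g a i * ∑ p, X i p * Ψ p := by
  simp only [Finset.sum_mul, Finset.mul_sum]
  rw [Finset.sum_comm]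
  refine Finset.sum_congr rfl fun i _ => Finset.sum_congr rfl fun j _ => ?_
  ring

/-- The differential of the action of matrices on tensors. -/
theorem act4_deriv_eq (g X : Matrix (Fin 8) (Fin 8) ℝ) (Φ : T4) (a b c d : Fin 8) :
    ∑ i, ∑ j, ∑ k, ∑ l,
      ((((∑ m, g a m * X m i) * g b j + g a i * ∑ m, g b m * X m j) * g c k +
        g a i * g b j * ∑ m, g c m * X m k) * g d l +
        g a i * g b j * g c k * ∑ m, g d m * X m l) * Φ i j k l = act4 g (infAct Φ X) a b c d := by
  have e1 : ∑ i, ∑ j, ∑ k, ∑ l, (∑ m, g a m * X m i) * (g b j * g c k * g d l * Φ i j k l) =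
      ∑ i, ∑ j, ∑ k, ∑ l, g a i * g b j * g c k * g d l * ∑ p, X i p * Φ p j k l := by
    simp only [← Finset.mul_sum]
    rw [sum_pull₁]
    refine Finset.sum_congr rfl fun i _ => ?_
    simp only [Finset.mul_sum]
    rw [Finset.sum_comm]
    refine Finset.sum_congr rfl fun j _ => ?_
    rw [Finset.sum_comm]
    refine Finset.sum_congr rfl fun k _ => ?_
    rw [Finset.sum_comm]
    refine Finset.sum_congr rfl fun l _ => Finset.sum_congr rfl fun p _ => ?_
    ring
  have e2 : ∑ i, ∑ j, ∑ k, ∑ l, (∑ m, g b m * X m j) * (g a i * g c k * g d l * Φ i j k l) =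
      ∑ i, ∑ j, ∑ k, ∑ l, g a i * g b j * g c k * g d l * ∑ p, X j p * Φ i p k l := by
    refine Finset.sum_congr rfl fun i _ => ?_
    simp only [← Finset.mul_sum]
    rw [sum_pull₁]
    refine Finset.sum_congr rfl fun j _ => ?_
    simp only [Finset.mul_sum]
    rw [Finset.sum_comm]
    refine Finset.sum_congr rfl fun k _ => ?_
    rw [Finset.sum_comm]
    refine Finset.sum_congr rfl fun l _ => Finset.sum_congr rfl fun p _ => ?_
    ring
  have e3 : ∑ i, ∑ j, ∑ k, ∑ l, (∑ m, g c m * X m k) * (g a i * g b j * g d l * Φ i j k l) =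
      ∑ i, ∑ j, ∑ k, ∑ l, g a i * g b j * g c k * g d l * ∑ p, X k p * Φ i j p l := by
    refine Finset.sum_congr rfl fun i _ => Finset.sum_congr rfl fun j _ => ?_
    simp only [← Finset.mul_sum]
    rw [sum_pull₁]
    refine Finset.sum_congr rfl fun k _ => ?_
    simp only [Finset.mul_sum]
    rw [Finset.sum_comm]
    refine Finset.sum_congr rfl fun l _ => Finset.sum_congr rfl fun p _ => ?_
    ring
  have e4 : ∑ i, ∑ j, ∑ k, ∑ l, (∑ m, g d m * X m l) * (g a i * g b j * g c k * Φ i j k l) =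
      ∑ i, ∑ j, ∑ k, ∑ l, g a i * g b j * g c k * g d l * ∑ p, X l p * Φ i j k p := by
    refine Finset.sum_congr rfl fun i _ => Finset.sum_congr rfl fun j _ =>
      Finset.sum_congr rfl fun k _ => ?_
    rw [sum_pull₁]
    refine Finset.sum_congr rfl fun l _ => ?_
    simp only [Finset.mul_sum]
    refine Finset.sum_congr rfl fun p _ => ?_
    ring
  simp only [act4, infAct, Finset.sum_add_distrib, mul_add]
  rw [← e1, ← e2, ← e3, ← e4]
  simp only [← Finset.sum_add_distrib]
  refine Finset.sum_congr rfl fun i _ => Finset.sum_congr rfl fun j _ =>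
      Finset.sum_congr rfl fun k _ => Finset.sum_congr rfl fun l _ => ?_
  ring

theorem act4_one (Φ : T4) : act4 1 Φ = Φ := by
  funext a b c d
  simp [act4, Matrix.one_apply]

/-- The derivative of the transported form along the one-parameter group is the transport of the
action of X on Φ, which is zero by `infAct_eq_zero`; the form is therefore constant and equal to its
value at 0. -/
theorem IsCayleyForm.exp_mem_spin7 {Φ : T4} (hΦ : IsCayleyForm Φ) {X : Matrix (Fin 8) (Fin 8) ℝ}
    (hX : ∀ a b, X a b = -X b a) (hJ : J2 Φ X = X) (t : ℝ) :
    NormedSpace.exp (t • X) ∈ spin7 Φ := by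
  have hT : X.transpose = -X := by
    ext a b; rw [Matrix.transpose_apply, hX]; rfl
  refine ⟨exp_mem_orthogonalGroup hT t, ?_⟩
  funext a b c d
  have h0 : ∀ s : ℝ, HasDerivAt (fun s : ℝ => act4 (NormedSpace.exp (s • X)) Φ a b c d) 0 s := by
    intro s
    have h1 := fun a i => hasDerivAt_exp_entry X a i s
    have h2 : act4 (NormedSpace.exp (s • X)) (infAct Φ X) a b c d = 0 := by
      rw [hΦ.infAct_eq_zero hX hJ]; simp [act4]
    rw [← h2, ← act4_deriv_eq]
    refine HasDerivAt.fun_sum fun i _ => HasDerivAt.fun_sum fun j _ =>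
      HasDerivAt.fun_sum fun k _ => HasDerivAt.fun_sum fun l _ => ?_
    exact ((((h1 a i).mul (h1 b j)).mul (h1 c k)).mul (h1 d l)).mul_const _
  have hc := is_const_of_deriv_eq_zero (fun s => (h0 s).differentiableAt)
    (fun s => (h0 s).deriv) t 0
  rw [hc, zero_smul, NormedSpace.exp_zero, act4_one]

/-! ### Invariants of three vectors -/

section
variable {Φ : T4}

/-- Invariance of a function of three vectors under `Spin(7)`. -/
def IsSpinInvariant₃ (Φ : T4) (F : E8 × E8 × E8 → ℝ) : Prop :=
  ∀ g ∈ spin7 Φ, ∀ p u w : E8, F (g.mulVec p, g.mulVec u, g.mulVec w) = F (p, u, w)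

/-- The action of a matrix on three vectors. -/
def mulVec₃ (X : Matrix (Fin 8) (Fin 8) ℝ) (x : E8 × E8 × E8) : E8 × E8 × E8 :=
  (X.mulVec x.1, X.mulVec x.2.1, X.mulVec x.2.2)

theorem IsSpinInvariant₃.fderiv_eq_zero (hΦ : IsCayleyForm Φ) {F : E8 × E8 × E8 → ℝ}
    (hF : Differentiable ℝ F) (hi : IsSpinInvariant₃ Φ F) {X : Matrix (Fin 8) (Fin 8) ℝ}
    (hX : ∀ a b, X a b = -X b a) (hJ : J2 Φ X = X) (x : E8 × E8 × E8) :
    fderiv ℝ F x (mulVec₃ X x) = 0 := by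
  have h1 : ∀ p : E8, HasDerivAt (fun t : ℝ => (NormedSpace.exp (t • X)).mulVec p) (X.mulVec p) 0 := by
    intro p
    rw [hasDerivAt_pi]
    intro a
    have h2 : HasDerivAt (fun t : ℝ => ∑ i, NormedSpace.exp (t • X) a i * p i)
        (∑ i, (∑ m, NormedSpace.exp ((0 : ℝ) • X) a m * X m i) * p i) 0 :=
      HasDerivAt.fun_sum fun i _ => (hasDerivAt_exp_entry X a i 0).mul_const (p i)
    have e : ∑ i, (∑ m, NormedSpace.exp ((0 : ℝ) • X) a m * X m i) * p i = X.mulVec p a := by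
      simp only [zero_smul, NormedSpace.exp_zero, Matrix.one_apply, ite_mul, one_mul, zero_mul,
        Finset.sum_ite_eq, Finset.mem_univ, if_true]
      rfl
    rw [e] at h2
    exact h2
  have h3 : HasDerivAt (fun t : ℝ => mulVec₃ (NormedSpace.exp (t • X)) x) (mulVec₃ X x) 0 :=
    (h1 x.1).prodMk ((h1 x.2.1).prodMk (h1 x.2.2))
  have h4 : mulVec₃ (NormedSpace.exp ((0 : ℝ) • X)) x = x := by
    simp [mulVec₃, NormedSpace.exp_zero]
  have h5 := (h4.symm ▸ (hF x).hasFDerivAt : HasFDerivAt F (fderiv ℝ F x)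
    (mulVec₃ (NormedSpace.exp ((0 : ℝ) • X)) x)).comp_hasDerivAt (0 : ℝ) h3
  have h6 : F ∘ (fun t : ℝ => mulVec₃ (NormedSpace.exp (t • X)) x) = fun _ => F x := by
    funext t
    exact hi _ (hΦ.exp_mem_spin7 hX hJ t) _ _ _
  rw [h6] at h5
  exact h5.unique (hasDerivAt_const _ _)

theorem mulVec₃_add (X Y : Matrix (Fin 8) (Fin 8) ℝ) (x : E8 × E8 × E8) :
    mulVec₃ (X + Y) x = mulVec₃ X x + mulVec₃ Y x := by
  simp [mulVec₃, Matrix.add_mulVec]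

theorem mulVec₃_smul (c : ℝ) (X : Matrix (Fin 8) (Fin 8) ℝ) (x : E8 × E8 × E8) :
    mulVec₃ (c • X) x = c • mulVec₃ X x := by
  simp [mulVec₃, Matrix.smul_mulVec]

/-- The 2-form `v ∧ w`. -/
def wedge₂ (v w : E8) : T2 := fun a b => v a * w b - w a * v b

theorem IsCayleyForm.clifford_polar (hΦ : IsCayleyForm Φ) {ξ η : T2} (hξ : ∀ a b, ξ a b = -ξ b a)
    (h : ∀ a b, J2 Φ ξ a b = -3 * ξ a b) (hη : ∀ a b, η a b = -η b a)
    (h' : ∀ a b, J2 Φ η a b = -3 * η a b) (a b : Fin 8) :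
    ∑ c, ξ a c * η b c + ∑ c, η a c * ξ b c = if a = b then 1 / 4 * frob ξ η else 0 := by
  have h1 := hΦ.clifford hξ h a b
  have h2 := hΦ.clifford hη h' a b
  have h3 := hΦ.clifford (ξ := ξ + η)
    (fun a b => by rw [Pi.add_apply, Pi.add_apply, Pi.add_apply, Pi.add_apply, hξ, hη]; ring)
    (fun a b => by rw [J2_add, Pi.add_apply, Pi.add_apply, Pi.add_apply, Pi.add_apply, h, h']; ring) a b
  simp only [Pi.add_apply, mul_add, add_mul, Finset.sum_add_distrib] at h3
  rw [frob_add_left, frob_add_right, frob_add_right, frob_comm η ξ] at h3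
  split_ifs at * <;> linarith

/-- The vector `ξ v`. -/
def apply₂ (ξ : T2) (v : E8) : E8 := fun b => ∑ c, ξ b c * v c

/-- Contracting the polarised Clifford relation with v ⊗ v. It says that v ∧ ξv pairs with Λ²_7 as a
multiple of ξ does. -/
theorem IsCayleyForm.frob_wedge_apply (hΦ : IsCayleyForm Φ) {ξ η : T2} (hξ : ∀ a b, ξ a b = -ξ b a)
    (h : ∀ a b, J2 Φ ξ a b = -3 * ξ a b) (hη : ∀ a b, η a b = -η b a)
    (h' : ∀ a b, J2 Φ η a b = -3 * η a b) (v : E8) :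
    frob (wedge₂ v (apply₂ ξ v)) η = -(1 / 4) * (v ⬝ᵥ v) * frob ξ η := by
  set S := ∑ a, ∑ c, v a * v c * ∑ b, η a b * ξ c b
  have e1 : S = ∑ a, ∑ c, v a * v c * ∑ b, ξ a b * η c b := by
    simp only [S]
    rw [Finset.sum_comm]
    refine Finset.sum_congr rfl fun a _ => Finset.sum_congr rfl fun c _ => ?_
    simp only [mul_comm (v c), mul_comm (η c _)]
  have e2 : 2 * S = 1 / 4 * frob ξ η * (v ⬝ᵥ v) := by
    have hc : ∀ a c, ∑ b, (ξ a b * η c b + η a b * ξ c b) =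
        if a = c then 1 / 4 * frob ξ η else 0 := fun a c => by
      rw [Finset.sum_add_distrib, hΦ.clifford_polar hξ h hη h']
    rw [two_mul]
    nth_rewrite 1 [e1]
    simp only [S, ← Finset.sum_add_distrib, ← mul_add, hc, mul_ite, mul_zero, Finset.sum_ite_eq,
      Finset.mem_univ, if_true]
    simp only [dotProduct, Finset.mul_sum]
    refine Finset.sum_congr rfl fun a _ => ?_
    ring
  have e3 : ∑ a, ∑ b, v a * apply₂ ξ v b * η a b = -S := by
    simp only [S, apply₂, Finset.mul_sum, Finset.sum_mul, ← Finset.sum_neg_distrib]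
    refine Finset.sum_congr rfl fun a _ => ?_
    rw [Finset.sum_comm]
    refine Finset.sum_congr rfl fun b _ => Finset.sum_congr rfl fun c _ => ?_
    rw [hξ c b]; ring
  have e4 : ∑ a, ∑ b, apply₂ ξ v a * v b * η a b = S := by
    rw [Finset.sum_comm, ← neg_eq_iff_eq_neg.2 e3]
    simp only [← Finset.sum_neg_distrib]
    refine Finset.sum_congr rfl fun a _ => Finset.sum_congr rfl fun b _ => ?_
    rw [hη b a]; ring
  simp only [frob, wedge₂, sub_mul, Finset.sum_sub_distrib]
  rw [e3, e4]
  have : frob ξ η = ∑ a, ∑ b, ξ a b * η a b := rfl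
  rw [← this]
  linarith

/-- Every element of `Λ²_7` is the projection of a decomposable 2-form `v ∧ ξ v`. -/
theorem IsCayleyForm.asdPart_wedge_apply (hΦ : IsCayleyForm Φ) {ξ : T2}
    (hξ : ∀ a b, ξ a b = -ξ b a) (h : ∀ a b, J2 Φ ξ a b = -3 * ξ a b) (v : E8) :
    asdPart Φ (wedge₂ v (apply₂ ξ v)) = (-(v ⬝ᵥ v)) • ξ := by
  set N := wedge₂ v (apply₂ ξ v)
  set D := asdPart Φ N + (v ⬝ᵥ v) • ξ with hD
  have a1 : ∀ a b, D a b = -D b a := by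
    intro a b
    simp only [hD, Pi.add_apply, Pi.smul_apply, smul_eq_mul]
    rw [hΦ.asdPart_antisymm, hξ]; ring
  have a2 : ∀ a b, J2 Φ D a b = -3 * D a b := by
    intro a b
    simp only [hD, J2_add, J2_smul, Pi.add_apply, Pi.smul_apply, smul_eq_mul, hΦ.J2_asdPart, h]
    ring
  -- D lies in Λ²_7 and is orthogonal to all of Λ²_7, in particular to itself.
  have e : frob D D = 0 := by
    nth_rewrite 1 [hD]
    rw [frob_add_left, frob_smul_left, hΦ.frob_asdPart N a1 a2, hΦ.frob_wedge_apply hξ h a1 a2]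
    ring
  have := frob_self_eq_zero e
  rw [hD] at this
  rw [neg_smul]
  exact eq_neg_of_add_eq_zero_left this

theorem exists_orthogonal₆ (x : Fin 6 → E8) : ∃ v : E8, v ≠ 0 ∧ ∀ i, x i ⬝ᵥ v = 0 := by
  let T : E8 →ₗ[ℝ] (Fin 6 → ℝ) := Matrix.mulVecLin (Matrix.of x)
  have : LinearMap.ker T ≠ ⊥ := LinearMap.ker_ne_bot_of_finrank_lt (by simp)
  obtain ⟨v, hv, hv0⟩ := Submodule.exists_mem_ne_zero_of_ne_bot this
  exact ⟨v, hv0, fun i => congrFun hv i⟩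

theorem dotProduct_self_pos {v : E8} (hv : v ≠ 0) : 0 < v ⬝ᵥ v := by
  have h : v ⬝ᵥ v ≠ 0 := fun h => hv (dotProduct_self_eq_zero.1 h)
  exact lt_of_le_of_ne (Finset.sum_nonneg fun i _ => mul_self_nonneg _) h.symm

/-- Functions of three vectors that are invariant under `Spin(7)` are invariant under all
infinitesimal rotations. -/
theorem IsSpinInvariant₃.fderiv_rotation (hΦ : IsCayleyForm Φ) {F : E8 × E8 × E8 → ℝ}
    (hF : Differentiable ℝ F) (hi : IsSpinInvariant₃ Φ F) {Y : T2}
    (hY : ∀ a b, Y a b = -Y b a) (x : E8 × E8 × E8) :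
    fderiv ℝ F x (mulVec₃ (Matrix.of Y) x) = 0 := by
  -- Subtracting the Λ²_7 part from N leaves an element of spin(7), along which the derivative is
  -- zero.
  have h21 : ∀ N : T2, (∀ a b, N a b = -N b a) →
      fderiv ℝ F x (mulVec₃ (Matrix.of N) x) =
        1 / 4 * fderiv ℝ F x (mulVec₃ (Matrix.of (asdPart Φ N)) x) := by
    intro N hN
    have h1 : fderiv ℝ F x (mulVec₃ (Matrix.of (N + (-(1 / 4) : ℝ) • asdPart Φ N)) x) = 0 := by
      refine hi.fderiv_eq_zero hΦ hF (fun a b => ?_) ?_ x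
      · simp only [Matrix.of_apply, Pi.add_apply, Pi.smul_apply, smul_eq_mul]
        rw [hN, hΦ.asdPart_antisymm]; ring
      · change J2 Φ (N + (-(1 / 4) : ℝ) • asdPart Φ N) = N + (-(1 / 4) : ℝ) • asdPart Φ N
        funext a b
        rw [J2_add, J2_smul]
        simp only [Pi.add_apply, Pi.smul_apply, smul_eq_mul, hΦ.J2_asdPart]
        simp only [asdPart, hN b a]; ring
    have h2 : Matrix.of (N + (-(1 / 4) : ℝ) • asdPart Φ N) =
      Matrix.of N + (-(1 / 4) : ℝ) • Matrix.of (asdPart Φ N) := rfl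
    rw [h2, mulVec₃_add, mulVec₃_smul, map_add, map_smul, smul_eq_mul] at h1
    linarith
  -- With v orthogonal to the three vectors and to their images under ξ, the 2-form v ∧ ξv
  -- annihilates the three vectors, so the derivative along it is trivially zero. Its Λ²_7 part is a
  -- nonzero multiple of ξ, and `h21` transfers the vanishing to ξ.
  have h7 : ∀ ξ : T2, (∀ a b, ξ a b = -ξ b a) → (∀ a b, J2 Φ ξ a b = -3 * ξ a b) →
      fderiv ℝ F x (mulVec₃ (Matrix.of ξ) x) = 0 := by
    intro ξ hξ h
    obtain ⟨v, hv0, hv⟩ := exists_orthogonal₆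
      ![x.1, x.2.1, x.2.2, apply₂ ξ x.1, apply₂ ξ x.2.1, apply₂ ξ x.2.2]
    have hkill : ∀ y : E8, y ⬝ᵥ v = 0 → apply₂ ξ y ⬝ᵥ v = 0 →
        (Matrix.of (wedge₂ v (apply₂ ξ v))).mulVec y = 0 := by
      intro y h1 h2
      have h3 : apply₂ ξ v ⬝ᵥ y = 0 := by
        rw [← neg_eq_zero, ← h2]
        simp only [apply₂, dotProduct, Finset.sum_mul, ← Finset.sum_neg_distrib]
        rw [Finset.sum_comm]
        refine Finset.sum_congr rfl fun a _ => Finset.sum_congr rfl fun b _ => ?_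
        rw [hξ b a]; ring
      rw [dotProduct_comm] at h1
      funext a
      simp only [Matrix.mulVec, dotProduct, Matrix.of_apply, wedge₂, sub_mul,
        Finset.sum_sub_distrib, mul_assoc, ← Finset.mul_sum, Pi.zero_apply] at *
      rw [h1, h3]; ring
    have h0 : mulVec₃ (Matrix.of (wedge₂ v (apply₂ ξ v))) x = 0 := by
      have h0 := hv 0
      have h1 := hv 1
      have h2 := hv 2
      have h3 := hv 3
      have h4 := hv 4
      have h5 := hv 5
      simp only [mulVec₃, hkill x.1 h0 h3, hkill x.2.1 h1 h4, hkill x.2.2 h2 h5]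
      rfl
    have h1 := h21 (wedge₂ v (apply₂ ξ v)) fun a b => by simp only [wedge₂]; ring
    have h2 : Matrix.of ((-(v ⬝ᵥ v)) • ξ) = (-(v ⬝ᵥ v)) • Matrix.of ξ := rfl
    rw [h0, map_zero, hΦ.asdPart_wedge_apply hξ h, h2, mulVec₃_smul, map_smul, smul_eq_mul] at h1
    have h3 := dotProduct_self_pos hv0
    have h4 : (v ⬝ᵥ v) * fderiv ℝ F x (mulVec₃ (Matrix.of ξ) x) = 0 := by linarith
    exact (mul_eq_zero.1 h4).resolve_left h3.ne'
  rw [h21 Y hY, h7 _ (hΦ.asdPart_antisymm Y) (hΦ.J2_asdPart Y), mul_zero]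

end
end Cayley
end

noncomputable section
namespace Cayley

/-! ### Plane rotations -/

/-- The rotation by the angle `t` in the plane of the orthonormal vectors `a` and `b`. -/
def planeRot (a b : E8) (t : ℝ) (x : E8) : E8 :=
  x + ((Real.cos t - 1) * (a ⬝ᵥ x) - Real.sin t * (b ⬝ᵥ x)) • a +
    (Real.sin t * (a ⬝ᵥ x) + (Real.cos t - 1) * (b ⬝ᵥ x)) • b

/-- Invariance of a function of three vectors under plane rotations. -/
def IsRotInvariant₃ (F : E8 × E8 × E8 → ℝ) : Prop :=
  ∀ a b : E8, a ⬝ᵥ a = 1 → b ⬝ᵥ b = 1 → a ⬝ᵥ b = 0 → ∀ t p u w,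
    F (planeRot a b t p, planeRot a b t u, planeRot a b t w) = F (p, u, w)

theorem wedge₂_mulVec (a b x : E8) :
    (Matrix.of (wedge₂ b a)).mulVec x = (a ⬝ᵥ x) • b - (b ⬝ᵥ x) • a := by
  funext i
  simp only [Matrix.mulVec, dotProduct, Matrix.of_apply, wedge₂, sub_mul, Finset.sum_sub_distrib,
    mul_assoc, ← Finset.mul_sum, Pi.sub_apply, Pi.smul_apply, smul_eq_mul]
  ring

theorem hasDerivAt_planeRot {a b : E8} (ha : a ⬝ᵥ a = 1) (hb : b ⬝ᵥ b = 1) (hab : a ⬝ᵥ b = 0)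
    (x : E8) (t : ℝ) : HasDerivAt (fun t => planeRot a b t x)
      ((Matrix.of (wedge₂ b a)).mulVec (planeRot a b t x)) t := by
  have hc := Real.hasDerivAt_cos t
  have hs := Real.hasDerivAt_sin t
  have h := ((((hc.sub_const 1).mul_const (a ⬝ᵥ x)).sub (hs.mul_const (b ⬝ᵥ x))).smul_const a
    |>.const_add x).add (((hs.mul_const (a ⬝ᵥ x)).add
      ((hc.sub_const 1).mul_const (b ⬝ᵥ x))).smul_const b)
  have hba : b ⬝ᵥ a = 0 := by rw [dotProduct_comm, hab]
  have e : (Matrix.of (wedge₂ b a)).mulVec (planeRot a b t x) =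
      (-Real.sin t * (a ⬝ᵥ x) - Real.cos t * (b ⬝ᵥ x)) • a +
        (Real.cos t * (a ⬝ᵥ x) + -Real.sin t * (b ⬝ᵥ x)) • b := by
    rw [wedge₂_mulVec]
    simp only [planeRot, dotProduct_add, dotProduct_smul, ha, hb, hab, hba, smul_eq_mul]
    funext i
    simp only [Pi.add_apply, Pi.sub_apply, Pi.smul_apply, smul_eq_mul]
    ring
  rw [e]
  exact h

theorem IsSpinInvariant₃.isRotInvariant₃ {Φ : T4} (hΦ : IsCayleyForm Φ) {F : E8 × E8 × E8 → ℝ}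
    (hF : Differentiable ℝ F) (hi : IsSpinInvariant₃ Φ F) : IsRotInvariant₃ F := by
  intro a b ha hb hab t p u w
  have h1 : ∀ s : ℝ, HasDerivAt
      (fun s => F (planeRot a b s p, planeRot a b s u, planeRot a b s w)) 0 s := by
    intro s
    have h2 := (hasDerivAt_planeRot ha hb hab p s).prodMk
      ((hasDerivAt_planeRot ha hb hab u s).prodMk (hasDerivAt_planeRot ha hb hab w s))
    have h3 := (hF (planeRot a b s p, planeRot a b s u,
      planeRot a b s w)).hasFDerivAt.comp_hasDerivAt s h2
    have h4 := hi.fderiv_rotation hΦ hF (Y := wedge₂ b a)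
      (fun i j => by simp only [wedge₂]; ring)
      (planeRot a b s p, planeRot a b s u, planeRot a b s w)
    rw [mulVec₃] at h4
    rw [h4] at h3
    exact h3
  have hc := is_const_of_deriv_eq_zero (fun s => (h1 s).differentiableAt)
    (fun s => (h1 s).deriv) t 0
  have h0 : ∀ x, planeRot a b 0 x = x := by intro x; simp [planeRot]
  simpa only [h0] using hc

theorem planeRot_dotProduct {a b : E8} (ha : a ⬝ᵥ a = 1) (hb : b ⬝ᵥ b = 1) (hab : a ⬝ᵥ b = 0)
    (t : ℝ) (x y : E8) : planeRot a b t x ⬝ᵥ planeRot a b t y = x ⬝ᵥ y := by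
  have hba : b ⬝ᵥ a = 0 := by rw [dotProduct_comm, hab]
  simp only [planeRot, dotProduct_add, add_dotProduct, dotProduct_smul, smul_dotProduct, ha, hb,
    hab, hba, smul_eq_mul, dotProduct_comm x a, dotProduct_comm x b]
  linear_combination ((a ⬝ᵥ x) * (a ⬝ᵥ y) + (b ⬝ᵥ x) * (b ⬝ᵥ y)) * Real.sin_sq_add_cos_sq t

theorem planeRot_of_orthogonal {a b : E8} (t : ℝ) {x : E8} (ha : a ⬝ᵥ x = 0) (hb : b ⬝ᵥ x = 0) :
    planeRot a b t x = x := by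
  simp [planeRot, ha, hb]

/-- A rotation that moves a vector into the span of the first `k + 1` basis vectors and fixes
the first `k` basis vectors. -/
theorem exists_planeRot_eq_zero (k : Fin 8) (hk : k < 7) (v : E8) :
    ∃ b : E8, ∃ t : ℝ, b ⬝ᵥ b = 1 ∧ (∀ j ≤ k, b j = 0) ∧
      ∀ j, k < j → planeRot (Pi.single k 1) b t v j = 0 := by
  set v' : E8 := fun j => if k < j then v j else 0 with hv'
  by_cases h0 : v' = 0
  -- Nothing has to be moved: the angle is 0, and any admissible second axis will do.
  · refine ⟨Pi.single 7 1, 0, by simp, fun j hj => ?_, fun j hj => ?_⟩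
    · rw [Pi.single_apply, if_neg]
      rintro rfl; exact absurd hk (not_lt.2 hj)
    · have := congrFun h0 j
      simp only [hv', if_pos hj, Pi.zero_apply] at this
      simp [planeRot, this]
  · have hn := dotProduct_self_pos h0
    set n := Real.sqrt (v' ⬝ᵥ v') with hnd
    have hn0 : 0 < n := Real.sqrt_pos.2 hn
    have hnn : n * n = v' ⬝ᵥ v' := Real.mul_self_sqrt hn.le
    -- Along b, the rotated vector has component sin t · v_k + cos t · n; it vanishes when t is the
    -- argument of v_k - i n.
    set z : ℂ := ⟨v k, -n⟩ with hz
    have hz0 : ‖z‖ ≠ 0 := by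
      rw [norm_ne_zero_iff]
      intro h
      have := congrArg Complex.im h
      simp only [hz, Complex.zero_im] at this
      linarith
    have hcos := Complex.norm_mul_cos_arg z
    have hsin := Complex.norm_mul_sin_arg z
    have hang : Real.sin z.arg * v k + Real.cos z.arg * n = 0 := by
      have : ‖z‖ * (Real.sin z.arg * v k + Real.cos z.arg * n) = 0 := by
        linear_combination v k * hsin + n * hcos
      exact (mul_eq_zero.1 this).resolve_left hz0
    have hbv : (n⁻¹ • v') ⬝ᵥ v = n := by
      have : v' ⬝ᵥ v = v' ⬝ᵥ v' := by
        refine Finset.sum_congr rfl fun j _ => ?_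
        simp only [hv']; split_ifs <;> simp
      rw [smul_dotProduct, this, ← hnn, smul_eq_mul]; field_simp
    refine ⟨n⁻¹ • v', z.arg, ?_, fun j hj => ?_, fun j hj => ?_⟩
    · rw [smul_dotProduct, dotProduct_smul, ← hnn, smul_eq_mul, smul_eq_mul]; field_simp
    · simp [hv', not_lt.2 hj]
    · have hne : j ≠ k := hj.ne'
      have h1 : v j = n * (n⁻¹ • v') j := by
        simp only [hv', Pi.smul_apply, if_pos hj, smul_eq_mul]; field_simp
      have hs : (Pi.single k (1 : ℝ) : E8) j = 0 := by simp [hne]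
      have hk1 : (Pi.single k (1 : ℝ) : E8) ⬝ᵥ v = v k := by simp
      change v j + ((Real.cos z.arg - 1) * _ - Real.sin z.arg * _) * (Pi.single k (1 : ℝ) : E8) j +
        (Real.sin z.arg * _ + (Real.cos z.arg - 1) * _) * (n⁻¹ • v') j = 0
      rw [hs, hk1, hbv]
      linear_combination h1 + (n⁻¹ • v') j * hang

/-- The vector with components `(x, y, z, 0, …, 0)`. -/
def vec₃ (x y z : ℝ) : E8 := ![x, y, z, 0, 0, 0, 0, 0]

theorem vec₃_dotProduct (x y z x' y' z' : ℝ) :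
    vec₃ x y z ⬝ᵥ vec₃ x' y' z' = x * x' + y * y' + z * z' := by
  simp [vec₃, dotProduct, Fin.sum_univ_succ]; ring

theorem eq_vec₃ {v : E8} (h : ∀ j, 2 < j → v j = 0) : v = vec₃ (v 0) (v 1) (v 2) := by
  funext j
  fin_cases j
  · rfl
  · rfl
  · rfl
  all_goals exact h _ (by decide)

/-- Every triple of vectors can be rotated into the span of the first three basis vectors. -/
theorem IsRotInvariant₃.exists_vec₃ {F : E8 × E8 × E8 → ℝ} (hF : IsRotInvariant₃ F) (p u w : E8) :
    ∃ r x y z₀ z₁ z₂ : ℝ, F (p, u, w) = F (vec₃ r 0 0, vec₃ x y 0, vec₃ z₀ z₁ z₂) ∧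
      r * r = p ⬝ᵥ p ∧ r * x = p ⬝ᵥ u ∧ x * x + y * y = u ⬝ᵥ u ∧ r * z₀ = p ⬝ᵥ w ∧
      x * z₀ + y * z₁ = u ⬝ᵥ w ∧ z₀ * z₀ + z₁ * z₁ + z₂ * z₂ = w ⬝ᵥ w := by
  have hs : ∀ k : Fin 8, (Pi.single k 1 : E8) ⬝ᵥ Pi.single k 1 = 1 := by intro k; simp
  obtain ⟨b, t, hb1, hb0, h1⟩ := exists_planeRot_eq_zero 0 (by decide) p
  have ob : (Pi.single 0 1 : E8) ⬝ᵥ b = 0 := by simp [hb0]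
  set R := planeRot (Pi.single 0 1) b t
  obtain ⟨c, s, hc1, hc0, h2⟩ := exists_planeRot_eq_zero 1 (by decide) (R u)
  have oc : (Pi.single 1 1 : E8) ⬝ᵥ c = 0 := by simp [hc0]
  set S := planeRot (Pi.single 1 1) c s
  obtain ⟨d, q, hd1, hd0, h3⟩ := exists_planeRot_eq_zero 2 (by decide) (S (R w))
  have od : (Pi.single 2 1 : E8) ⬝ᵥ d = 0 := by simp [hd0]
  set T := planeRot (Pi.single 2 1) d q
  have ep : R p = vec₃ (R p 0) 0 0 := by
    have := eq_vec₃ (v := R p) fun j hj => h1 j (lt_trans (by decide) hj)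
    rwa [h1 1 (by decide), h1 2 (by decide)] at this
  -- Each later rotation acts in a plane orthogonal to the vectors already normalised, and so fixes
  -- them.
  have ep2 : S (R p) = R p := by
    refine planeRot_of_orthogonal _ ?_ ?_
    · rw [ep]; simp [vec₃]
    · rw [ep]; simp [vec₃, dotProduct, Fin.sum_univ_succ, hc0]
  have ep3 : T (S (R p)) = vec₃ (R p 0) 0 0 := by
    rw [ep2, ← ep]
    refine planeRot_of_orthogonal _ ?_ ?_
    · rw [ep]; simp [vec₃]
    · rw [ep]; simp [vec₃, dotProduct, Fin.sum_univ_succ, hd0]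
  have eu : S (R u) = vec₃ (S (R u) 0) (S (R u) 1) 0 := by
    have := eq_vec₃ (v := S (R u)) fun j hj => h2 j (lt_trans (by decide) hj)
    rwa [h2 2 (by decide)] at this
  have eu2 : T (S (R u)) = vec₃ (S (R u) 0) (S (R u) 1) 0 := by
    rw [← eu]
    refine planeRot_of_orthogonal _ ?_ ?_
    · rw [eu]; simp [vec₃]
    · rw [eu]; simp [vec₃, dotProduct, Fin.sum_univ_succ, hd0]
  have ew : T (S (R w)) = vec₃ (T (S (R w)) 0) (T (S (R w)) 1) (T (S (R w)) 2) :=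
    eq_vec₃ fun j hj => h3 j hj
  have hdot : ∀ x y, T (S (R x)) ⬝ᵥ T (S (R y)) = x ⬝ᵥ y := fun x y => by
    rw [planeRot_dotProduct (hs 2) hd1 od, planeRot_dotProduct (hs 1) hc1 oc,
      planeRot_dotProduct (hs 0) hb1 ob]
  refine ⟨R p 0, S (R u) 0, S (R u) 1, T (S (R w)) 0, T (S (R w)) 1, T (S (R w)) 2, ?_, ?_, ?_,
    ?_, ?_, ?_, ?_⟩
  · rw [← ew, ← eu2, ← ep3, hF _ _ (hs 2) hd1 od, hF _ _ (hs 1) hc1 oc, hF _ _ (hs 0) hb1 ob]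
  · rw [← hdot p p, ep3, vec₃_dotProduct]; ring
  · rw [← hdot p u, ep3, eu2, vec₃_dotProduct]; ring
  · rw [← hdot u u, eu2, vec₃_dotProduct]; ring
  · rw [← hdot p w, ep3, ew, vec₃_dotProduct]; simp only [vec₃, Matrix.cons_val]; ring
  · rw [← hdot u w, eu2, ew, vec₃_dotProduct]; simp only [vec₃, Matrix.cons_val]; ring
  · rw [← hdot w w, ew, vec₃_dotProduct]; simp only [vec₃, Matrix.cons_val]

/-- A sign change of one coordinate is realised by a proper rotation, namely a half-turn in a plane
containing the unused axis e_3. Such flips eliminate odd monomials from the normal forms. -/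
theorem planeRot_pi (i : Fin 8) (x : E8) (hx : x 3 = 0) :
    planeRot (Pi.single i 1) (Pi.single 3 1) Real.pi x = x - (2 * x i) • Pi.single i 1 := by
  funext j
  simp [planeRot, hx]; ring

theorem planeRot_pi_div_two (i j : Fin 8) (x : E8) :
    planeRot (Pi.single i 1) (Pi.single j 1) (Real.pi / 2) x =
      x - (x i + x j) • Pi.single i 1 + (x i - x j) • Pi.single j 1 := by
  funext k
  simp [planeRot]; ring

theorem IsRotInvariant₃.flip₁ {F : E8 × E8 × E8 → ℝ} (hF : IsRotInvariant₃ F)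
    (p₀ p₁ p₂ u₀ u₁ u₂ w₀ w₁ w₂ : ℝ) :
    F (vec₃ p₀ (-p₁) p₂, vec₃ u₀ (-u₁) u₂, vec₃ w₀ (-w₁) w₂) =
      F (vec₃ p₀ p₁ p₂, vec₃ u₀ u₁ u₂, vec₃ w₀ w₁ w₂) := by
  have h : ∀ x y z, planeRot (Pi.single 1 1) (Pi.single 3 1) Real.pi (vec₃ x y z) =
      vec₃ x (-y) z := by
    intro x y z
    rw [planeRot_pi _ _ rfl]
    funext j
    fin_cases j <;> simp [vec₃]
    ring
  simpa only [h] using hF (Pi.single 1 1) (Pi.single 3 1) (by simp) (by simp) (by simp) Real.pi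
    (vec₃ p₀ p₁ p₂) (vec₃ u₀ u₁ u₂) (vec₃ w₀ w₁ w₂)

theorem IsRotInvariant₃.flip₂ {F : E8 × E8 × E8 → ℝ} (hF : IsRotInvariant₃ F)
    (p₀ p₁ p₂ u₀ u₁ u₂ w₀ w₁ w₂ : ℝ) :
    F (vec₃ p₀ p₁ (-p₂), vec₃ u₀ u₁ (-u₂), vec₃ w₀ w₁ (-w₂)) =
      F (vec₃ p₀ p₁ p₂, vec₃ u₀ u₁ u₂, vec₃ w₀ w₁ w₂) := by
  have h : ∀ x y z, planeRot (Pi.single 2 1) (Pi.single 3 1) Real.pi (vec₃ x y z) =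
      vec₃ x y (-z) := by
    intro x y z
    rw [planeRot_pi _ _ rfl]
    funext j
    fin_cases j <;> simp [vec₃]
    ring
  simpa only [h] using hF (Pi.single 2 1) (Pi.single 3 1) (by simp) (by simp) (by simp) Real.pi
    (vec₃ p₀ p₁ p₂) (vec₃ u₀ u₁ u₂) (vec₃ w₀ w₁ w₂)

theorem IsRotInvariant₃.swap₁₂ {F : E8 × E8 × E8 → ℝ} (hF : IsRotInvariant₃ F)
    (p₀ p₁ p₂ u₀ u₁ u₂ w₀ w₁ w₂ : ℝ) :
    F (vec₃ p₀ (-p₂) p₁, vec₃ u₀ (-u₂) u₁, vec₃ w₀ (-w₂) w₁) =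
      F (vec₃ p₀ p₁ p₂, vec₃ u₀ u₁ u₂, vec₃ w₀ w₁ w₂) := by
  have h : ∀ x y z, planeRot (Pi.single 1 1) (Pi.single 2 1) (Real.pi / 2) (vec₃ x y z) =
      vec₃ x (-z) y := by
    intro x y z
    funext j
    rw [planeRot_pi_div_two]
    simp only [Pi.add_apply, Pi.sub_apply, Pi.smul_apply]
    fin_cases j <;> simp [vec₃]
  simpa only [h] using hF (Pi.single 1 1) (Pi.single 2 1) (by simp) (by simp) (by simp) (Real.pi / 2)
    (vec₃ p₀ p₁ p₂) (vec₃ u₀ u₁ u₂) (vec₃ w₀ w₁ w₂)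

end Cayley
end

noncomputable section
namespace Cayley

variable {Φ : T4}

/-! ### The six terms -/

/-- The component `h_{ab}` as a linear form. -/
def hForm (Φ : T4) (a b : Fin 8) : FieldSpace Φ →ₗ[ℝ] ℝ where
  toFun f := f.1.1 a b
  map_add' _ _ := rfl
  map_smul' _ _ := rfl

/-- The component `ξ_{ab}` as a linear form. -/
def xForm (Φ : T4) (a b : Fin 8) : FieldSpace Φ →ₗ[ℝ] ℝ where
  toFun f := f.1.2 a b
  map_add' _ _ := rfl
  map_smul' _ _ := rfl

/-- The trace of `h` as a linear form. -/
def trForm (Φ : T4) : FieldSpace Φ →ₗ[ℝ] ℝ := ∑ a, hForm Φ a a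

/-- The trace of a tensor. -/
def tr (t : T2) : ℝ := ∑ a, t a a

/-- The contraction of a covector with the first index of a tensor. -/
def contr (p : E8) (t : T2) : E8 := fun b => ∑ a, p a * t a b

@[simp] theorem hForm_apply (a b : Fin 8) (f : FieldSpace Φ) : hForm Φ a b f = f.1.1 a b := rfl

@[simp] theorem xForm_apply (a b : Fin 8) (f : FieldSpace Φ) : xForm Φ a b f = f.1.2 a b := rfl

@[simp] theorem trForm_apply (f : FieldSpace Φ) : trForm Φ f = tr f.1.1 := by
  simp [trForm, tr]

open LinearMap.BilinForm (linMulLin)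

/-- The general combination of the six terms. -/
def sixTerms (Φ : T4) (ρ α β γ lam μ : ℝ) : QuadLagrangian Φ where
  A a b := (-β) • linMulLin (trForm Φ) (hForm Φ a b)
  B a b := (if a = b then (1 : ℝ) else 0) •
      ((ρ / 2) • (∑ c, ∑ d, linMulLin (hForm Φ c d) (hForm Φ c d))
        + (α / 2) • linMulLin (trForm Φ) (trForm Φ)
        + (lam / 2) • (∑ c, ∑ d, linMulLin (xForm Φ c d) (xForm Φ c d)))
    + (-γ) • (∑ c, linMulLin (hForm Φ a c) (hForm Φ b c))
    + (-μ) • (∑ c, linMulLin (hForm Φ a c) (xForm Φ b c))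

theorem sixTerms_A_apply (ρ α β γ lam μ : ℝ) (a b : Fin 8) (f k : FieldSpace Φ) :
    (sixTerms Φ ρ α β γ lam μ).A a b f k = -β * (tr f.1.1 * k.1.1 a b) := by
  simp [sixTerms]

theorem sixTerms_B_apply (ρ α β γ lam μ : ℝ) (a b : Fin 8) (f k : FieldSpace Φ) :
    (sixTerms Φ ρ α β γ lam μ).B a b f k = (if a = b then (1 : ℝ) else 0) *
      (ρ / 2 * frob f.1.1 k.1.1 + α / 2 * (tr f.1.1 * tr k.1.1) + lam / 2 * frob f.1.2 k.1.2)
      - γ * (f.1.1 a ⬝ᵥ k.1.1 b) - μ * (f.1.1 a ⬝ᵥ k.1.2 b) := by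
  split_ifs with h <;> simp [sixTerms, LinearMap.sum_apply, frob, dotProduct, h] <;> ring

theorem sum_mul_dotProduct (p : E8) (s t : T2) :
    ∑ a, ∑ b, p a * p b * (s a ⬝ᵥ t b) = contr p s ⬝ᵥ contr p t := by
  simp only [dotProduct, contr, Finset.sum_mul_sum]
  simp only [Finset.mul_sum]
  rw [Finset.sum_comm_cycle]
  refine Finset.sum_congr rfl fun c _ => Finset.sum_congr rfl fun a _ =>
    Finset.sum_congr rfl fun b _ => ?_
  ring

theorem dotProduct_contr (p v : E8) (t : T2) :
    v ⬝ᵥ contr p t = ∑ a, ∑ b, p a * v b * t a b := by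
  simp only [dotProduct, contr, Finset.mul_sum]
  rw [Finset.sum_comm]
  refine Finset.sum_congr rfl fun a _ => Finset.sum_congr rfl fun b _ => ?_
  ring

/-- The β-term appears with a plus sign because both of its derivatives fall on one field, which
costs one integration by parts. -/
theorem sixTerms_quadSymbol (ρ α β γ lam μ : ℝ) (p : E8) (f : FieldSpace Φ) :
    (sixTerms Φ ρ α β γ lam μ).quadSymbol p f =
      ρ / 2 * ((p ⬝ᵥ p) * frob f.1.1 f.1.1) + α / 2 * ((p ⬝ᵥ p) * tr f.1.1 ^ 2)
        + β * (tr f.1.1 * (p ⬝ᵥ contr p f.1.1))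
        - γ * (contr p f.1.1 ⬝ᵥ contr p f.1.1)
        + lam / 2 * ((p ⬝ᵥ p) * frob f.1.2 f.1.2)
        - μ * (contr p f.1.1 ⬝ᵥ contr p f.1.2) := by
  set X := ρ / 2 * frob f.1.1 f.1.1 + α / 2 * (tr f.1.1 * tr f.1.1) + lam / 2 * frob f.1.2 f.1.2
  have e : ∀ a b, p a * p b * ((sixTerms Φ ρ α β γ lam μ).B a b f f -
      (sixTerms Φ ρ α β γ lam μ).A a b f f) =
      (if a = b then p a * p a * X else 0) - γ * (p a * p b * (f.1.1 a ⬝ᵥ f.1.1 b))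
        - μ * (p a * p b * (f.1.1 a ⬝ᵥ f.1.2 b)) + β * tr f.1.1 * (p a * p b * f.1.1 a b) := by
    intro a b
    rw [sixTerms_A_apply, sixTerms_B_apply]
    split_ifs with h
    · subst h; ring
    · ring
  simp only [QuadLagrangian.quadSymbol, e, Finset.sum_add_distrib, Finset.sum_sub_distrib,
    ← Finset.mul_sum, sum_mul_dotProduct, ← dotProduct_contr, Finset.sum_ite_eq,
    Finset.mem_univ, if_true, ← Finset.sum_mul]
  change (p ⬝ᵥ p) * X - _ - _ + _ = _
  simp only [X]; ring

theorem pd_hc {ψ : Field Φ} (hψ : ContDiff ℝ ∞ ψ) (a b c : Fin 8) :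
    pd a (hc ψ b c) = fun x => (pd a ψ x).1.1 b c :=
  pd_clm hψ (LinearMap.toContinuousLinearMap (hForm Φ b c)) a

theorem pd_xc {ψ : Field Φ} (hψ : ContDiff ℝ ∞ ψ) (a b c : Fin 8) :
    pd a (xc ψ b c) = fun x => (pd a ψ x).1.2 b c :=
  pd_clm hψ (LinearMap.toContinuousLinearMap (xForm Φ b c)) a

theorem pd_trh {ψ : Field Φ} (hψ : ContDiff ℝ ∞ ψ) (a : Fin 8) :
    pd a (trh ψ) = fun x => tr (pd a ψ x).1.1 := by
  have := pd_clm hψ (LinearMap.toContinuousLinearMap (trForm Φ)) a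
  simp only [LinearMap.coe_toContinuousLinearMap', trForm_apply] at this
  exact this

theorem pd_pd_hc {ψ : Field Φ} (hψ : ContDiff ℝ ∞ ψ) (a b c d : Fin 8) :
    pd a (pd b (hc ψ c d)) = fun x => (pd a (pd b ψ) x).1.1 c d := by
  rw [pd_hc hψ]
  exact pd_clm (contDiff_pd hψ b) (LinearMap.toContinuousLinearMap (hForm Φ c d)) a

theorem sum_sum_dotProduct (s t : Fin 8 → T2) :
    ∑ a, ∑ b, (s a a ⬝ᵥ t b b) = ∑ c, (∑ a, s a a c) * ∑ b, t b b c := by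
  simp only [dotProduct, Finset.sum_mul_sum]
  rw [Finset.sum_comm_cycle]

theorem sixTerms_density (ρ α β γ lam μ : ℝ) {ψ : Field Φ} (hψ : ContDiff ℝ ∞ ψ) (x : E8) :
    (sixTerms Φ ρ α β γ lam μ).density ψ x = lagXi ρ α β γ lam μ ψ x := by
  set X : Fin 8 → Fin 8 → ℝ := fun a b => ρ / 2 * frob (pd a ψ x).1.1 (pd b ψ x).1.1 +
    α / 2 * (tr (pd a ψ x).1.1 * tr (pd b ψ x).1.1) + lam / 2 * frob (pd a ψ x).1.2 (pd b ψ x).1.2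
  have e : ∀ a b, (sixTerms Φ ρ α β γ lam μ).A a b (ψ x) (pd a (pd b ψ) x) +
      (sixTerms Φ ρ α β γ lam μ).B a b (pd a ψ x) (pd b ψ x) =
      -β * (tr (ψ x).1.1 * (pd a (pd b ψ) x).1.1 a b) + (if a = b then X a a else 0)
        - γ * ((pd a ψ x).1.1 a ⬝ᵥ (pd b ψ x).1.1 b)
        - μ * ((pd a ψ x).1.1 a ⬝ᵥ (pd b ψ x).1.2 b) := by
    intro a b
    rw [sixTerms_A_apply, sixTerms_B_apply]
    split_ifs with h
    · subst h; ring
    · ring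
  simp only [QuadLagrangian.density, e, Finset.sum_add_distrib, Finset.sum_sub_distrib,
    ← Finset.mul_sum, Finset.sum_ite_eq, Finset.mem_univ, if_true]
  rw [sum_sum_dotProduct (fun a => (pd a ψ x).1.1)
    (fun a => (pd a ψ x).1.1),
    sum_sum_dotProduct (fun a => (pd a ψ x).1.1) (fun a => (pd a ψ x).1.2)]
  simp only [lagXi, hddh, pd_pd_hc hψ]
  simp only [dhSq, dtrSq, divhSq, dxSq, divhdivx, pd_hc hψ, pd_xc hψ, pd_trh hψ, X, Finset.sum_add_distrib, ← Finset.mul_sum, frob, pow_two]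
  change _ = _ - β * (tr (ψ x).1.1 * _) - _ + _ - _
  have hs : ∀ a b, (pd b ψ x).1.1 b a = (pd b ψ x).1.1 a b := fun a b => (pd b ψ x).2.1 b a
  simp only [hs]
  ring

theorem mulVec_dotProduct_mulVec {g : Matrix (Fin 8) (Fin 8) ℝ}
    (hg : g ∈ Matrix.orthogonalGroup (Fin 8) ℝ) (u v : E8) :
    g.mulVec u ⬝ᵥ g.mulVec v = u ⬝ᵥ v := by
  have h : g.transpose * g = 1 := (Matrix.mem_orthogonalGroup_iff' (Fin 8) ℝ).1 hg
  rw [Matrix.dotProduct_mulVec, Matrix.vecMul_mulVec, h, Matrix.vecMul_one]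

theorem contr_act2 {g : Matrix (Fin 8) (Fin 8) ℝ}
    (hg : g ∈ Matrix.orthogonalGroup (Fin 8) ℝ) (p : E8) (t : T2) :
    contr (g.mulVec p) (act2 g t) = g.mulVec (contr p t) := by
  have h : g.transpose * g = 1 := (Matrix.mem_orthogonalGroup_iff' (Fin 8) ℝ).1 hg
  have e : ∀ (q : E8) (s : T2), contr q s = (Matrix.of s).vecMul q := fun _ _ => rfl
  rw [e, e, of_act2, Matrix.vecMul_mulVec, ← Matrix.vecMul_transpose, Matrix.vecMul_vecMul,
    ← Matrix.mul_assoc, ← Matrix.mul_assoc, h, Matrix.one_mul]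

theorem tr_act2 {g : Matrix (Fin 8) (Fin 8) ℝ} (hg : g ∈ Matrix.orthogonalGroup (Fin 8) ℝ)
    (t : T2) : tr (act2 g t) = tr t := by
  have h : g.transpose * g = 1 := (Matrix.mem_orthogonalGroup_iff' (Fin 8) ℝ).1 hg
  change (Matrix.of (act2 g t)).trace = (Matrix.of t).trace
  rw [of_act2, Matrix.trace_mul_cycle, h, Matrix.one_mul]

theorem sixTerms_isSpin7Invariant (ρ α β γ lam μ : ℝ) :
    IsSpin7Invariant (sixTerms Φ ρ α β γ lam μ).density := by
  rw [QuadLagrangian.isSpin7Invariant_iff]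
  intro g hg p f
  have e1 : (spinAct hg f).1.1 = act2 g f.1.1 := rfl
  have e2 : (spinAct hg f).1.2 = act2 g f.1.2 := rfl
  simp only [sixTerms_quadSymbol, e1, e2, frob_act2 hg.1, tr_act2 hg.1, contr_act2 hg.1,
    mulVec_dotProduct_mulVec hg.1]

end Cayley
end

noncomputable section
namespace Cayley

variable {Φ : T4}

/-! ### The symbol of the six terms and gauge directions -/

theorem tr_add (s t : T2) : tr (s + t) = tr s + tr t := by
  simp [tr, Finset.sum_add_distrib]

theorem tr_zero : tr 0 = 0 := by simp [tr]

theorem contr_zero (p : E8) : contr p 0 = 0 := by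
  funext b
  simp [contr]

theorem contr_add (p : E8) (s t : T2) : contr p (s + t) = contr p s + contr p t := by
  funext b
  simp [contr, mul_add, Finset.sum_add_distrib]

theorem contr_smul (p : E8) (c : ℝ) (t : T2) : contr p (c • t) = c • contr p t := by
  funext b
  simp only [contr, Pi.smul_apply, smul_eq_mul, Finset.mul_sum]
  exact Finset.sum_congr rfl fun a _ => by ring

theorem sixTerms_symbol (ρ α β γ lam μ : ℝ) (p : E8) (f k : FieldSpace Φ) :
    (sixTerms Φ ρ α β γ lam μ).symbol p f k =
      -(ρ * ((p ⬝ᵥ p) * frob f.1.1 k.1.1) + α * ((p ⬝ᵥ p) * (tr f.1.1 * tr k.1.1))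
        + β * (tr f.1.1 * (p ⬝ᵥ contr p k.1.1) + tr k.1.1 * (p ⬝ᵥ contr p f.1.1))
        - 2 * γ * (contr p f.1.1 ⬝ᵥ contr p k.1.1)
        + lam * ((p ⬝ᵥ p) * frob f.1.2 k.1.2)
        - μ * ((contr p f.1.1 ⬝ᵥ contr p k.1.2) + (contr p k.1.1 ⬝ᵥ contr p f.1.2))) := by
  have e1 : (f + k).1.1 = f.1.1 + k.1.1 := rfl
  have e2 : (f + k).1.2 = f.1.2 + k.1.2 := rfl
  rw [QuadLagrangian.symbol_eq_polar]
  simp only [sixTerms_quadSymbol, e1, e2, frob_add_left, frob_add_right, tr_add, contr_add,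
    dotProduct_add, add_dotProduct, frob_comm k.1.1 f.1.1, frob_comm k.1.2 f.1.2,
    dotProduct_comm (contr p k.1.1) (contr p f.1.1)]
  ring

/-- The symmetric part of a tensor, as a field value with `ξ = 0`. -/
def symMap (Φ : T4) : T2 →ₗ[ℝ] FieldSpace Φ where
  toFun H := ⟨(symPart H, 0), fun a b => by simp only [symPart]; ring, fun a b => by simp,
    fun a b => by simp [J2]⟩
  map_add' s t := Subtype.ext (Prod.ext (symPart_add s t) (add_zero (0 : T2)).symm)
  map_smul' c s := Subtype.ext (Prod.ext (symPart_smul c s) (smul_zero c : c • (0 : T2) = 0).symm)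

/-- Four times the projection of a tensor to `Λ²_7`, as a field value with `h = 0`. -/
def asdMap (hΦ : IsCayleyForm Φ) : T2 →ₗ[ℝ] FieldSpace Φ where
  toFun H := ⟨(0, asdPart Φ H), fun _ _ => rfl, hΦ.asdPart_antisymm H, hΦ.J2_asdPart H⟩
  map_add' s t := Subtype.ext (Prod.ext (add_zero (0 : T2)).symm (asdPart_add Φ s t))
  map_smul' c s := Subtype.ext (Prod.ext (smul_zero c : c • (0 : T2) = 0).symm (asdPart_smul Φ c s))

theorem symMap_fst (H : T2) : (symMap Φ H).1.1 = symPart H := rfl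
theorem symMap_snd (H : T2) : (symMap Φ H).1.2 = 0 := rfl
theorem asdMap_fst (hΦ : IsCayleyForm Φ) (H : T2) : (asdMap hΦ H).1.1 = 0 := rfl
theorem asdMap_snd (hΦ : IsCayleyForm Φ) (H : T2) : (asdMap hΦ H).1.2 = asdPart Φ H := rfl
theorem gaugeMap_fst (hΦ : IsCayleyForm Φ) (H : T2) : (gaugeMap hΦ H).1.1 = symPart H := rfl
theorem gaugeMap_snd (hΦ : IsCayleyForm Φ) (H : T2) : (gaugeMap hΦ H).1.2 = asdPart Φ H := rfl

theorem symPart_of_symm {h : T2} (hs : ∀ a b, h a b = h b a) : symPart h = h := by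
  funext a b
  simp only [symPart, hs b a]; ring

theorem IsCayleyForm.eq_symMap_add_asdMap (hΦ : IsCayleyForm Φ) (f : FieldSpace Φ) :
    f = symMap Φ f.1.1 + (1 / 4 : ℝ) • asdMap hΦ f.1.2 := by
  refine Subtype.ext (Prod.ext ?_ ?_)
  · change f.1.1 = symPart f.1.1 + (1 / 4 : ℝ) • (0 : T2)
    rw [symPart_of_symm f.2.1, smul_zero, add_zero]
  · change f.1.2 = 0 + (1 / 4 : ℝ) • asdPart Φ f.1.2
    rw [asdPart_of_mem f.2.2.1 f.2.2.2, smul_smul, zero_add]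
    norm_num

theorem tr_symPart_tensor (p v : E8) : tr (symPart (tensor p v)) = p ⬝ᵥ v := by
  refine Finset.sum_congr rfl fun a _ => ?_
  simp only [symPart, tensor]; ring

theorem contr_tensor (q p v : E8) : contr q (tensor p v) = (q ⬝ᵥ p) • v := by
  funext b
  simp only [contr, tensor, Pi.smul_apply, smul_eq_mul, dotProduct, Finset.sum_mul, mul_assoc]

theorem symPart_tensor (p v : E8) :
    symPart (tensor p v) = (1 / 2 : ℝ) • (tensor p v + tensor v p) := by
  funext a b
  simp only [symPart, tensor, Pi.smul_apply, Pi.add_apply, smul_eq_mul]; ring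

theorem contr_symPart_tensor (q p v : E8) :
    contr q (symPart (tensor p v)) = (1 / 2 : ℝ) • ((q ⬝ᵥ p) • v + (q ⬝ᵥ v) • p) := by
  rw [symPart_tensor, contr_smul, contr_add, contr_tensor, contr_tensor]

theorem frob_tensor (p v : E8) (t : T2) : frob (tensor p v) t = v ⬝ᵥ contr p t := by
  rw [dotProduct_contr]; rfl

theorem frob_symPart {k : T2} (hk : ∀ a b, k a b = k b a) (H : T2) :
    frob (symPart H) k = frob H k := by
  have e : symPart H = (1 / 2 : ℝ) • (H + fun a b => H b a) := rfl
  have e2 : (fun a b => k b a) = k := funext fun a => funext fun b => hk b a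
  rw [e, frob_smul_left, frob_add_left, ← frob_swap, e2]; ring

/-- The covector p enters twice in antisymmetric slots of Φ. Consequently Φ disappears from the
divergence of a gauge direction. -/
theorem IsCayleyForm.contr_J2_tensor (hΦ : IsCayleyForm Φ) (p v : E8) :
    contr p (J2 Φ (tensor p v)) = 0 := by
  funext b
  have h : contr p (J2 Φ (tensor p v)) b = -contr p (J2 Φ (tensor p v)) b := by
    simp only [contr, J2, tensor, Finset.mul_sum, ← Finset.sum_neg_distrib]
    rw [Finset.sum_comm]
    refine Finset.sum_congr rfl fun a _ => Finset.sum_congr rfl fun c _ =>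
      Finset.sum_congr rfl fun d _ => ?_
    rw [show Φ c b a d = -Φ a b c d by
      rw [hΦ.swap₁₂ b c, hΦ.swap₂₃ b a c, hΦ.swap₁₂ a b]; ring]
    ring
  exact self_eq_neg.1 h

theorem IsCayleyForm.contr_asdPart_tensor (hΦ : IsCayleyForm Φ) (p v : E8) :
    contr p (asdPart Φ (tensor p v)) = (1 / 2 : ℝ) • ((p ⬝ᵥ p) • v - (p ⬝ᵥ v) • p) := by
  have e : asdPart Φ (tensor p v) = (1 / 2 : ℝ) • (tensor p v + (-1 : ℝ) • tensor v p)
      + (-1 : ℝ) • J2 Φ (tensor p v) := by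
    funext a b
    simp only [asdPart, tensor, Pi.add_apply, Pi.smul_apply, smul_eq_mul]; ring
  rw [e, contr_add, contr_smul, contr_smul, hΦ.contr_J2_tensor, contr_add,
    contr_smul, contr_tensor, contr_tensor, smul_zero, add_zero, neg_one_smul,
    sub_eq_add_neg]

theorem dotProduct_contr_self {η : T2} (hη : ∀ a b, η a b = -η b a) (p : E8) :
    p ⬝ᵥ contr p η = 0 := by
  have h : p ⬝ᵥ contr p η = -(p ⬝ᵥ contr p η) := by
    rw [dotProduct_contr, ← Finset.sum_neg_distrib]
    simp only [← Finset.sum_neg_distrib]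
    conv_lhs => rw [Finset.sum_comm]
    refine Finset.sum_congr rfl fun a _ => Finset.sum_congr rfl fun b _ => ?_
    rw [hη b a]; ring
  exact self_eq_neg.1 h

/-- The pairing sees k only through its divergences and its trace, giving four independent
expressions whose coefficients are the obstructions to invariance. -/
theorem IsCayleyForm.sixTerms_symbol_gauge (hΦ : IsCayleyForm Φ) (ρ α β γ lam μ : ℝ) (p v : E8)
    (k : FieldSpace Φ) :
    (sixTerms Φ ρ α β γ lam μ).symbol p (gaugeMap hΦ (tensor p v)) k =
      -((ρ - γ - μ / 2) * ((p ⬝ᵥ p) * (v ⬝ᵥ contr p k.1.1))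
        + (β - γ + μ / 2) * ((p ⬝ᵥ v) * (p ⬝ᵥ contr p k.1.1))
        + (α + β) * ((p ⬝ᵥ p) * ((p ⬝ᵥ v) * tr k.1.1))
        + (4 * lam - μ / 2) * ((p ⬝ᵥ p) * (v ⬝ᵥ contr p k.1.2))) := by
  rw [sixTerms_symbol, gaugeMap_fst, gaugeMap_snd, frob_symPart k.2.1,
    hΦ.frob_asdPart _ k.2.2.1 k.2.2.2, frob_tensor, frob_tensor, tr_symPart_tensor,
    contr_symPart_tensor, hΦ.contr_asdPart_tensor]
  simp only [smul_dotProduct, dotProduct_smul, add_dotProduct, dotProduct_add, sub_dotProduct,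
    smul_eq_mul, dotProduct_contr_self k.2.2.1, dotProduct_comm (contr p k.1.1)]
  ring

theorem isDiffeoInvariant_congr (hΦ : IsCayleyForm Φ) {ℓ ℓ' : Field Φ → E8 → ℝ}
    (h : SameAction ℓ ℓ') : IsDiffeoInvariant ℓ ↔ IsDiffeoInvariant ℓ' := by
  refine forall₂_congr fun ψ hψ => forall₂_congr fun v hv => forall₂_congr fun δ hδ => ?_
  rw [h ψ hψ, h (ψ + δ)]
  rw [(hΦ.isDiffeoVariation_iff v δ).1 hδ]
  exact hψ.add (isTest_gaugeVariation hΦ hv)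

theorem sameAction_sixTerms (ρ α β γ lam μ : ℝ) :
    SameAction (sixTerms Φ ρ α β γ lam μ).density (lagXi ρ α β γ lam μ) := fun ψ hψ => by
  simp only [action, sixTerms_density ρ α β γ lam μ hψ.1]

theorem IsCayleyForm.isDiffeoInvariant_lagXi_iff (hΦ : IsCayleyForm Φ) (ρ α β γ lam μ : ℝ) :
    IsDiffeoInvariant (lagXi (Φ := Φ) ρ α β γ lam μ) ↔
      α = -ρ + μ ∧ β = ρ - μ ∧ γ = ρ - μ / 2 ∧ lam = μ / 8 := by
  rw [← isDiffeoInvariant_congr hΦ (sameAction_sixTerms ρ α β γ lam μ),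
    QuadLagrangian.isDiffeoInvariant_iff hΦ]
  simp only [hΦ.sixTerms_symbol_gauge]
  constructor
  · intro h
    -- The four tests give the first coefficient, the sum of the first three, the third, and the
    -- fourth.
    have h1 := h (Pi.single 0 1) (Pi.single 1 1)
      (symMap Φ (tensor (Pi.single 0 1) (Pi.single 1 1)))
    have h2 := h (Pi.single 0 1) (Pi.single 0 1)
      (symMap Φ (tensor (Pi.single 0 1) (Pi.single 0 1)))
    have h3 := h (Pi.single 0 1) (Pi.single 0 1)
      (symMap Φ (tensor (Pi.single 1 1) (Pi.single 1 1)))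
    have h4 := h (Pi.single 0 1) (Pi.single 1 1)
      (asdMap hΦ (tensor (Pi.single 0 1) (Pi.single 1 1)))
    simp [symMap_fst, symMap_snd, asdMap_fst, asdMap_snd, contr_symPart_tensor,
      hΦ.contr_asdPart_tensor, tr_symPart_tensor, contr_zero, tr_zero] at h1 h2 h3 h4
    refine ⟨?_, ?_, ?_, ?_⟩ <;> linarith
  · rintro ⟨rfl, rfl, rfl, rfl⟩ p v χ
    ring

end Cayley
end

noncomputable section
namespace Cayley

variable {Φ : T4}

/-! ### Classification of the invariant symbols -/

theorem tensor_add_left (u u' w : E8) : tensor (u + u') w = tensor u w + tensor u' w := by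
  funext a b; simp only [tensor, Pi.add_apply]; ring

theorem tensor_add_right (u w w' : E8) : tensor u (w + w') = tensor u w + tensor u w' := by
  funext a b; simp only [tensor, Pi.add_apply]; ring

theorem tensor_smul_left (c : ℝ) (u w : E8) : tensor (c • u) w = c • tensor u w := by
  funext a b; simp only [tensor, Pi.smul_apply, smul_eq_mul]; ring

theorem tensor_smul_right (c : ℝ) (u w : E8) : tensor u (c • w) = c • tensor u w := by
  funext a b; simp only [tensor, Pi.smul_apply, smul_eq_mul]; ring

theorem wedge₂_eq (u w : E8) : wedge₂ u w = tensor u w - tensor w u := rfl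

theorem symMap_tensor_comm (u w : E8) : symMap Φ (tensor u w) = symMap Φ (tensor w u) := by
  refine Subtype.ext (Prod.ext ?_ rfl)
  change symPart (tensor u w) = symPart (tensor w u)
  rw [symPart_tensor, symPart_tensor, add_comm]

/-- Polarisation of squares. This is what allows arbitrary symmetric h to be replaced by u ⊗ u, so
that the symbol becomes a function of vectors. -/
theorem linearMap_eq_zero_of_squares {ℓ : T2 →ₗ[ℝ] ℝ} (h : ∀ u, ℓ (tensor u u) = 0)
    (hs : ∀ u w, ℓ (tensor u w) = ℓ (tensor w u)) (H : T2) : ℓ H = 0 := by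
  have h2 : ∀ u w, ℓ (tensor u w) = 0 := fun u w => by
    have := h (u + w)
    rw [tensor_add_left, tensor_add_right, tensor_add_right, map_add, map_add, map_add, h, h,
      hs w u] at this
    linarith
  rw [T2.eq_sum H]
  simp [h2]

theorem act2_tensor (g : Matrix (Fin 8) (Fin 8) ℝ) (u w : E8) :
    act2 g (tensor u w) = tensor (g.mulVec u) (g.mulVec w) := by
  funext a b
  simp only [act2, tensor, Matrix.mulVec, dotProduct, Finset.sum_mul_sum]
  exact Finset.sum_congr rfl fun i _ => Finset.sum_congr rfl fun j _ => by ring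

theorem act2_sub (g : Matrix (Fin 8) (Fin 8) ℝ) (s t : T2) : act2 g (s - t) = act2 g s - act2 g t := by
  rw [sub_eq_add_neg, act2_add, ← neg_one_smul ℝ t, act2_smul, neg_one_smul, ← sub_eq_add_neg]

theorem act2_symPart (g : Matrix (Fin 8) (Fin 8) ℝ) (H : T2) :
    act2 g (symPart H) = symPart (act2 g H) := by
  have e : symPart H = (1 / 2 : ℝ) • (H + fun a b => H b a) := rfl
  rw [e, act2_smul, act2_add]
  funext a b
  simp only [symPart, act2_transpose_swap g H a b]; rfl

theorem act2_asdPart {g : Matrix (Fin 8) (Fin 8) ℝ} (hg : g ∈ spin7 Φ) (H : T2) :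
    act2 g (asdPart Φ H) = asdPart Φ (act2 g H) := by
  have e : asdPart Φ H = (1 / 2 : ℝ) • (H - fun a b => H b a) - J2 Φ H := rfl
  rw [e, act2_sub, act2_smul, act2_sub, ← J2_act_of_mem_spin7 hg]
  funext a b
  simp only [asdPart, act2_transpose_swap g H a b]; rfl

theorem spinAct_symMap {g : Matrix (Fin 8) (Fin 8) ℝ} (hg : g ∈ spin7 Φ) (H : T2) :
    spinAct hg (symMap Φ H) = symMap Φ (act2 g H) := by
  refine Subtype.ext (Prod.ext (act2_symPart g H) ?_)
  change act2 g 0 = 0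
  funext a b; simp [act2]

theorem spinAct_asdMap (hΦ : IsCayleyForm Φ) {g : Matrix (Fin 8) (Fin 8) ℝ} (hg : g ∈ spin7 Φ)
    (H : T2) : spinAct hg (asdMap hΦ H) = asdMap hΦ (act2 g H) := by
  refine Subtype.ext (Prod.ext ?_ (act2_asdPart hg H))
  change act2 g 0 = 0
  funext a b; simp [act2]

theorem QuadLagrangian.symbol_add_smul (L : QuadLagrangian Φ) (p q : E8) (x y : ℝ)
    (f k : FieldSpace Φ) : L.symbol (x • p + y • q) f k = x ^ 2 * L.symbol p f k +
      y ^ 2 * L.symbol q f k + x * y * (L.symbol (p + q) f k - L.symbol p f k - L.symbol q f k) := by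
  simp only [symbol_apply, Finset.mul_sum, ← Finset.sum_add_distrib, ← Finset.sum_sub_distrib]
  refine Finset.sum_congr rfl fun a _ => Finset.sum_congr rfl fun b _ => ?_
  simp only [Pi.add_apply, Pi.smul_apply, smul_eq_mul]; ring

theorem QuadLagrangian.symbol_smul (L : QuadLagrangian Φ) (p : E8) (x : ℝ) (f k : FieldSpace Φ) :
    L.symbol (x • p) f k = x ^ 2 * L.symbol p f k := by
  have := L.symbol_add_smul p 0 x 0 f k
  simpa using this

theorem QuadLagrangian.symbol_spinAct {L : QuadLagrangian Φ} (hL : IsSpin7Invariant L.density)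
    {g : Matrix (Fin 8) (Fin 8) ℝ} (hg : g ∈ spin7 Φ) (p : E8) (f k : FieldSpace Φ) :
    L.symbol (g.mulVec p) (spinAct hg f) (spinAct hg k) = L.symbol p f k := by
  have h := L.isSpin7Invariant_iff.1 hL g hg p
  rw [symbol_eq_polar, symbol_eq_polar, ← map_add, h, h, h]

theorem differentiable_bilin {D F : Type*} [NormedAddCommGroup D] [NormedSpace ℝ D]
    [NormedAddCommGroup F] [NormedSpace ℝ F] [FiniteDimensional ℝ F] (b : LinearMap.BilinForm ℝ F)
    {f g : D → F} (hf : Differentiable ℝ f) (hg : Differentiable ℝ g) :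
    Differentiable ℝ fun x => b (f x) (g x) := by
  change Differentiable ℝ fun x => b.toContinuousBilinearMap (f x) (g x)
  exact (b.toContinuousBilinearMap.differentiable.comp hf).clm_apply hg

theorem QuadLagrangian.differentiable_symbol (L : QuadLagrangian Φ) (A B : T2 →ₗ[ℝ] FieldSpace Φ)
    {P : E8 × E8 × E8 → E8} {S T : E8 × E8 × E8 → T2} (hP : Differentiable ℝ P)
    (hS : Differentiable ℝ S) (hT : Differentiable ℝ T) :
    Differentiable ℝ fun x => L.symbol (P x) (A (S x)) (B (T x)) := by
  have h : ∀ a b, Differentiable ℝ fun x => L.coeff a b (A (S x)) (B (T x)) := fun a b => by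
    have hA : Differentiable ℝ fun x => A (S x) :=
      (LinearMap.toContinuousLinearMap A).differentiable.comp hS
    have hB : Differentiable ℝ fun x => B (T x) :=
      (LinearMap.toContinuousLinearMap B).differentiable.comp hT
    exact differentiable_bilin _ hA hB
  have hp : ∀ a, Differentiable ℝ fun x => P x a := fun a => differentiable_pi.1 hP a
  simp only [symbol_apply]
  exact Differentiable.fun_sum fun a _ => Differentiable.fun_sum fun b _ =>
    ((hp a).mul (hp b)).mul (h a b)

theorem differentiable_tensor {U W : E8 × E8 × E8 → E8} (hU : Differentiable ℝ U)
    (hW : Differentiable ℝ W) : Differentiable ℝ fun x => tensor (U x) (W x) :=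
  differentiable_pi.2 fun a => differentiable_pi.2 fun b =>
    (differentiable_pi.1 hU a).mul (differentiable_pi.1 hW b)

theorem differentiable_wedge₂ {U W : E8 × E8 × E8 → E8} (hU : Differentiable ℝ U)
    (hW : Differentiable ℝ W) : Differentiable ℝ fun x => wedge₂ (U x) (W x) :=
  (differentiable_tensor hU hW).sub (differentiable_tensor hW hU)

theorem vec₃_eq (x y z : ℝ) :
    vec₃ x y z = x • Pi.single 0 1 + y • Pi.single 1 1 + z • Pi.single 2 1 := by
  funext j
  simp only [Pi.add_apply, Pi.smul_apply]
  fin_cases j <;> simp [vec₃]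

/-- The symbol on squares of vectors. -/
def symSymbol (L : QuadLagrangian Φ) (x : E8 × E8 × E8) : ℝ :=
  L.symbol x.1 (symMap Φ (tensor x.2.1 x.2.1)) (symMap Φ (tensor x.2.2 x.2.2))

/-- The symbol on a square and an element of `Λ²_7`; the arguments are `u`, `p`, `w`. -/
def mixedSymbol (hΦ : IsCayleyForm Φ) (L : QuadLagrangian Φ) (x : E8 × E8 × E8) : ℝ :=
  L.symbol x.2.1 (symMap Φ (tensor x.1 x.1)) (asdMap hΦ (wedge₂ x.1 x.2.2))

/-- The symbol on an element of `Λ²_7`. -/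
def asdSymbol (hΦ : IsCayleyForm Φ) (L : QuadLagrangian Φ) (x : E8 × E8 × E8) : ℝ :=
  L.symbol x.1 (asdMap hΦ (wedge₂ x.2.1 x.2.2)) (asdMap hΦ (wedge₂ x.2.1 x.2.2))

theorem act2_wedge₂ (g : Matrix (Fin 8) (Fin 8) ℝ) (u w : E8) :
    act2 g (wedge₂ u w) = wedge₂ (g.mulVec u) (g.mulVec w) := by
  rw [wedge₂_eq, act2_sub, act2_tensor, act2_tensor, wedge₂_eq]

theorem symSymbol_rotInvariant (hΦ : IsCayleyForm Φ) {L : QuadLagrangian Φ}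
    (hL : IsSpin7Invariant L.density) : IsRotInvariant₃ (symSymbol L) := by
  refine IsSpinInvariant₃.isRotInvariant₃ hΦ (L.differentiable_symbol _ _ differentiable_fst
    (differentiable_tensor differentiable_snd.fst differentiable_snd.fst)
    (differentiable_tensor differentiable_snd.snd differentiable_snd.snd)) fun g hg p u w => ?_
  simp only [symSymbol, ← act2_tensor, ← spinAct_symMap hg, QuadLagrangian.symbol_spinAct hL hg]

theorem mixedSymbol_rotInvariant (hΦ : IsCayleyForm Φ) {L : QuadLagrangian Φ}
    (hL : IsSpin7Invariant L.density) : IsRotInvariant₃ (mixedSymbol hΦ L) := by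
  refine IsSpinInvariant₃.isRotInvariant₃ hΦ (L.differentiable_symbol _ _ differentiable_snd.fst
    (differentiable_tensor differentiable_fst differentiable_fst)
    (differentiable_wedge₂ differentiable_fst differentiable_snd.snd)) fun g hg p u w => ?_
  simp only [mixedSymbol, ← act2_tensor, ← act2_wedge₂, ← spinAct_symMap hg,
    ← spinAct_asdMap hΦ hg, QuadLagrangian.symbol_spinAct hL hg]

theorem asdSymbol_rotInvariant (hΦ : IsCayleyForm Φ) {L : QuadLagrangian Φ}
    (hL : IsSpin7Invariant L.density) : IsRotInvariant₃ (asdSymbol hΦ L) := by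
  refine IsSpinInvariant₃.isRotInvariant₃ hΦ (L.differentiable_symbol _ _ differentiable_fst
    (differentiable_wedge₂ differentiable_snd.fst differentiable_snd.snd)
    (differentiable_wedge₂ differentiable_snd.fst differentiable_snd.snd)) fun g hg p u w => ?_
  simp only [asdSymbol, ← act2_wedge₂, ← spinAct_asdMap hΦ hg,
    QuadLagrangian.symbol_spinAct hL hg]

end Cayley
end

/-! ### Normal forms of the invariant symbols -/

noncomputable section
namespace Cayley

variable {Φ : T4}

/-- The coefficients of the symbol at `e₀` on products of basis vectors. -/
def symCoeff (L : QuadLagrangian Φ) (i j k l : Fin 8) : ℝ :=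
  L.symbol (Pi.single 0 1) (symMap Φ (tensor (Pi.single i 1) (Pi.single j 1)))
    (symMap Φ (tensor (Pi.single k 1) (Pi.single l 1)))

theorem symSymbol_expand (L : QuadLagrangian Φ) (x y z₀ z₁ z₂ : ℝ) :
    symSymbol L (vec₃ 1 0 0, vec₃ x y 0, vec₃ z₀ z₁ z₂) =
      x ^ 2 * (z₀ ^ 2 * symCoeff L 0 0 0 0 + z₁ ^ 2 * symCoeff L 0 0 1 1
        + z₂ ^ 2 * symCoeff L 0 0 2 2 + 2 * z₀ * z₁ * symCoeff L 0 0 0 1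
        + 2 * z₀ * z₂ * symCoeff L 0 0 0 2 + 2 * z₁ * z₂ * symCoeff L 0 0 1 2)
      + 2 * x * y * (z₀ ^ 2 * symCoeff L 0 1 0 0 + z₁ ^ 2 * symCoeff L 0 1 1 1
        + z₂ ^ 2 * symCoeff L 0 1 2 2 + 2 * z₀ * z₁ * symCoeff L 0 1 0 1
        + 2 * z₀ * z₂ * symCoeff L 0 1 0 2 + 2 * z₁ * z₂ * symCoeff L 0 1 1 2)
      + y ^ 2 * (z₀ ^ 2 * symCoeff L 1 1 0 0 + z₁ ^ 2 * symCoeff L 1 1 1 1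
        + z₂ ^ 2 * symCoeff L 1 1 2 2 + 2 * z₀ * z₁ * symCoeff L 1 1 0 1
        + 2 * z₀ * z₂ * symCoeff L 1 1 0 2 + 2 * z₁ * z₂ * symCoeff L 1 1 1 2) := by
  simp only [symSymbol, symCoeff, vec₃_eq, tensor_add_left, tensor_add_right, tensor_smul_left,
    tensor_smul_right, map_add, map_smul, LinearMap.add_apply, LinearMap.smul_apply, smul_eq_mul,
    zero_smul, add_zero, one_smul, symMap_tensor_comm (Pi.single 1 1) (Pi.single 0 1),
    symMap_tensor_comm (Pi.single 2 1) (Pi.single 0 1),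
    symMap_tensor_comm (Pi.single 2 1) (Pi.single 1 1)]
  ring

theorem symSymbol_smul (L : QuadLagrangian Φ) (r : ℝ) (u w : E8) :
    symSymbol L (vec₃ r 0 0, u, w) = r ^ 2 * symSymbol L (vec₃ 1 0 0, u, w) := by
  have e : vec₃ r 0 0 = r • vec₃ 1 0 0 := by simp [vec₃]
  rw [symSymbol, e, QuadLagrangian.symbol_smul]; rfl

/-- The symbol of an invariant Lagrangian on two squares. -/
theorem exists_symSymbol_eq (hΦ : IsCayleyForm Φ) {L : QuadLagrangian Φ}
    (hL : IsSpin7Invariant L.density) : ∃ a b c d : ℝ, ∀ p u w : E8,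
      symSymbol L (p, u, w) = a * ((p ⬝ᵥ p) * (u ⬝ᵥ u) * (w ⬝ᵥ w)) + b * ((p ⬝ᵥ p) * (u ⬝ᵥ w) ^ 2)
        + c * ((p ⬝ᵥ u) ^ 2 * (w ⬝ᵥ w) + (u ⬝ᵥ u) * (p ⬝ᵥ w) ^ 2)
        + d * ((p ⬝ᵥ u) * (u ⬝ᵥ w) * (p ⬝ᵥ w)) := by
  have hF := symSymbol_rotInvariant hΦ hL
  set A := symCoeff L 1 1 2 2
  set B := symCoeff L 1 1 1 1
  set M := symCoeff L 0 0 1 1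
  set D := symCoeff L 0 0 0 0
  set E := symCoeff L 0 1 0 1
  have hN : symCoeff L 1 1 0 0 = M := L.symbol_symm _ _ _
  have hM : symCoeff L 0 0 2 2 = M := by
    have h := hF.swap₁₂ 1 0 0 1 0 0 0 1 0
    simp only [neg_zero, symSymbol_expand] at h
    linarith
  -- Averaging over the four sign changes of coordinates 1 and 2 keeps only monomials even in each
  -- of them.
  have hnf : ∀ x y z₀ z₁ z₂ : ℝ, symSymbol L (vec₃ 1 0 0, vec₃ x y 0, vec₃ z₀ z₁ z₂) =
      x ^ 2 * z₀ ^ 2 * D + (x ^ 2 * z₁ ^ 2 + x ^ 2 * z₂ ^ 2 + y ^ 2 * z₀ ^ 2) * M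
        + y ^ 2 * z₁ ^ 2 * B + y ^ 2 * z₂ ^ 2 * A + 4 * x * y * z₀ * z₁ * E := by
    intro x y z₀ z₁ z₂
    have h1 := hF.flip₁ 1 0 0 x y 0 z₀ z₁ z₂
    have h2 := hF.flip₂ 1 0 0 x y 0 z₀ z₁ z₂
    have h3 := hF.flip₂ 1 0 0 x (-y) 0 z₀ (-z₁) z₂
    simp only [neg_zero, symSymbol_expand, hN, hM] at h1 h2 h3 ⊢
    linear_combination (-1 / 2 : ℝ) * h1 - 1 / 4 * h2 - 1 / 4 * h3
  set a := A
  set b := B - A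
  set c := M - A
  set d := 4 * E - 2 * (B - A)
  set G : E8 → E8 → E8 → ℝ := fun p u w => a * ((p ⬝ᵥ p) * (u ⬝ᵥ u) * (w ⬝ᵥ w))
    + b * ((p ⬝ᵥ p) * (u ⬝ᵥ w) ^ 2) + c * ((p ⬝ᵥ u) ^ 2 * (w ⬝ᵥ w) + (u ⬝ᵥ u) * (p ⬝ᵥ w) ^ 2)
    + d * ((p ⬝ᵥ u) * (u ⬝ᵥ w) * (p ⬝ᵥ w)) with hG
  -- Rotation invariance alone still permits the rational invariant (p·u)²(p·w)²/(p·p); multiplying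
  -- by p·p clears its denominator.
  have key : ∀ p u w : E8, symSymbol L (p, u, w) * (p ⬝ᵥ p) =
      G p u w * (p ⬝ᵥ p) + (D + B - 2 * M - 4 * E) * ((p ⬝ᵥ u) ^ 2 * (p ⬝ᵥ w) ^ 2) := by
    intro p u w
    obtain ⟨r, x, y, z₀, z₁, z₂, h, h1, h2, h3, h4, h5, h6⟩ := hF.exists_vec₃ p u w
    simp only [h, symSymbol_smul, hnf, hG, ← h1, ← h2, ← h3, ← h4, ← h5, ← h6, a, b, c, d]
    ring
  -- The symbol is quadratic in p, but the rational invariant violates the parallelogram law at p =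
  -- e_0 ± e_1 with u = w = e_0, so its coefficient is zero.
  have hδ : D + B - 2 * M - 4 * E = 0 := by
    have h := L.symbol_add_smul (Pi.single 0 1) (Pi.single 1 1) 1 (-1)
      (symMap Φ (tensor (Pi.single 0 1) (Pi.single 0 1)))
      (symMap Φ (tensor (Pi.single 0 1) (Pi.single 0 1)))
    have k1 := key (Pi.single 0 1 + Pi.single 1 1) (Pi.single 0 1) (Pi.single 0 1)
    have k2 := key ((1 : ℝ) • Pi.single 0 1 + (-1 : ℝ) • Pi.single 1 1) (Pi.single 0 1) (Pi.single 0 1)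
    have k3 := key (Pi.single 0 1) (Pi.single 0 1) (Pi.single 0 1)
    have k4 := key (Pi.single 1 1) (Pi.single 0 1) (Pi.single 0 1)
    simp only [symSymbol, h] at k1 k2 k3 k4
    simp [hG] at k1 k2 k3 k4
    linarith
  refine ⟨a, b, c, d, fun p u w => ?_⟩
  by_cases hp : p = 0
  · subst hp
    have : symSymbol L (0, u, w) = 0 := by simp [symSymbol, QuadLagrangian.symbol_apply]
    simp [this]
  · have := key p u w
    rw [hδ, zero_mul, add_zero] at this
    exact mul_right_cancel₀ (dotProduct_self_pos hp).ne' this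

theorem wedge₂_smul_left (c : ℝ) (u w : E8) : wedge₂ (c • u) w = c • wedge₂ u w := by
  funext a b; simp only [wedge₂, Pi.smul_apply, smul_eq_mul]; ring

theorem wedge₂_smul_right (c : ℝ) (u w : E8) : wedge₂ u (c • w) = c • wedge₂ u w := by
  funext a b; simp only [wedge₂, Pi.smul_apply, smul_eq_mul]; ring

theorem wedge₂_add_right (u w w' : E8) : wedge₂ u (w + w') = wedge₂ u w + wedge₂ u w' := by
  funext a b; simp only [wedge₂, Pi.add_apply]; ring

/-- Placing u first puts it along e_0, and u·w = 0 removes the first component of w. The expression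
is then r³ times a quadratic form in p, linear in w, and the sign flips leave only r³xyz₁. -/
theorem exists_mixedSymbol_eq (hΦ : IsCayleyForm Φ) {L : QuadLagrangian Φ}
    (hL : IsSpin7Invariant L.density) : ∃ κ : ℝ, ∀ u p w : E8, u ⬝ᵥ w = 0 →
      mixedSymbol hΦ L (u, p, w) = κ * ((u ⬝ᵥ u) * (p ⬝ᵥ u) * (p ⬝ᵥ w)) := by
  have hF := mixedSymbol_rotInvariant hΦ hL
  set c : Fin 8 → Fin 8 → ℝ := fun i j => L.symbol (Pi.single i 1)
    (symMap Φ (tensor (Pi.single 0 1) (Pi.single 0 1)))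
    (asdMap hΦ (wedge₂ (Pi.single 0 1) (Pi.single j 1)))
  set d : Fin 8 → ℝ := fun j => L.symbol (Pi.single 0 1 + Pi.single 1 1)
    (symMap Φ (tensor (Pi.single 0 1) (Pi.single 0 1)))
    (asdMap hΦ (wedge₂ (Pi.single 0 1) (Pi.single j 1)))
  have hexp : ∀ r x y z₁ z₂ : ℝ, mixedSymbol hΦ L (vec₃ r 0 0, vec₃ x y 0, vec₃ 0 z₁ z₂) =
      r ^ 3 * (z₁ * (x ^ 2 * c 0 1 + y ^ 2 * c 1 1 + x * y * (d 1 - c 0 1 - c 1 1))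
        + z₂ * (x ^ 2 * c 0 2 + y ^ 2 * c 1 2 + x * y * (d 2 - c 0 2 - c 1 2))) := by
    intro r x y z₁ z₂
    simp only [mixedSymbol, vec₃_eq, zero_smul, add_zero, zero_add, tensor_smul_left,
      tensor_smul_right, wedge₂_smul_left, wedge₂_smul_right, wedge₂_add_right, map_add, map_smul,
      LinearMap.smul_apply, smul_eq_mul, QuadLagrangian.symbol_add_smul, c, d]
    ring
  -- This is the coefficient of xy, obtained by polarising in p.
  refine ⟨d 1 - c 0 1 - c 1 1, fun u p w huw => ?_⟩
  obtain ⟨r, x, y, z₀, z₁, z₂, h, h1, h2, h3, h4, h5, h6⟩ := hF.exists_vec₃ u p w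
  have hz : r = 0 ∨ z₀ = 0 := mul_eq_zero.1 (h4.trans huw)
  rw [h, ← h1, dotProduct_comm p u, ← h2, ← h5]
  rcases hz with rfl | rfl
  · have e : vec₃ 0 0 0 = 0 := by simp [vec₃_eq]
    have : tensor (0 : E8) 0 = 0 := by funext a b; simp [tensor]
    simp [mixedSymbol, e, this]
  · have f1 := hF.flip₁ r 0 0 x y 0 0 z₁ z₂
    have f2 := hF.flip₂ r 0 0 x y 0 0 z₁ z₂
    have f3 := hF.flip₂ r 0 0 x (-y) 0 0 (-z₁) z₂
    simp only [neg_zero, hexp] at f1 f2 f3 ⊢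
    linear_combination (-1 / 2 : ℝ) * f1 - 1 / 4 * f2 - 1 / 4 * f3

/-- An orthogonal triple rotates to multiples of e_0, e_1, e_2; homogeneity then leaves a single
constant. -/
theorem exists_asdSymbol_eq (hΦ : IsCayleyForm Φ) {L : QuadLagrangian Φ}
    (hL : IsSpin7Invariant L.density) : ∃ τ : ℝ, ∀ p u w : E8, p ≠ 0 → u ≠ 0 →
      p ⬝ᵥ u = 0 → p ⬝ᵥ w = 0 → u ⬝ᵥ w = 0 →
      asdSymbol hΦ L (p, u, w) = τ * ((p ⬝ᵥ p) * (u ⬝ᵥ u) * (w ⬝ᵥ w)) := by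
  have hF := asdSymbol_rotInvariant hΦ hL
  refine ⟨asdSymbol hΦ L (Pi.single 0 1, Pi.single 1 1, Pi.single 2 1),
    fun p u w hp hu hpu hpw huw => ?_⟩
  obtain ⟨r, x, y, z₀, z₁, z₂, h, h1, h2, h3, h4, h5, h6⟩ := hF.exists_vec₃ p u w
  have hr : r ≠ 0 := by
    rintro rfl
    exact (dotProduct_self_pos hp).ne' (by rw [← h1, mul_zero])
  have hx : x = 0 := (mul_eq_zero.1 (h2.trans hpu)).resolve_left hr
  have hz : z₀ = 0 := (mul_eq_zero.1 (h4.trans hpw)).resolve_left hr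
  subst hx hz
  have hy : y ≠ 0 := by
    rintro rfl
    exact (dotProduct_self_pos hu).ne' (by rw [← h3]; ring)
  have hz1 : z₁ = 0 := by
    have := h5.trans huw
    rw [zero_mul, zero_add] at this
    exact (mul_eq_zero.1 this).resolve_left hy
  subst hz1
  rw [h, ← h1, ← h3, ← h6]
  simp only [asdSymbol, vec₃_eq, zero_smul, add_zero, zero_add, wedge₂_smul_left,
    wedge₂_smul_right, map_smul, LinearMap.smul_apply, smul_eq_mul, QuadLagrangian.symbol_smul]
  ring

end Cayley
end

/-! ### From vectors back to arbitrary field values -/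

noncomputable section
namespace Cayley

variable {Φ : T4}

/-- The Clifford relation contracted with p ⊗ p. It makes the square of the divergence of ξ
equivalent to a Laplacian term, which is why the list of six has no separate term for it. -/
theorem IsCayleyForm.contr_dotProduct_contr (hΦ : IsCayleyForm Φ) {ξ : T2}
    (hξ : ∀ a b, ξ a b = -ξ b a) (h : ∀ a b, J2 Φ ξ a b = -3 * ξ a b) (p : E8) :
    contr p ξ ⬝ᵥ contr p ξ = 1 / 8 * (p ⬝ᵥ p) * frob ξ ξ := by
  rw [← sum_mul_dotProduct]
  have e : ∀ a b, p a * p b * (ξ a ⬝ᵥ ξ b) =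
      if a = b then p a * p a * (1 / 8 * frob ξ ξ) else 0 := by
    intro a b
    rw [dotProduct, hΦ.clifford hξ h]
    split_ifs with hab
    · rw [hab]
    · rw [mul_zero]
  simp only [e, Finset.sum_ite_eq, Finset.mem_univ, if_true, ← Finset.sum_mul]
  change (p ⬝ᵥ p) * _ = _
  ring

theorem apply₂_eq {ξ : T2} (hξ : ∀ a b, ξ a b = -ξ b a) (v : E8) :
    apply₂ ξ v = (-1 : ℝ) • contr v ξ := by
  funext b
  simp only [apply₂, contr, Pi.smul_apply, smul_eq_mul, Finset.mul_sum]
  exact Finset.sum_congr rfl fun a _ => by rw [hξ b a]; ring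

theorem dotProduct_apply₂ (ξ : T2) (p v : E8) : p ⬝ᵥ apply₂ ξ v = v ⬝ᵥ contr p ξ := by
  rw [dotProduct_contr]
  simp only [dotProduct, apply₂, Finset.mul_sum]
  exact Finset.sum_congr rfl fun a _ => Finset.sum_congr rfl fun b _ => by ring

theorem IsCayleyForm.asdMap_wedge_apply (hΦ : IsCayleyForm Φ) {ξ : T2}
    (hξ : ∀ a b, ξ a b = -ξ b a) (h : ∀ a b, J2 Φ ξ a b = -3 * ξ a b) (v : E8) :
    asdMap hΦ (wedge₂ v (apply₂ ξ v)) = (-(v ⬝ᵥ v) / 4) • asdMap hΦ ξ := by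
  refine Subtype.ext (Prod.ext ?_ ?_)
  · change (0 : T2) = _ • (0 : T2)
    rw [smul_zero]
  · change asdPart Φ _ = _ • asdPart Φ ξ
    rw [hΦ.asdPart_wedge_apply hξ h, asdPart_of_mem hξ h, smul_smul]
    congr 1; ring

/-- Write ξ as a multiple of the projection of u ∧ ξu, with the same u as in the square. The symbol
then depends on u, p and ξu only, and ξu is orthogonal to u. -/
theorem exists_symbol_sym_asd (hΦ : IsCayleyForm Φ) {L : QuadLagrangian Φ}
    (hL : IsSpin7Invariant L.density) : ∃ κ : ℝ, ∀ (p u : E8) (ξ : T2),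
      (∀ a b, ξ a b = -ξ b a) → (∀ a b, J2 Φ ξ a b = -3 * ξ a b) →
      L.symbol p (symMap Φ (tensor u u)) (asdMap hΦ ξ) =
        κ * ((p ⬝ᵥ u) * (u ⬝ᵥ contr p ξ)) := by
  obtain ⟨κ, h⟩ := exists_mixedSymbol_eq hΦ hL
  refine ⟨-4 * κ, fun p u ξ hξ hJ => ?_⟩
  by_cases hu : u = 0
  · subst hu
    have : tensor (0 : E8) 0 = 0 := by funext a b; simp [tensor]
    simp [this]
  · have h1 := h u p (apply₂ ξ u) (by rw [dotProduct_apply₂, dotProduct_contr_self hξ])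
    rw [mixedSymbol, hΦ.asdMap_wedge_apply hξ hJ, map_smul, smul_eq_mul, dotProduct_apply₂] at h1
    refine mul_left_cancel₀ (dotProduct_self_pos hu).ne' ?_
    linear_combination (-4) * h1

/-- Represent ξ by v ∧ ξv with v orthogonal to p and to p^aξ_{ab}; then p, v, ξv are mutually
orthogonal, and |ξv|² is known from the Clifford relation. -/
theorem exists_symbol_asd_asd (hΦ : IsCayleyForm Φ) {L : QuadLagrangian Φ}
    (hL : IsSpin7Invariant L.density) : ∃ τ : ℝ, ∀ (p : E8) (ξ : T2),
      (∀ a b, ξ a b = -ξ b a) → (∀ a b, J2 Φ ξ a b = -3 * ξ a b) →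
      L.symbol p (asdMap hΦ ξ) (asdMap hΦ ξ) = τ * ((p ⬝ᵥ p) * frob ξ ξ) := by
  obtain ⟨τ, h⟩ := exists_asdSymbol_eq hΦ hL
  refine ⟨2 * τ, fun p ξ hξ hJ => ?_⟩
  by_cases hp : p = 0
  · simp [hp, QuadLagrangian.symbol_apply]
  obtain ⟨v, hv, hv'⟩ := exists_orthogonal₆ ![p, contr p ξ, 0, 0, 0, 0]
  have hpv : p ⬝ᵥ v = 0 := hv' 0
  have hpw : v ⬝ᵥ contr p ξ = 0 := by rw [dotProduct_comm]; exact hv' 1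
  have h1 := h p v (apply₂ ξ v) hp hv hpv (by rw [dotProduct_apply₂, hpw])
    (by rw [dotProduct_apply₂, dotProduct_contr_self hξ])
  have h2 : apply₂ ξ v ⬝ᵥ apply₂ ξ v = 1 / 8 * (v ⬝ᵥ v) * frob ξ ξ := by
    rw [apply₂_eq hξ, smul_dotProduct, dotProduct_smul, hΦ.contr_dotProduct_contr hξ hJ,
      smul_eq_mul, smul_eq_mul]
    ring
  rw [asdSymbol, hΦ.asdMap_wedge_apply hξ hJ, map_smul, map_smul, LinearMap.smul_apply,
    smul_eq_mul, smul_eq_mul, h2] at h1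
  have hvv := (dotProduct_self_pos hv).ne'
  refine mul_left_cancel₀ hvv (mul_left_cancel₀ hvv ?_)
  linear_combination 16 * h1

theorem frob_symPart_squares (u w : E8) :
    frob (symPart (tensor u u)) (symPart (tensor w w)) = (u ⬝ᵥ w) ^ 2 := by
  rw [frob_symPart (fun a b => by simp only [symPart]; ring), frob_tensor,
    contr_symPart_tensor]
  simp only [dotProduct_smul, dotProduct_add, smul_eq_mul]
  ring

theorem apply_symMap_eq_zero {g : FieldSpace Φ →ₗ[ℝ] ℝ}
    (h : ∀ u, g (symMap Φ (tensor u u)) = 0) (H : T2) : g (symMap Φ H) = 0 :=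
  linearMap_eq_zero_of_squares (ℓ := g.comp (symMap Φ)) h
    (fun u v => by rw [LinearMap.comp_apply, LinearMap.comp_apply, symMap_tensor_comm]) H

/-- Every invariant symbol is a combination of the six terms. -/
theorem exists_quadSymbol_eq_sixTerms (hΦ : IsCayleyForm Φ) {L : QuadLagrangian Φ}
    (hL : IsSpin7Invariant L.density) : ∃ ρ α β γ lam μ : ℝ, ∀ p f,
      L.quadSymbol p f = (sixTerms Φ ρ α β γ lam μ).quadSymbol p f := by
  obtain ⟨a, b, c, d, hhh⟩ := exists_symSymbol_eq hΦ hL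
  obtain ⟨κ, hhx⟩ := exists_symbol_sym_asd hΦ hL
  obtain ⟨τ, hxx⟩ := exists_symbol_asd_asd hΦ hL
  -- Read off from `sixTerms_symbol`, whose overall sign is negative; `asdMap` multiplies ξ by four,
  -- which accounts for 16 and 4.
  refine ⟨-b, -a, -c, d / 2, -τ / 16, κ / 4, fun p f => ?_⟩
  set L₀ := sixTerms Φ (-b) (-a) (-c) (d / 2) (-τ / 16) (κ / 4) with hL₀
  set D : LinearMap.BilinForm ℝ (FieldSpace Φ) := L.symbol p - L₀.symbol p with hD
  have hD' : ∀ f k, D f k = L.symbol p f k - L₀.symbol p f k := fun _ _ => rfl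
  have hsymm : ∀ f k, D f k = D k f := fun f k => by
    rw [hD', hD', L.symbol_symm, L₀.symbol_symm]
  have e1 : ∀ u w, D (symMap Φ (tensor u u)) (symMap Φ (tensor w w)) = 0 := by
    intro u w
    have h1 := hhh p u w
    rw [symSymbol] at h1
    rw [hD', h1, sixTerms_symbol, symMap_fst, symMap_fst, symMap_snd, symMap_snd, contr_zero,
      frob_symPart_squares, tr_symPart_tensor, tr_symPart_tensor, contr_symPart_tensor,
      contr_symPart_tensor]
    simp only [dotProduct_smul, dotProduct_add, smul_dotProduct, add_dotProduct, smul_eq_mul,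
      dotProduct_zero, frob, Pi.zero_apply, mul_zero, Finset.sum_const_zero]
    ring
  have e2 : ∀ H w, D (symMap Φ H) (symMap Φ (tensor w w)) = 0 := fun H w => by
    rw [hsymm]
    exact apply_symMap_eq_zero (fun u => (hsymm _ _).trans (e1 u w)) H
  have e3 : ∀ H K, D (symMap Φ H) (symMap Φ K) = 0 := fun H K =>
    apply_symMap_eq_zero (e2 H) K
  have e4 : ∀ u, D (symMap Φ (tensor u u)) (asdMap hΦ f.1.2) = 0 := by
    intro u
    rw [hD', hhx p u _ f.2.2.1 f.2.2.2, sixTerms_symbol, symMap_fst, symMap_snd, asdMap_fst,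
      asdMap_snd, contr_zero, contr_symPart_tensor, IsCayleyForm.asdPart_of_mem f.2.2.1 f.2.2.2,
      tr_zero, contr_smul]
    simp only [dotProduct_smul, dotProduct_add, smul_dotProduct, add_dotProduct, smul_eq_mul,
      dotProduct_zero, frob, Pi.zero_apply, mul_zero, zero_mul, Finset.sum_const_zero]
    ring
  have e5 : ∀ H, D (symMap Φ H) (asdMap hΦ f.1.2) = 0 := fun H => by
    rw [hsymm]
    exact apply_symMap_eq_zero (fun u => (hsymm _ _).trans (e4 u)) H
  have e6 : D (asdMap hΦ f.1.2) (asdMap hΦ f.1.2) = 0 := by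
    rw [hD', hxx p _ f.2.2.1 f.2.2.2, sixTerms_symbol, asdMap_fst, asdMap_snd, contr_zero,
      IsCayleyForm.asdPart_of_mem f.2.2.1 f.2.2.2, tr_zero, frob_smul_left, frob_smul_right]
    simp only [dotProduct_zero, zero_dotProduct, frob, Pi.zero_apply, mul_zero,
      Finset.sum_const_zero]
    ring
  have e7 : D f f = 0 := by
    have hf := hΦ.eq_symMap_add_asdMap f
    have : D f f = D (symMap Φ f.1.1 + (1 / 4 : ℝ) • asdMap hΦ f.1.2)
        (symMap Φ f.1.1 + (1 / 4 : ℝ) • asdMap hΦ f.1.2) := by rw [← hf]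
    rw [this]
    simp only [map_add, map_smul, LinearMap.add_apply, LinearMap.smul_apply, e3, e5, e6,
      hsymm (asdMap hΦ f.1.2) (symMap Φ f.1.1), smul_zero, add_zero]
  have h1 := L.symbol_self p f
  have h2 := L₀.symbol_self p f
  rw [hD'] at e7
  linarith

end Cayley
end

noncomputable section
namespace Cayley

variable {Φ : T4}

/-! ### The invariant family -/

/-- The diffeomorphism-invariant combinations of the six terms. -/
abbrev familyLag (Φ : T4) (ρ μ : ℝ) : QuadLagrangian Φ :=
  sixTerms Φ ρ (-ρ + μ) (ρ - μ) (ρ - μ / 2) (μ / 8) μ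

theorem lagXi_eq_lagDiff (ρ μ : ℝ) (ψ : Field Φ) (x : E8) :
    lagXi ρ (-ρ + μ) (ρ - μ) (ρ - μ / 2) (μ / 8) μ ψ x = lagDiff ρ μ ψ x := by
  simp only [lagXi, lagDiff, lagGR, lagPrime]; ring

theorem SameAction.symm {ℓ ℓ' : Field Φ → E8 → ℝ} (h : SameAction ℓ ℓ') : SameAction ℓ' ℓ :=
  fun ψ hψ => (h ψ hψ).symm

theorem SameAction.trans {ℓ ℓ' ℓ'' : Field Φ → E8 → ℝ} (h : SameAction ℓ ℓ')
    (h' : SameAction ℓ' ℓ'') : SameAction ℓ ℓ'' := fun ψ hψ => (h ψ hψ).trans (h' ψ hψ)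

theorem sameAction_familyLag (ρ μ : ℝ) :
    SameAction (familyLag Φ ρ μ).density (lagDiff ρ μ) := by
  have h := sameAction_sixTerms (Φ := Φ) ρ (-ρ + μ) (ρ - μ) (ρ - μ / 2) (μ / 8) μ
  rwa [show lagXi ρ (-ρ + μ) (ρ - μ) (ρ - μ / 2) (μ / 8) μ = lagDiff (Φ := Φ) ρ μ from
    funext fun ψ => funext fun x => lagXi_eq_lagDiff ρ μ ψ x] at h

theorem IsCayleyForm.lagDiff_injective (hΦ : IsCayleyForm Φ) {ρ μ ρ' μ' : ℝ}
    (h : SameAction (lagDiff (Φ := Φ) ρ μ) (lagDiff ρ' μ')) : ρ = ρ' ∧ μ = μ' := by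
  have h1 := (QuadLagrangian.sameAction_iff _ _).1
    (((sameAction_familyLag ρ μ).trans h).trans (sameAction_familyLag ρ' μ').symm)
  -- A transverse traceless h detects ρ alone, and a field with h = 0 detects λ = μ/8 alone.
  have h2 := h1 (Pi.single 0 1) (symMap Φ (tensor (Pi.single 1 1) (Pi.single 2 1)))
  have h3 := h1 (Pi.single 0 1) (asdMap hΦ (tensor (Pi.single 0 1) (Pi.single 1 1)))
  have hf : frob (symPart (tensor (Pi.single 1 1) (Pi.single 2 1)))
      (symPart (tensor (Pi.single 1 1) (Pi.single 2 1))) = 1 / 2 := by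
    rw [frob_symPart (fun a b => by simp only [symPart]; ring), frob_tensor,
      contr_symPart_tensor]
    simp
  have hg : frob (asdPart Φ (tensor (Pi.single 0 1) (Pi.single 1 1)))
      (asdPart Φ (tensor (Pi.single 0 1) (Pi.single 1 1))) = 2 := by
    rw [hΦ.frob_asdPart _ (hΦ.asdPart_antisymm _) (hΦ.J2_asdPart _), frob_tensor,
      hΦ.contr_asdPart_tensor]
    simp; norm_num
  simp only [sixTerms_quadSymbol, symMap_fst, symMap_snd, asdMap_fst, asdMap_snd, hf, hg, tr_zero,
    contr_zero, tr_symPart_tensor, contr_symPart_tensor] at h2 h3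
  simp [frob] at h2 h3
  exact ⟨by linarith, by linarith⟩

theorem IsCayleyForm.exists_lagXi (hΦ : IsCayleyForm Φ) (L : QuadLagrangian Φ)
    (hL : IsSpin7Invariant L.density) :
    ∃ ρ α β γ lam μ : ℝ, SameAction L.density (lagXi ρ α β γ lam μ) := by
  obtain ⟨ρ, α, β, γ, lam, μ, h⟩ := exists_quadSymbol_eq_sixTerms hΦ hL
  exact ⟨ρ, α, β, γ, lam, μ, ((QuadLagrangian.sameAction_iff _ _).2 h).trans
    (sameAction_sixTerms ρ α β γ lam μ)⟩

theorem IsCayleyForm.isDiffeoInvariant_iff_lagDiff (hΦ : IsCayleyForm Φ) (L : QuadLagrangian Φ)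
    (hL : IsSpin7Invariant L.density) : IsDiffeoInvariant L.density ↔
      ∃! c : ℝ × ℝ, SameAction L.density (lagDiff c.1 c.2) := by
  constructor
  · intro h
    obtain ⟨ρ, α, β, γ, lam, μ, hs⟩ := hΦ.exists_lagXi L hL
    rw [isDiffeoInvariant_congr hΦ hs, hΦ.isDiffeoInvariant_lagXi_iff] at h
    obtain ⟨rfl, rfl, rfl, rfl⟩ := h
    have hs' : SameAction L.density (lagDiff ρ μ) := by
      intro ψ hψ
      rw [hs ψ hψ]
      exact congrArg (fun ℓ => ∫ x, ℓ x) (funext fun x => lagXi_eq_lagDiff ρ μ ψ x)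
    refine ⟨(ρ, μ), hs', fun c hc => ?_⟩
    obtain ⟨h1, h2⟩ := hΦ.lagDiff_injective (hc.symm.trans hs')
    exact Prod.ext h1 h2
  · rintro ⟨c, hc, -⟩
    rw [isDiffeoInvariant_congr hΦ (hc.trans (sameAction_familyLag c.1 c.2).symm),
      isDiffeoInvariant_congr hΦ (sameAction_sixTerms _ _ _ _ _ _),
      hΦ.isDiffeoInvariant_lagXi_iff]
    exact ⟨rfl, rfl, rfl, rfl⟩

theorem QuadLagrangian.action_smul (L : QuadLagrangian Φ) {ψ : Field Φ} (hψ : ContDiff ℝ ∞ ψ)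
    (c : ℝ) : action L.density (c • ψ) = c ^ 2 * action L.density ψ := by
  have h1 : ∀ φ : Field Φ, ContDiff ℝ ∞ φ → ∀ a, pd a (c • φ) = c • pd a φ :=
    fun φ hφ a => pd_const_smul hφ c a
  have h2 : ∀ x, L.density (c • ψ) x = c ^ 2 * L.density ψ x := fun x => by
    simp only [density, h1 ψ hψ, h1 _ (contDiff_pd hψ _), Finset.mul_sum]
    refine Finset.sum_congr rfl fun a _ => Finset.sum_congr rfl fun b _ => ?_
    simp only [Pi.smul_apply, map_smul, LinearMap.smul_apply, smul_eq_mul]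
    ring
  simp only [action, h2]
  exact MeasureTheory.integral_const_mul _ _

theorem action_lagDiff_smul (ρ μ : ℝ) {ψ : Field Φ} (hψ : IsTest ψ) (c : ℝ) :
    action (lagDiff ρ μ) (c • ψ) = c ^ 2 * action (lagDiff ρ μ) ψ := by
  rw [← sameAction_familyLag ρ μ ψ hψ, ← sameAction_familyLag ρ μ _ (hψ.const_smul c),
    QuadLagrangian.action_smul _ hψ.1]

theorem action_lagDiff_mul (t ρ μ : ℝ) (ψ : Field Φ) :
    action (lagDiff (t * ρ) (t * μ)) ψ = t * action (lagDiff ρ μ) ψ := by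
  rw [action, action, ← MeasureTheory.integral_const_mul]
  refine congrArg (fun ℓ : E8 → ℝ => ∫ x, ℓ x) (funext fun x => ?_)
  simp only [lagDiff]; ring

/-- A rescaling by c multiplies the action by c², so with the sign every nonzero factor t occurs, as
s = sign t and c = √|t|. Two nonzero pairs are related by such a factor exactly when they are
proportional. -/
theorem IsCayleyForm.rescaling_iff (hΦ : IsCayleyForm Φ) {ρ μ ρ' μ' : ℝ}
    (h : (ρ, μ) ≠ (0, 0)) (h' : (ρ', μ') ≠ (0, 0)) :
    (∃ s c : ℝ, (s = 1 ∨ s = -1) ∧ 0 < c ∧ ∀ ψ : Field Φ, IsTest ψ →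
      action (lagDiff ρ' μ') ψ = s * action (lagDiff ρ μ) (c • ψ)) ↔ ρ * μ' = ρ' * μ := by
  constructor
  · rintro ⟨s, c, -, -, hsc⟩
    obtain ⟨h1, h2⟩ := hΦ.lagDiff_injective (ρ := ρ') (μ := μ') (ρ' := s * c ^ 2 * ρ)
      (μ' := s * c ^ 2 * μ) fun ψ hψ => by
        rw [hsc ψ hψ, action_lagDiff_smul ρ μ hψ, action_lagDiff_mul]; ring
    rw [h1, h2]; ring
  · intro hr
    obtain ⟨t, h1, h2⟩ : ∃ t : ℝ, ρ' = t * ρ ∧ μ' = t * μ := by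
      by_cases hρ : ρ = 0
      · have hμ : μ ≠ 0 := fun hμ => h (by rw [hρ, hμ])
        refine ⟨μ' / μ, ?_, by field_simp⟩
        rw [hρ, zero_mul] at hr
        rw [hρ, mul_zero]
        exact (mul_eq_zero.1 hr.symm).resolve_right hμ
      · refine ⟨ρ' / ρ, by field_simp, ?_⟩
        field_simp
        linarith
    have ht : t ≠ 0 := by
      rintro rfl
      exact h' (by rw [h1, h2, zero_mul, zero_mul])
    obtain ⟨s, hs, hst⟩ : ∃ s : ℝ, (s = 1 ∨ s = -1) ∧ s * |t| = t := by
      rcases le_total 0 t with h0 | h0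
      · exact ⟨1, Or.inl rfl, by rw [abs_of_nonneg h0, one_mul]⟩
      · exact ⟨-1, Or.inr rfl, by rw [abs_of_nonpos h0]; ring⟩
    refine ⟨s, Real.sqrt |t|, hs, Real.sqrt_pos.2 (abs_pos.2 ht), fun ψ hψ => ?_⟩
    rw [h1, h2, action_lagDiff_mul, action_lagDiff_smul ρ μ hψ, Real.sq_sqrt (abs_nonneg t),
      ← mul_assoc, hst]

/-! ### The gauge condition -/

/-- The expression `h_{ab} - s δ_{ab} h + t ξ_{ab}` as a linear form. -/
def gaugeForm (Φ : T4) (s t : ℝ) (a b : Fin 8) : FieldSpace Φ →ₗ[ℝ] ℝ :=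
  hForm Φ a b - (s * if a = b then 1 else 0) • trForm Φ + t • xForm Φ a b

theorem gaugeForm_apply (s t : ℝ) (a b : Fin 8) (f : FieldSpace Φ) : gaugeForm Φ s t a b f =
    f.1.1 a b - s * ((if a = b then 1 else 0) * tr f.1.1) + t * f.1.2 a b := by
  simp only [gaugeForm, LinearMap.add_apply, LinearMap.sub_apply, LinearMap.smul_apply,
    hForm_apply, xForm_apply, trForm_apply, smul_eq_mul, mul_assoc]

/-- The Lagrangian whose density is the gauge-fixing square. -/
def gaugeSqLag (Φ : T4) (c s t : ℝ) : QuadLagrangian Φ where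
  A _ _ := 0
  B a b := c • ∑ d, LinearMap.BilinForm.linMulLin (gaugeForm Φ s t a d) (gaugeForm Φ s t b d)

theorem gaugeSqLag_density (c s t : ℝ) {ψ : Field Φ} (hψ : ContDiff ℝ ∞ ψ) (x : E8) :
    (gaugeSqLag Φ c s t).density ψ x = c * gaugeSq s t ψ x := by
  have h : ∀ a b, pd a (fun y => hc ψ a b y - s * ((if a = b then 1 else 0) * trh ψ y)
      + t * xc ψ a b y) x = gaugeForm Φ s t a b (pd a ψ x) := fun a b => by
    have := congrFun (pd_clm hψ (LinearMap.toContinuousLinearMap (gaugeForm Φ s t a b)) a) x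
    simp only [LinearMap.coe_toContinuousLinearMap'] at this
    rw [← this]
    congr 1
    funext y
    rw [gaugeForm_apply]; rfl
  simp only [gaugeSq, h, pow_two, Finset.sum_mul_sum]
  simp only [QuadLagrangian.density, gaugeSqLag, LinearMap.zero_apply, zero_add,
    LinearMap.smul_apply, LinearMap.sum_apply, LinearMap.BilinForm.linMulLin_apply, smul_eq_mul,
    ← Finset.mul_sum]
  rw [Finset.sum_comm_cycle]
  simp only [Finset.mul_sum]

theorem gaugeCondSymbol_eq (s t : ℝ) (p : E8) (f : FieldSpace Φ) : gaugeCondSymbol s t p f =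
    contr p f.1.1 - (s * tr f.1.1) • p + t • contr p f.1.2 := by
  funext b
  have e : ∀ a, p a * (f.1.1 a b - s * ((if a = b then 1 else 0) * ∑ c, f.1.1 c c)
      + t * f.1.2 a b) = p a * f.1.1 a b - (if a = b then s * tr f.1.1 * p a else 0)
        + t * (p a * f.1.2 a b) := fun a => by
    split_ifs
    · simp only [tr]; ring
    · ring
  simp only [gaugeCondSymbol, e, Finset.sum_add_distrib, Finset.sum_sub_distrib,
    ← Finset.mul_sum, Finset.sum_ite_eq', Finset.mem_univ, if_true]
  rfl

theorem gaugeSqLag_quadSymbol (c s t : ℝ) (p : E8) (f : FieldSpace Φ) :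
    (gaugeSqLag Φ c s t).quadSymbol p f =
      c * (gaugeCondSymbol s t p f ⬝ᵥ gaugeCondSymbol s t p f) := by
  have e : ∀ b, gaugeCondSymbol s t p f b = ∑ a, p a * gaugeForm Φ s t a b f := fun b => by
    simp only [gaugeCondSymbol, gaugeForm_apply]; rfl
  simp only [dotProduct, e, Finset.sum_mul_sum]
  simp only [QuadLagrangian.quadSymbol, gaugeSqLag, LinearMap.zero_apply, sub_zero,
    LinearMap.smul_apply, LinearMap.sum_apply, LinearMap.BilinForm.linMulLin_apply, smul_eq_mul,
    Finset.mul_sum]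
  rw [Finset.sum_comm_cycle]
  exact Finset.sum_congr rfl fun d _ => Finset.sum_congr rfl fun a _ =>
    Finset.sum_congr rfl fun b _ => by ring

theorem QuadLagrangian.density_sub (L L' : QuadLagrangian Φ) (ψ : Field Φ) (x : E8) :
    (L.sub L').density ψ x = L.density ψ x - L'.density ψ x := by
  simp only [density, sub, LinearMap.sub_apply, ← Finset.sum_sub_distrib]
  exact Finset.sum_congr rfl fun a _ => Finset.sum_congr rfl fun b _ => by ring

theorem QuadLagrangian.quadSymbol_sub (L L' : QuadLagrangian Φ) (p : E8) (f : FieldSpace Φ) :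
    (L.sub L').quadSymbol p f = L.quadSymbol p f - L'.quadSymbol p f := by
  simp only [quadSymbol, sub, LinearMap.sub_apply, ← Finset.sum_sub_distrib]
  exact Finset.sum_congr rfl fun a _ => Finset.sum_congr rfl fun b _ => by ring

/-- Completing the square in p^a h_{ab} at the level of symbols. The leftover square of p^a ξ_{ab}
is (1/8)|p|²|ξ|², which turns μ²/(4γ) into μ²/(32γ). -/
theorem IsCayleyForm.lagXi_sameAction_gaugeSq (hΦ : IsCayleyForm Φ) (ρ α β lam μ : ℝ) {γ : ℝ}
    (hγ : γ ≠ 0) : SameAction (lagXi (Φ := Φ) ρ α β γ lam μ) (fun ψ x =>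
      ρ / 2 * dhSq ψ x + (α / 2 + β ^ 2 / (4 * γ)) * dtrSq ψ x
        + (lam / 2 + μ ^ 2 / (32 * γ)) * dxSq ψ x
        - γ * gaugeSq (β / (2 * γ)) (μ / (2 * γ)) ψ x) := by
  refine (sameAction_sixTerms ρ α β γ lam μ).symm.trans
    (SameAction.trans (ℓ' := ((sixTerms Φ ρ (α + β ^ 2 / (2 * γ)) 0 0 (lam + μ ^ 2 / (16 * γ))
      0).sub (gaugeSqLag Φ γ (β / (2 * γ)) (μ / (2 * γ)))).density)
      ((QuadLagrangian.sameAction_iff _ _).2 fun p f => ?_) fun ψ hψ => ?_)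
  · rw [QuadLagrangian.quadSymbol_sub, gaugeSqLag_quadSymbol, gaugeCondSymbol_eq,
      sixTerms_quadSymbol, sixTerms_quadSymbol]
    simp only [dotProduct_add, add_dotProduct, dotProduct_sub, sub_dotProduct, smul_dotProduct,
      dotProduct_smul, smul_eq_mul, dotProduct_comm (contr p f.1.2) (contr p f.1.1),
      dotProduct_comm (contr p f.1.2) p, dotProduct_comm (contr p f.1.1) p,
      dotProduct_contr_self f.2.2.1, hΦ.contr_dotProduct_contr f.2.2.1 f.2.2.2]
    field_simp
    ring
  · refine congrArg (fun ℓ : E8 → ℝ => ∫ x, ℓ x) (funext fun x => ?_)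
    rw [QuadLagrangian.density_sub, gaugeSqLag_density _ _ _ hψ.1, sixTerms_density _ _ _ _ _ _ hψ.1,
      lagXi]
    ring

end Cayley
end

noncomputable section
namespace Cayley

variable {Φ : T4}

/-! ### Gauge fixing and ellipticity -/

theorem IsCayleyForm.mem_gaugeDirections (hΦ : IsCayleyForm Φ) (p : E8) (f : FieldSpace Φ) :
    f ∈ gaugeDirections Φ p ↔ ∃ v, f = gaugeMap hΦ (tensor p v) :=
  exists_congr fun _ => hΦ.perturbation_eq_iff

theorem IsCayleyForm.gaugeCondSymbol_gaugeMap (hΦ : IsCayleyForm Φ) (s t : ℝ) (p v : E8) :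
    gaugeCondSymbol s t p (gaugeMap hΦ (tensor p v)) =
      (1 / 2 * (1 + t) * (p ⬝ᵥ p)) • v + ((1 / 2 - s - t / 2) * (p ⬝ᵥ v)) • p := by
  rw [gaugeCondSymbol_eq, gaugeMap_fst, gaugeMap_snd, contr_symPart_tensor,
    hΦ.contr_asdPart_tensor, tr_symPart_tensor]
  funext b
  simp only [Pi.add_apply, Pi.sub_apply, Pi.smul_apply, smul_eq_mul]; ring

theorem gaugeCondSymbol_add (s t : ℝ) (p : E8) (f k : FieldSpace Φ) :
    gaugeCondSymbol s t p (f + k) = gaugeCondSymbol s t p f + gaugeCondSymbol s t p k := by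
  have e1 : (f + k).1.1 = f.1.1 + k.1.1 := rfl
  have e2 : (f + k).1.2 = f.1.2 + k.1.2 := rfl
  rw [gaugeCondSymbol_eq, gaugeCondSymbol_eq, gaugeCondSymbol_eq, e1, e2, contr_add, contr_add,
    tr_add]
  funext b
  simp only [Pi.add_apply, Pi.sub_apply, Pi.smul_apply, smul_eq_mul]; ring

/-- Maps of the form `v ↦ x v + y (p · v) p` are bijective unless degenerate on `p` or on its
orthogonal complement. -/
theorem existsUnique_smul_add {p : E8} {x y : ℝ} (hx : x ≠ 0)
    (hy : x + y * (p ⬝ᵥ p) ≠ 0) (w : E8) : ∃! v : E8, x • v + (y * (p ⬝ᵥ v)) • p = w := by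
  refine ⟨x⁻¹ • w - (x⁻¹ * (y * (x + y * (p ⬝ᵥ p))⁻¹ * (p ⬝ᵥ w))) • p, ?_, fun v hv => ?_⟩
  · simp only [dotProduct_sub, dotProduct_smul, smul_eq_mul]
    funext b
    simp only [Pi.add_apply, Pi.sub_apply, Pi.smul_apply, smul_eq_mul]
    field_simp
    ring
  · have h : p ⬝ᵥ w = (x + y * (p ⬝ᵥ p)) * (p ⬝ᵥ v) := by
      rw [← hv]
      simp only [dotProduct_add, dotProduct_smul, smul_eq_mul]; ring
    rw [h, ← hv]
    funext b
    simp only [Pi.add_apply, Pi.sub_apply, Pi.smul_apply, smul_eq_mul]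
    field_simp
    ring

/-- The gauge condition on p ⊗ v is a linear map of v with eigenvalue (1 + t)|p|²/2 on the
complement of p and (1 - s)|p|² on p, hence invertible. -/
theorem IsCayleyForm.existsUnique_gauge (hΦ : IsCayleyForm Φ) {s t : ℝ} (ht : 1 + t ≠ 0)
    (hs : 1 - s ≠ 0) {p : E8} (hp : p ≠ 0) (f : FieldSpace Φ) :
    ∃! κ : FieldSpace Φ, κ ∈ gaugeDirections Φ p ∧ gaugeCondSymbol s t p (f + κ) = 0 := by
  have hpp := (dotProduct_self_pos hp).ne'
  obtain ⟨v, hv, huniq⟩ := existsUnique_smul_add (x := 1 / 2 * (1 + t) * (p ⬝ᵥ p))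
    (y := 1 / 2 - s - t / 2) (by positivity)
    (by
      rw [show 1 / 2 * (1 + t) * (p ⬝ᵥ p) + (1 / 2 - s - t / 2) * (p ⬝ᵥ p) =
        (1 - s) * (p ⬝ᵥ p) by ring]
      exact mul_ne_zero hs hpp) (-gaugeCondSymbol s t p f)
  refine ⟨gaugeMap hΦ (tensor p v), ⟨(hΦ.mem_gaugeDirections p _).2 ⟨v, rfl⟩, ?_⟩, ?_⟩
  · rw [gaugeCondSymbol_add, hΦ.gaugeCondSymbol_gaugeMap, hv, add_neg_cancel]
  · rintro κ ⟨hκ, hc⟩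
    obtain ⟨v', rfl⟩ := (hΦ.mem_gaugeDirections p _).1 hκ
    rw [gaugeCondSymbol_add, hΦ.gaugeCondSymbol_gaugeMap] at hc
    rw [huniq v' (eq_neg_of_add_eq_zero_right hc)]

theorem QuadLagrangian.symbolKernel_congr {L L' : QuadLagrangian Φ}
    (h : SameAction L.density L'.density) (p : E8) : L.symbolKernel p = L'.symbolKernel p := by
  rw [sameAction_iff] at h
  ext f
  simp only [mem_symbolKernel, symbol_eq_polar, h]

theorem IsCayleyForm.gaugeMap_mem_symbolKernel (hΦ : IsCayleyForm Φ) (ρ μ : ℝ) (p v : E8) :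
    gaugeMap hΦ (tensor p v) ∈ (familyLag Φ ρ μ).symbolKernel p := by
  rw [QuadLagrangian.mem_symbolKernel]
  intro χ
  rw [hΦ.sixTerms_symbol_gauge]; ring

theorem frob_delta (s : T2) : frob s (fun a b => if a = b then 1 else 0) = tr s := by
  simp [frob, tr]

theorem contr_delta (p : E8) : contr p (fun a b => if a = b then 1 else 0) = p := by
  funext b; simp [contr]

theorem tr_delta : tr (fun a b => if a = b then 1 else 0) = 8 := by
  simp [tr]

theorem symPart_delta : symPart (fun a b => if a = b then 1 else 0) =
    fun a b => if a = b then 1 else 0 :=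
  symPart_of_symm fun a b => by simp only [eq_comm]

/-- Elements of the kernel of the symbol that satisfy `p^a h_{ab} = 0` have `h = 0`. -/
theorem fst_eq_zero_of_mem_symbolKernel {ρ μ : ℝ} (hρ : ρ ≠ 0) (hρμ : 7 * μ ≠ 6 * ρ) {p : E8}
    (hp : p ≠ 0) {f : FieldSpace Φ} (hf : f ∈ (familyLag Φ ρ μ).symbolKernel p)
    (h0 : contr p f.1.1 = 0) : f.1.1 = 0 := by
  have hpp := (dotProduct_self_pos hp).ne'
  rw [QuadLagrangian.mem_symbolKernel] at hf
  -- Against δ only the trace survives, with coefficient ρ + 8α + β = 7μ - 6ρ; against h itself the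
  -- term ρ|p|²|h|² then remains.
  have h1 := hf (symMap Φ fun a b => if a = b then 1 else 0)
  have h2 := hf (symMap Φ f.1.1)
  simp only [sixTerms_symbol, symMap_fst, symMap_snd, symPart_delta, symPart_of_symm f.2.1, h0,
    contr_zero, frob_delta, contr_delta, tr_delta, dotProduct_zero, zero_dotProduct, mul_zero,
    dotProduct_contr_self f.2.2.1, show frob f.1.2 0 = 0 by simp [frob]] at h1 h2
  have ht : tr f.1.1 = 0 := by
    have : (7 * μ - 6 * ρ) * ((p ⬝ᵥ p) * tr f.1.1) = 0 := by linear_combination -h1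
    exact (mul_eq_zero.1 ((mul_eq_zero.1 this).resolve_left (sub_ne_zero.2 hρμ))).resolve_left hpp
  rw [ht] at h2
  have : ρ * ((p ⬝ᵥ p) * frob f.1.1 f.1.1) = 0 := by linear_combination -h2
  exact frob_self_eq_zero
    ((mul_eq_zero.1 ((mul_eq_zero.1 this).resolve_left hρ)).resolve_left hpp)

/-- Modulo gauge directions, an element of the kernel of the symbol has `h = 0`. -/
theorem IsCayleyForm.exists_gauge_of_mem_symbolKernel (hΦ : IsCayleyForm Φ) {ρ μ : ℝ}
    (hρ : ρ ≠ 0) (hρμ : 7 * μ ≠ 6 * ρ) {p : E8} (hp : p ≠ 0) {f : FieldSpace Φ}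
    (hf : f ∈ (familyLag Φ ρ μ).symbolKernel p) :
    ∃ v, f - gaugeMap hΦ (tensor p v) ∈ (familyLag Φ ρ μ).symbolKernel p ∧
      f.1.1 = symPart (tensor p v) := by
  have hpp := (dotProduct_self_pos hp).ne'
  -- Choose v so that the symmetric part of p ⊗ v has the same contraction with p as h.
  obtain ⟨v, hv, -⟩ := existsUnique_smul_add (x := 1 / 2 * (p ⬝ᵥ p)) (y := 1 / 2)
    (by positivity) (by rw [← add_mul]; positivity) (contr p f.1.1)
  have hm : f - gaugeMap hΦ (tensor p v) ∈ (familyLag Φ ρ μ).symbolKernel p := by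
    have h := hΦ.gaugeMap_mem_symbolKernel ρ μ p v
    rw [QuadLagrangian.mem_symbolKernel] at hf h ⊢
    intro χ
    rw [map_sub, LinearMap.sub_apply, hf, h, sub_zero]
  refine ⟨v, hm, ?_⟩
  have e : (f - gaugeMap hΦ (tensor p v)).1.1 = f.1.1 + (-1 : ℝ) • symPart (tensor p v) := by
    rw [neg_one_smul, ← sub_eq_add_neg]; rfl
  have h0 := fst_eq_zero_of_mem_symbolKernel hρ hρμ hp hm (by
    rw [e, contr_add, contr_smul, contr_symPart_tensor, ← hv]
    funext b
    simp only [Pi.add_apply, Pi.smul_apply, smul_eq_mul, Pi.zero_apply]; ring)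
  rw [e, neg_one_smul, ← sub_eq_add_neg] at h0
  exact sub_eq_zero.1 h0

theorem snd_eq_zero_of_mem_symbolKernel {ρ μ : ℝ} (hμ : μ ≠ 0) {p : E8} (hp : p ≠ 0)
    {f : FieldSpace Φ} (hf : f ∈ (familyLag Φ ρ μ).symbolKernel p) (h0 : f.1.1 = 0) :
    f.1.2 = 0 := by
  have hpp := (dotProduct_self_pos hp).ne'
  rw [QuadLagrangian.mem_symbolKernel] at hf
  have h1 := hf f
  simp only [sixTerms_symbol, h0, contr_zero, tr_zero, dotProduct_zero, zero_dotProduct, mul_zero,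
    show frob (0 : T2) 0 = 0 by simp [frob]] at h1
  have : μ * ((p ⬝ᵥ p) * frob f.1.2 f.1.2) = 0 := by linear_combination -8 * h1
  exact frob_self_eq_zero
    ((mul_eq_zero.1 ((mul_eq_zero.1 this).resolve_left hμ)).resolve_left hpp)

/-- For μ = 0 also λ = 0, so the symbol ignores ξ, and the condition 7μ ≠ 6ρ reduces to ρ ≠ 0. Only
the step that determines h is needed. -/
theorem IsCayleyForm.mem_symbolKernel_zero_iff (hΦ : IsCayleyForm Φ) {ρ : ℝ} (hρ : ρ ≠ 0) {p : E8}
    (hp : p ≠ 0) (f : FieldSpace Φ) : f ∈ (familyLag Φ ρ 0).symbolKernel p ↔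
      ∃ v : E8, ∀ a b, f.1.1 a b = (1 / 2) * (p a * v b + p b * v a) := by
  constructor
  · intro hf
    obtain ⟨v, -, hv⟩ := hΦ.exists_gauge_of_mem_symbolKernel hρ
      (by rw [mul_zero]; exact fun h => hρ (by linarith)) hp hf
    exact ⟨v, fun a b => by rw [hv]; rfl⟩
  · rintro ⟨v, hv⟩
    have e : f.1.1 = (gaugeMap hΦ (tensor p v)).1.1 := funext fun a => funext fun b => hv a b
    have h := hΦ.gaugeMap_mem_symbolKernel ρ 0 p v
    rw [QuadLagrangian.mem_symbolKernel] at h ⊢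
    intro χ
    have := h χ
    rw [sixTerms_symbol] at this ⊢
    rw [e]
    linear_combination this

theorem IsCayleyForm.familyLag_elliptic (hΦ : IsCayleyForm Φ) {ρ μ : ℝ} (hρ : ρ ≠ 0) (hμ : μ ≠ 0)
    (hρμ : 7 * μ ≠ 6 * ρ) : (familyLag Φ ρ μ).EllipticModuloGauge := by
  intro p hp
  ext f
  rw [hΦ.mem_gaugeDirections]
  constructor
  · intro hf
    obtain ⟨v, hm, hv⟩ := hΦ.exists_gauge_of_mem_symbolKernel hρ hρμ hp hf
    have h1 : (f - gaugeMap hΦ (tensor p v)).1.1 = 0 := sub_eq_zero.2 hv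
    have h2 := snd_eq_zero_of_mem_symbolKernel hμ hp hm h1
    exact ⟨v, sub_eq_zero.1 (Subtype.ext (Prod.ext h1 h2))⟩
  · rintro ⟨v, rfl⟩
    exact hΦ.gaugeMap_mem_symbolKernel ρ μ p v

/-- Each excluded parameter value has an explicit kernel element at p = e_0 that is not a gauge
direction: a transverse traceless h if ρ = 0, a pure ξ if μ = 0, and the transverse metric δ - p ⊗ p
if 7μ = 6ρ. -/
theorem IsCayleyForm.ne_of_elliptic (hΦ : IsCayleyForm Φ) {ρ μ : ℝ}
    (h : (familyLag Φ ρ μ).EllipticModuloGauge) : ρ ≠ 0 ∧ μ ≠ 0 ∧ 7 * μ ≠ 6 * ρ := by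
  have hp : (Pi.single 0 1 : E8) ≠ 0 := by simp
  have key : ∀ f : FieldSpace Φ, (∀ χ, (familyLag Φ ρ μ).symbol (Pi.single 0 1) f χ = 0) →
      ∃ v : E8, f = gaugeMap hΦ (tensor (Pi.single 0 1) v) := fun f hf => by
    rw [← hΦ.mem_gaugeDirections, ← h _ hp, QuadLagrangian.mem_symbolKernel]
    exact hf
  refine ⟨?_, ?_, ?_⟩
  · rintro rfl
    obtain ⟨v, hv⟩ := key (symMap Φ (tensor (Pi.single 1 1) (Pi.single 2 1))) fun χ => by
      rw [sixTerms_symbol, symMap_fst, symMap_snd, contr_symPart_tensor, tr_symPart_tensor,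
        contr_zero]
      simp [frob]
    have := congrFun (congrFun (congrArg (fun f => f.1.1) hv) 1) 2
    simp [symMap_fst, gaugeMap_fst, symPart, tensor] at this
  · rintro rfl
    obtain ⟨v, hv⟩ := key (asdMap hΦ (tensor (Pi.single 0 1) (Pi.single 1 1))) fun χ => by
      rw [sixTerms_symbol, asdMap_fst, contr_zero, tr_zero]
      simp [frob]
    have h1 := congrFun (congrFun (congrArg (fun f => f.1.1) hv) 0) 1
    have h2 := congrFun (congrArg (fun f => contr (Pi.single 0 1) f.1.2) hv) 1
    simp [asdMap_fst, gaugeMap_fst, symPart, tensor] at h1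
    simp [asdMap_snd, gaugeMap_snd, hΦ.contr_asdPart_tensor, h1] at h2
  · intro hρμ
    set H : T2 := (fun a b => if a = b then 1 else 0) +
      (-1 : ℝ) • tensor (Pi.single 0 1) (Pi.single 0 1) with hH
    have hs : symPart H = H := symPart_of_symm fun a b => by
      simp only [hH, tensor, Pi.add_apply, Pi.smul_apply, smul_eq_mul, eq_comm (a := a)]; ring
    obtain ⟨v, hv⟩ := key (symMap Φ H) fun χ => by
      have e1 : tr H = 7 := by
        rw [hH, tr_add, tr_delta]
        simp [tr, tensor, Fin.sum_univ_succ]; norm_num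
      have e2 : contr (Pi.single 0 1) H = 0 := by
        rw [hH, contr_add, contr_delta, contr_smul, contr_tensor]; simp
      have e3 : frob H χ.1.1 = tr χ.1.1 - Pi.single 0 1 ⬝ᵥ contr (Pi.single 0 1) χ.1.1 := by
        rw [hH, frob_add_left, frob_comm, frob_delta, frob_smul_left, frob_tensor]; ring
      rw [sixTerms_symbol, symMap_fst, symMap_snd, hs, e1, e2, e3, contr_zero]
      simp [frob]
      linear_combination (contr (Pi.single 0 1) χ.1.1 0 - tr χ.1.1) * hρμ
    have := congrFun (congrFun (congrArg (fun f => f.1.1) hv) 1) 1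
    simp [symMap_fst, gaugeMap_fst, hH, symPart, tensor] at this

end Cayley
end

namespace Cayley

theorem IsCayleyForm.isDiffeoVariation_iff_components {Φ : T4} (hΦ : IsCayleyForm Φ)
    (v : E8 → E8) (δ : Field Φ) : IsDiffeoVariation Φ v δ ↔ ∀ x a b,
      (δ x).1.1 a b = (1 / 2) * (pd a (fun y => v y b) x + pd b (fun y => v y a) x) ∧
      (δ x).1.2 a b = (1 / 2) * (pd a (fun y => v y b) x - pd b (fun y => v y a) x)
        - (1 / 2) * ∑ p, ∑ q, Φ a b p q * pd p (fun y => v y q) x := by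
  rw [hΦ.isDiffeoVariation_iff]
  constructor
  · rintro rfl x a b
    exact ⟨rfl, rfl⟩
  · intro h
    funext x
    exact Subtype.ext (Prod.ext (funext fun a => funext fun b => (h x a b).1)
      (funext fun a => funext fun b => (h x a b).2))

end Cayley

theorem mainTheorem6 (Φ : Cayley.T4) (hΦ : Cayley.IsCayleyForm Φ) :
    -- transformation of the fields under diffeomorphisms
    (∀ v : Cayley.E8 → Cayley.E8, Cayley.IsTest v →
      (∃ δ : Cayley.Field Φ, Cayley.IsTest δ ∧ Cayley.IsDiffeoVariation Φ v δ) ∧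
      ∀ δ : Cayley.Field Φ, Cayley.IsDiffeoVariation Φ v δ ↔ ∀ x a b,
        (δ x).1.1 a b = (1 / 2) * (Cayley.pd a (fun y => v y b) x + Cayley.pd b (fun y => v y a) x) ∧
        (δ x).1.2 a b = (1 / 2) * (Cayley.pd a (fun y => v y b) x - Cayley.pd b (fun y => v y a) x)
          - (1 / 2) * ∑ p, ∑ q, Φ a b p q * Cayley.pd p (fun y => v y q) x) ∧
    -- the six terms are Lagrangians of the type considered, and there are no others
    (∀ ρ α β γ lam μ : ℝ, ∃ L : Cayley.QuadLagrangian Φ,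
      (∀ ψ : Cayley.Field Φ, ContDiff ℝ ∞ ψ → ∀ x,
        L.density ψ x = Cayley.lagXi ρ α β γ lam μ ψ x) ∧
      Cayley.IsSpin7Invariant L.density) ∧
    (∀ L : Cayley.QuadLagrangian Φ, Cayley.IsSpin7Invariant L.density →
      ∃ ρ α β γ lam μ : ℝ, Cayley.SameAction L.density (Cayley.lagXi ρ α β γ lam μ)) ∧
    -- diffeomorphism invariance fixes the parameters
    (∀ ρ α β γ lam μ : ℝ,
      Cayley.IsDiffeoInvariant (Cayley.lagXi (Φ := Φ) ρ α β γ lam μ) ↔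
        α = -ρ + μ ∧ β = ρ - μ ∧ γ = ρ - μ / 2 ∧ lam = μ / 8) ∧
    (∀ (ρ μ : ℝ) (ψ : Cayley.Field Φ) (x : Cayley.E8),
      Cayley.lagXi ρ (-ρ + μ) (ρ - μ) (ρ - μ / 2) (μ / 8) μ ψ x = Cayley.lagDiff ρ μ ψ x) ∧
    -- the most general diffeomorphism-invariant Lagrangian
    (∀ L : Cayley.QuadLagrangian Φ, Cayley.IsSpin7Invariant L.density →
      (Cayley.IsDiffeoInvariant L.density ↔
        ∃! c : ℝ × ℝ, Cayley.SameAction L.density (Cayley.lagDiff c.1 c.2))) ∧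
    -- up to rescaling of the fields and overall sign only the ratio of the parameters remains
    (∀ ρ μ ρ' μ' : ℝ, (ρ, μ) ≠ (0, 0) → (ρ', μ') ≠ (0, 0) →
      ((∃ s c : ℝ, (s = 1 ∨ s = -1) ∧ 0 < c ∧ ∀ ψ : Cayley.Field Φ, Cayley.IsTest ψ →
          Cayley.action (Cayley.lagDiff ρ' μ') ψ =
            s * Cayley.action (Cayley.lagDiff ρ μ) (c • ψ)) ↔
        ρ * μ' = ρ' * μ)) ∧
    -- the form of the general Lagrangian in which only Laplacians and a gauge condition appear
    (∀ ρ α β γ lam μ : ℝ, γ ≠ 0 →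
      Cayley.SameAction (Cayley.lagXi (Φ := Φ) ρ α β γ lam μ) (fun ψ x =>
        ρ / 2 * Cayley.dhSq ψ x + (α / 2 + β ^ 2 / (4 * γ)) * Cayley.dtrSq ψ x
          + (lam / 2 + μ ^ 2 / (32 * γ)) * Cayley.dxSq ψ x
          - γ * Cayley.gaugeSq (β / (2 * γ)) (μ / (2 * γ)) ψ x)) ∧
    -- in the invariant family this gauge condition can be imposed, in exactly one way
    (∀ ρ μ β γ : ℝ, β = ρ - μ → γ = ρ - μ / 2 → ρ ≠ 0 → γ ≠ 0 →
      ∀ p : Cayley.E8, p ≠ 0 → ∀ f : Cayley.FieldSpace Φ,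
        ∃! κ : Cayley.FieldSpace Φ, κ ∈ Cayley.gaugeDirections Φ p ∧
          Cayley.gaugeCondSymbol (β / (2 * γ)) (μ / (2 * γ)) p (f + κ) = 0) ∧
    -- ellipticity modulo gauge
    (∀ (L : Cayley.QuadLagrangian Φ) (ρ μ : ℝ),
      Cayley.SameAction L.density (Cayley.lagDiff ρ μ) →
        (L.EllipticModuloGauge ↔ ρ ≠ 0 ∧ μ ≠ 0 ∧ 7 * μ ≠ 6 * ρ) ∧
        (ρ ≠ 0 → μ = 0 → ∀ p : Cayley.E8, p ≠ 0 → ∀ f : Cayley.FieldSpace Φ,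
          f ∈ L.symbolKernel p ↔
            ∃ v : Cayley.E8, ∀ a b, f.1.1 a b = (1 / 2) * (p a * v b + p b * v a))) := by
  refine ⟨fun v hv => ⟨⟨_, Cayley.isTest_gaugeVariation hΦ hv,
      (hΦ.isDiffeoVariation_iff v _).2 rfl⟩, fun δ => hΦ.isDiffeoVariation_iff_components v δ⟩,
    fun ρ α β γ lam μ => ⟨_, fun ψ hψ x => Cayley.sixTerms_density ρ α β γ lam μ hψ x,
      Cayley.sixTerms_isSpin7Invariant ρ α β γ lam μ⟩,
    hΦ.exists_lagXi, hΦ.isDiffeoInvariant_lagXi_iff, Cayley.lagXi_eq_lagDiff,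
    hΦ.isDiffeoInvariant_iff_lagDiff, fun ρ μ ρ' μ' => hΦ.rescaling_iff,
    fun ρ α β γ lam μ hγ => hΦ.lagXi_sameAction_gaugeSq ρ α β lam μ hγ, ?_, ?_⟩
  · rintro ρ μ β γ rfl h hρ hγ p hp f
    obtain rfl : μ = 2 * (ρ - γ) := by linarith
    refine hΦ.existsUnique_gauge ?_ ?_ hp f
    -- In the invariant family the two eigenvalue factors are 1 + t = ρ/γ and 1 - s = ρ/(2γ), so ρ ≠
    -- 0 is what makes the gauge condition solvable.
    · rw [show 1 + 2 * (ρ - γ) / (2 * γ) = ρ / γ by field_simp; ring]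
      exact div_ne_zero hρ hγ
    · rw [show 1 - (ρ - 2 * (ρ - γ)) / (2 * γ) = ρ / (2 * γ) by field_simp; ring]
      exact div_ne_zero hρ (mul_ne_zero two_ne_zero hγ)
  · intro L ρ μ hL
    have hk := Cayley.QuadLagrangian.symbolKernel_congr
      (hL.trans (Cayley.sameAction_familyLag ρ μ).symm)
    refine ⟨?_, ?_⟩
    · rw [show L.EllipticModuloGauge ↔ (Cayley.familyLag Φ ρ μ).EllipticModuloGauge by
        simp only [Cayley.QuadLagrangian.EllipticModuloGauge, hk]]
      exact ⟨hΦ.ne_of_elliptic, fun h => hΦ.familyLag_elliptic h.1 h.2.1 h.2.2⟩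
    · rintro hρ rfl p hp f
      rw [hk]
      exact hΦ.mem_symbolKernel_zero_iff hρ hp f
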